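/- Let $k$ be an algebraically closed field; all algebras are finite-dimensional associative unital $k$-algebras and all modules are finite-dimensional left modules. Let $A\neq 0$ be an algebra, let $\Lambda$ index the isomorphism classes of simple $A$-modules $L(\lambda)$, with projective covers $P(\lambda)$ and injective hulls $I(\lambda)$, and let $\le$ be a linear order on $\Lambda$. Put $$\Delta(\lambda)=P(\lambda)\Big/\sum_{\mu>\lambda}\ \sum_{f:P(\mu)\to P(\lambda)}\operatorname{Im} f,\qquad \overline{\Delta}(\lambda)=\Delta(\lambda)\Big/\sum_{f\in\operatorname{rad}\operatorname{End}(\Delta(\lambda))}\operatorname{Im} f,$$ $$\nabla(\lambda)=\bigcap_{\mu>\lambda}\ \bigcap_{f:I(\lambda)\to I(\mu)}\operatorname{Ker} f,\qquad \overline{\nabla}(\lambda)=\bigcap_{f\in\operatorname{rad}\operatorname{End}(\nabla(\lambda))}\operatorname{Ker} f .$$ For a family of modules $\mathcal C$ let $\mathcal F(\mathcal C)$ be the class of modules with a finite filtration whose subquotients are isomorphic to members of $\mathcal C$. The pair $(A,\le)$ is strongly standardly stratified if for every $\lambda$ the kernel of $P(\lambda)\to\Delta(\lambda)$ lies in $\mathcal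 F(\{\Delta(\mu):\mu>\lambda\})$; it is properly stratified if, in addition, $\Delta(\lambda)\in\mathcal F(\{\overline{\Delta}(\lambda)\})$ for all $\lambda$, and quasi-hereditary if it is strongly standardly stratified and $\Delta(\lambda)=\overline{\Delta}(\lambda)$ for all $\lambda$. Modules in $\mathcal F(\Delta)\cap\mathcal F(\overline{\nabla})$ are called tilting, and those in $\mathcal F(\overline{\Delta})\cap\mathcal F(\nabla)$ are called cotilting. A characteristic tilting module is a module $T\cong\bigoplus_{\lambda}T(\lambda)$, where $T(\lambda)$ is an indecomposable tilting module that admits an exact sequence $0\to\Delta(\lambda)\to T(\lambda)\to K\to 0$ with $K\in\mathcal F(\Delta)$. Assume that $(A,\le)$ is quasi-hereditary, let $B$ be a local algebra with simple module $L^{(B)}$, and set $D=A\otimes_k B$, whose simple modules $L^{(D)}(\lambda)\cong L(\lambda)\otimes_k L^{(B)}$ are again indexed by $\Lambda$, with the same order $\le$. Then $(D,\le)$ is properly stratified, and every tilting $D$-module is cotilting if and only if $B$ is self-injective. Likewise, a characteristic tilting $D$-module is cotilting if and only if $B$ is self-injective. -/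

import Mathlib

open TensorProduct

universe u w

namespace Strat

section Modules

variable (A : Type u) [Ring A]

/-- The trace of `M` in `N`: the sum of the images of all homomorphisms `M → N`. -/
def trace (M N : Type u) [AddCommGroup M] [Module A M] [AddCommGroup N] [Module A N] :
    Submodule A N :=
  ⨆ f : M →ₗ[A] N, LinearMap.range f

/-- `P` is a projective cover of `L`: it is projective and maps onto `L` with superfluous kernel. -/
def IsProjectiveCover (P L : Type u) [AddCommGroup P] [Module A P] [AddCommGroup L]
    [Module A L] : Prop :=
  Module.Projective A P ∧ ∃ p : P →ₗ[A] L, Function.Surjective p ∧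
    ∀ N : Submodule A P, N ⊔ LinearMap.ker p = ⊤ → N = ⊤

/-- `I` is an injective hull of `L`: it is injective and contains `L` as an essential submodule. -/
def IsInjectiveHull (I L : Type u) [AddCommGroup I] [Module A I] [AddCommGroup L]
    [Module A L] : Prop :=
  Module.Injective A I ∧ ∃ i : L →ₗ[A] I, Function.Injective i ∧
    ∀ N : Submodule A I, N ⊓ LinearMap.range i = ⊥ → N = ⊥

/-- `M` is indecomposable: it is nonzero and not the direct sum of two nonzero submodules. -/
def IsIndecomposable (M : Type u) [AddCommGroup M] [Module A M] : Prop :=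
  Nontrivial M ∧ ∀ N K : Submodule A M, IsCompl N K → N = ⊥ ∨ K = ⊥

variable {A}

/-- `M` has a finite filtration whose subquotients are isomorphic to members of the family `X`. -/
def HasFiltration {J : Type w} (X : J → ModuleCat.{u} A) (M : Type u) [AddCommGroup M]
    [Module A M] : Prop :=
  ∃ (n : ℕ) (F : ℕ → Submodule A M), F 0 = ⊥ ∧ F n = ⊤ ∧ Monotone F ∧
    ∀ i < n, ∃ j : J, Nonempty ((F (i + 1) ⧸ (F i).submoduleOf (F (i + 1))) ≃ₗ[A] X j)

variable (A)

/-- A complete irredundant family of simple `A`-modules `L l`, indexed by `Λ`, together with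
a choice of projective covers `P l` and injective hulls `I l`. -/
structure SimpleSystem (Λ : Type w) where
  /-- the simple modules -/
  L : Λ → ModuleCat.{u} A
  /-- their projective covers -/
  P : Λ → ModuleCat.{u} A
  /-- their injective hulls -/
  I : Λ → ModuleCat.{u} A
  isSimple : ∀ l, IsSimpleModule A (L l)
  eq_of_iso : ∀ l m, Nonempty (L l ≃ₗ[A] L m) → l = m
  exists_iso : ∀ (M : Type u) [AddCommGroup M] [Module A M] [IsSimpleModule A M],
    ∃ l, Nonempty (M ≃ₗ[A] L l)
  finite_P : ∀ l, Module.Finite A (P l)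
  finite_I : ∀ l, Module.Finite A (I l)
  isProjectiveCover : ∀ l, IsProjectiveCover A (P l) (L l)
  isInjectiveHull : ∀ l, IsInjectiveHull A (I l) (L l)

end Modules

namespace SimpleSystem

variable {A : Type u} [Ring A] {Λ : Type w} [LinearOrder Λ] (S : SimpleSystem A Λ)

/-- The trace of `⨁_{m > l} P m` in `P l`. -/
def traceAbove (l : Λ) : Submodule A (S.P l) :=
  ⨆ m : {m : Λ // l < m}, trace A (S.P m) (S.P l)

/-- The standard module `Δ l = P l / Tr (P l)`. -/
def standard (l : Λ) : ModuleCat.{u} A :=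
  ModuleCat.of A (S.P l ⧸ S.traceAbove l)

/-- The sum of the images of all radical endomorphisms of `Δ l`. -/
def radicalImage (l : Λ) : Submodule A (S.standard l) :=
  ⨆ f ∈ Ring.jacobson (Module.End A (S.standard l)), LinearMap.range f

/-- The proper standard module. -/
def properStandard (l : Λ) : ModuleCat.{u} A :=
  ModuleCat.of A (S.standard l ⧸ S.radicalImage l)

/-- The intersection of the kernels of all homomorphisms from `I l` to `⨁_{m > l} I m`. -/
def kernelAbove (l : Λ) : Submodule A (S.I l) :=
  ⨅ (m : {m : Λ // l < m}) (f : S.I l →ₗ[A] S.I m), LinearMap.ker f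

/-- The costandard module `∇ l`. -/
def costandard (l : Λ) : ModuleCat.{u} A :=
  ModuleCat.of A (S.kernelAbove l)

/-- The intersection of the kernels of all radical endomorphisms of `∇ l`. -/
def radicalKernel (l : Λ) : Submodule A (S.costandard l) :=
  ⨅ f ∈ Ring.jacobson (Module.End A (S.costandard l)), LinearMap.ker f

/-- The proper costandard module. -/
def properCostandard (l : Λ) : ModuleCat.{u} A :=
  ModuleCat.of A (S.radicalKernel l)

/-- `(A, ≤)` is strongly standardly stratified: the kernel of `P l → Δ l` is filtered by the
`Δ m` with `m > l`. -/
def IsSSS : Prop :=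
  ∀ l, HasFiltration (fun m : {m : Λ // l < m} => S.standard m) (S.traceAbove l)

/-- `(A, ≤)` is properly stratified: moreover `Δ l` is filtered by copies of the proper
standard module of the same index. -/
def IsProperlyStratified : Prop :=
  S.IsSSS ∧ ∀ l, HasFiltration (fun _ : Unit => S.properStandard l) (S.standard l)

/-- `(A, ≤)` is quasi-hereditary: it is strongly standardly stratified and the projection of
each `Δ l` onto the proper standard module is an isomorphism. -/
def IsQuasiHereditary : Prop :=
  S.IsSSS ∧ ∀ l, S.radicalImage l = ⊥

/-- Tilting modules: filtered by standard and by proper costandard modules. -/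
def IsTilting (M : Type u) [AddCommGroup M] [Module A M] : Prop :=
  HasFiltration S.standard M ∧ HasFiltration S.properCostandard M

/-- Cotilting modules: filtered by proper standard and by costandard modules. -/
def IsCotilting (M : Type u) [AddCommGroup M] [Module A M] : Prop :=
  HasFiltration S.properStandard M ∧ HasFiltration S.costandard M

/-- `M` is the indecomposable tilting module `T l`: there is an exact sequence
`0 → Δ l → M → Coker → 0` whose cokernel is filtered by standard modules. -/
def IsIndecomposableTilting (l : Λ) (M : Type u) [AddCommGroup M] [Module A M] : Prop :=
  IsIndecomposable A M ∧ S.IsTilting M ∧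
    ∃ i : S.standard l →ₗ[A] M, Function.Injective i ∧
      HasFiltration S.standard (M ⧸ LinearMap.range i)

/-- `M` is a characteristic tilting module, that is `⨁ l, T l` (the index set is finite). -/
def IsCharacteristicTilting (M : Type u) [AddCommGroup M] [Module A M] : Prop :=
  ∃ T : Λ → ModuleCat.{u} A, (∀ l, S.IsIndecomposableTilting l (T l)) ∧
    Nonempty (M ≃ₗ[A] ∀ l, T l)

end SimpleSystem

section Tensor

open scoped ModuleCat

/-- The `A ⊗ B`-module `X` is isomorphic to `M ⊗ N` with the action
`(a ⊗ b) (m ⊗ n) = a m ⊗ b n`. The vector space structures are those induced by the algebra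
structures. -/
def IsExternalTensor (k : Type u) [Field k] {A B : Type u} [Ring A] [Ring B] [Algebra k A]
    [Algebra k B] (M : ModuleCat.{u} A) (N : ModuleCat.{u} B) (X : ModuleCat.{u} (A ⊗[k] B)) :
    Prop :=
  ∃ e : (M ⊗[k] N) ≃ₗ[k] X, ∀ (a : A) (b : B) (m : M) (n : N),
    e ((a • m) ⊗ₜ[k] (b • n)) = (a ⊗ₜ[k] b) • e (m ⊗ₜ[k] n)

end Tensor

end Strat

/-! All structural modules of D = A ⊗ B come from those of A. Let ε : B → k be the augmentation of
the local algebra B. The simple D-modules are the A-modules L(λ) with B acting through ε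
(inflations). Hence P_D(λ) = P(λ) ⊗ B and I_D(λ) = Hom_k(B, I(λ)). Since L(λ) occurs just once in
Δ(λ) and in ∇(λ), this yields Δ_D = Δ ⊗ B and ∇_D = Hom_k(B, ∇), while the proper standard and
proper costandard modules are the inflations of Δ and ∇. Tensoring the filtrations of A with B, and
filtering B by its simple module, shows that D is properly stratified.

Cotilting forces self-injectivity: Hom_k(B, ∇) is injective over B, so a module with a costandard
filtration is B-injective. A nonzero module with a standard filtration maps onto some Δ ⊗ B, hence
B-linearly onto B. If it has both filtrations, B is a direct summand of an injective module
(`IsInflation.injective_of_filt`). This applies to a characteristic tilting module. It also applies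
to Δ_D(λ) for λ minimal, which is tilting because Δ(λ) = L(λ) = ∇(λ).

Self-injectivity makes tilting modules cotilting: a tilting D-module M is B-projective by its
standard filtration, and over A it has a ∇-filtration. For the largest index a that occurs, take M'
in M with M/M' a power of ∇(a) over A and M' filtered by smaller ∇. There are no A-maps M' → ∇(a),
so M' is stable under B. As End ∇(a) = k, one gets M/M' = ∇(a) ⊗ N with N = Hom_A(∇(a), M/M'). This
N is a retract of the B-projective module Hom_A(P(a), M), hence B-projective and filtered by copies
of B. Then M' is again B-projective and the argument repeats (`filt_extTensor_of_filt_bi`). So M is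
filtered by modules ∇ ⊗ B. Because B is local and self-injective, it is isomorphic to its dual, and
∇ ⊗ B is isomorphic to Hom_k(B, ∇) = ∇_D. -/

namespace Strat

/-! ### Filtrations as iterated extensions. -/

section Filtrations

variable {R : Type u} [Ring R] {J : Type w}

/-- The modules obtained from zero by finitely many extensions with members of `X` on top. -/
inductive Filt (X : J → ModuleCat.{u} R) :
    ∀ (M : Type u) [AddCommGroup M] [Module R M], Prop
  | zero (M : Type u) [AddCommGroup M] [Module R M] [Subsingleton M] : Filt X M
  | cons {N M : Type u} [AddCommGroup N] [Module R N] [AddCommGroup M] [Module R M]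
      (i : N →ₗ[R] M) (j : J) (q : M →ₗ[R] X j) (hi : Function.Injective i)
      (hex : Function.Exact i q) (hq : Function.Surjective q) (hN : Filt X N) : Filt X M

variable {X : J → ModuleCat.{u} R}

theorem Filt.of_equiv {M M' : Type u} [AddCommGroup M] [Module R M] [AddCommGroup M'] [Module R M']
    (h : Filt X M) (e : M ≃ₗ[R] M') : Filt X M' := by
  cases h with
  | zero M =>
    have : Subsingleton M' := e.symm.injective.subsingleton
    exact .zero _
  | cons i j q hi hex hq hN =>
    refine .cons (e.toLinearMap ∘ₗ i) j (q ∘ₗ e.symm.toLinearMap) (e.injective.comp hi) ?_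
      (hq.comp e.symm.surjective) hN
    intro x
    obtain ⟨y, rfl⟩ := e.surjective x
    simp [hex y]

theorem Filt.single {M : Type u} [AddCommGroup M] [Module R M] {j : J} (e : M ≃ₗ[R] X j) :
    Filt X M := by
  refine .cons (N := PUnit) 0 j e.toLinearMap (Function.injective_of_subsingleton _) ?_
    e.surjective (.zero _)
  intro x
  simp [eq_comm (a := x)]

/-- Induction on the filtration of `Q`: the preimage in `M` of the submodule below its top factor is
an extension of that submodule by `N`, and the top factor of `Q` becomes that of `M`. -/
theorem Filt.ext {N M Q : Type u} [AddCommGroup N] [Module R N] [AddCommGroup M] [Module R M]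
    [AddCommGroup Q] [Module R Q] (hN : Filt X N) (hQ : Filt X Q) (i : N →ₗ[R] M) (q : M →ₗ[R] Q)
    (hi : Function.Injective i) (hex : Function.Exact i q) (hq : Function.Surjective q) :
    Filt X M := by
  induction hQ generalizing M with
  | zero Q =>
    refine hN.of_equiv (LinearEquiv.ofBijective i ⟨hi, fun x => ?_⟩)
    exact (hex x).1 (Subsingleton.elim _ _)
  | @cons Q' Q _ _ _ _ i' j q' hi' hex' hq' _ ih =>
    let K : Submodule R M := LinearMap.ker (q' ∘ₗ q)
    have hqK : ∀ x : K, q x ∈ LinearMap.range i' := fun x => (hex' _).1 x.2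
    -- On the preimage `K`, the map `q` takes values in the image of `i'`, so it can be read in
    -- `Q'`.
    let g : K →ₗ[R] Q' := (LinearEquiv.ofInjective i' hi').symm.toLinearMap ∘ₗ
      (q ∘ₗ K.subtype).codRestrict (LinearMap.range i') hqK
    have hg : ∀ x, i' (g x) = q x := fun x => by
      have := LinearEquiv.apply_symm_apply (LinearEquiv.ofInjective i' hi')
        ((q ∘ₗ K.subtype).codRestrict (LinearMap.range i') hqK x)
      exact congrArg Subtype.val this
    have hK : Filt X K := by
      refine ih (i.codRestrict K fun x => ?_) g ?_ ?_ ?_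
      · simp [K, hex.apply_apply_eq_zero]
      · intro x y h
        exact hi (congrArg Subtype.val h)
      · intro x
        constructor
        · intro h
          have : q x = 0 := by rw [← hg, h, map_zero]
          obtain ⟨y, hy⟩ := (hex _).1 this
          exact ⟨y, Subtype.ext hy⟩
        · rintro ⟨y, rfl⟩
          apply hi'
          exact (hg _).trans ((hex.apply_apply_eq_zero y).trans (map_zero i').symm)
      · intro y
        obtain ⟨x, hx⟩ := hq (i' y)
        refine ⟨⟨x, ?_⟩, ?_⟩
        · simp [K, hx, hex'.apply_apply_eq_zero]
        · apply hi'
          rw [hg, hx]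
    refine .cons K.subtype j (q' ∘ₗ q) K.injective_subtype ?_ (hq'.comp hq) hK
    intro x
    simp [K]

theorem Filt.quotient {M : Type u} [AddCommGroup M] [Module R M] (N : Submodule R M)
    (hN : Filt X N) (hQ : Filt X (M ⧸ N)) : Filt X M :=
  hN.ext hQ N.subtype N.mkQ N.injective_subtype (LinearMap.exact_subtype_mkQ N) N.mkQ_surjective

theorem Filt.trans {J' : Type*} {Y : J' → ModuleCat.{u} R} {M : Type u} [AddCommGroup M]
    [Module R M] (h : Filt X M) (hY : ∀ j, Filt Y (X j)) : Filt Y M := by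
  induction h with
  | zero M => exact .zero _
  | cons i j q hi hex hq _ ih => exact ih.ext (hY j) i q hi hex hq

theorem Filt.prod {M N : Type u} [AddCommGroup M] [Module R M] [AddCommGroup N] [Module R N]
    (hM : Filt X M) (hN : Filt X N) : Filt X (M × N) :=
  hM.ext hN (.inl R M N) (.snd R M N) LinearMap.inl_injective
    (by intro x; simp [Prod.ext_iff, eq_comm]) LinearMap.snd_surjective

theorem Filt.pi_fin {n : ℕ} {T : Fin n → Type u} [∀ i, AddCommGroup (T i)] [∀ i, Module R (T i)]
    (h : ∀ i, Filt X (T i)) : Filt X (∀ i, T i) := by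
  induction n with
  | zero => exact .zero _
  | succ n ih =>
    exact ((h 0).prod (ih fun i => h i.succ)).of_equiv (Fin.consLinearEquiv R T)

theorem Filt.pi {ι : Type*} [Finite ι] {M : Type u} [AddCommGroup M] [Module R M]
    {T : ι → Type u} [∀ i, AddCommGroup (T i)] [∀ i, Module R (T i)]
    (h : ∀ i, Filt X (T i)) (e : M ≃ₗ[R] ∀ i, T i) : Filt X M := by
  obtain ⟨n, ⟨f⟩⟩ := Finite.exists_equiv_fin ι
  exact (Filt.pi_fin fun i => h (f.symm i)).of_equiv
    (e.trans (LinearEquiv.piCongrLeft' R T f)).symm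

theorem Filt.hasFiltration {M : Type u} [AddCommGroup M] [Module R M] (h : Filt X M) :
    HasFiltration X M := by
  induction h with
  | zero M => exact ⟨0, fun _ => ⊥, rfl, Subsingleton.elim _ _, monotone_const, by simp⟩
  | @cons N M _ _ _ _ i j q hi hex hq _ ih =>
    obtain ⟨n, F, h0, hn, hmono, hF⟩ := ih
    -- The chain is indexed by all of `ℕ`: images of the old chain up to `n`, and `⊤` from `n + 1`
    -- on.
    let G : ℕ → Submodule R M := fun m => if m ≤ n then (F m).map i else ⊤
    have hG : ∀ m ≤ n, G m = (F m).map i := fun m hm => if_pos hm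
    have hG' : G (n + 1) = ⊤ := if_neg (by omega)
    refine ⟨n + 1, G, ?_, hG', ?_, ?_⟩
    · rw [hG 0 n.zero_le, h0, Submodule.map_bot]
    · intro a b hab
      by_cases hb : b ≤ n
      · rw [hG a (hab.trans hb), hG b hb]
        exact Submodule.map_mono (hmono hab)
      · simp [G, hb]
    · intro m hm
      rcases Nat.lt_succ_iff_lt_or_eq.1 hm with hm | rfl
      · obtain ⟨j', ⟨e⟩⟩ := hF m hm
        refine ⟨j', ⟨?_ ≪≫ₗ e⟩⟩
        rw [hG m hm.le, hG (m + 1) hm]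
        let e' := Submodule.equivMapOfInjective i hi (F (m + 1))
        refine (Submodule.Quotient.equiv _ _ e' ?_).symm
        ext x
        simp only [Submodule.mem_map, Submodule.submoduleOf, Submodule.mem_comap,
          Submodule.subtype_apply]
        constructor
        · rintro ⟨y, hy, rfl⟩
          exact ⟨y, hy, rfl⟩
        · rintro ⟨y, hy, hyx⟩
          refine ⟨⟨y, hmono (Nat.le_succ m) hy⟩, hy, Subtype.ext hyx⟩
      · refine ⟨j, ⟨?_⟩⟩
        rw [hG m le_rfl, hG', hn, Submodule.map_top]
        have hqt : Function.Surjective (q ∘ₗ (⊤ : Submodule R M).subtype) := fun y => by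
          obtain ⟨x, rfl⟩ := hq y
          exact ⟨⟨x, trivial⟩, rfl⟩
        refine (Submodule.quotEquivOfEq _ _ ?_).trans (LinearMap.quotKerEquivOfSurjective _ hqt)
        ext x
        exact (hex x).symm

theorem HasFiltration.filt {M : Type u} [AddCommGroup M] [Module R M] (h : HasFiltration X M) :
    Filt X M := by
  obtain ⟨n, F, h0, hn, hmono, hF⟩ := h
  have key : ∀ m ≤ n, Filt X (F m) := by
    intro m
    induction m with
    | zero =>
      intro _
      have : Subsingleton (F 0) := by rw [h0]; infer_instance
      exact .zero _
    | succ m ih =>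
      intro hm
      obtain ⟨j, ⟨e⟩⟩ := hF m hm
      refine Filt.quotient ((F m).submoduleOf (F (m + 1))) ?_ (.single e)
      exact (ih (by omega)).of_equiv
        (Submodule.submoduleOfEquivOfLe (hmono (Nat.le_succ m))).symm
  exact (key n le_rfl).of_equiv ((LinearEquiv.ofEq _ _ hn).trans Submodule.topEquiv)

theorem hasFiltration_iff {M : Type u} [AddCommGroup M] [Module R M] :
    HasFiltration X M ↔ Filt X M :=
  ⟨HasFiltration.filt, Filt.hasFiltration⟩

end Filtrations

/-! ### Projective covers, injective hulls and local endomorphism rings. -/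

section Covers

variable {R : Type u} [Ring R]

/-- The kernel of `p` is maximal, so a submodule outside it would span everything together with it.
Thus `ker p` is the unique maximal submodule. -/
theorem le_ker_of_superfluous {P L : Type u} [AddCommGroup P] [Module R P] [AddCommGroup L]
    [Module R L] [IsSimpleModule R L] {p : P →ₗ[R] L} (hp : Function.Surjective p)
    (hs : ∀ N : Submodule R P, N ⊔ LinearMap.ker p = ⊤ → N = ⊤) {N : Submodule R P}
    (hN : N ≠ ⊤) : N ≤ LinearMap.ker p := by
  have hco : IsCoatom (LinearMap.ker p) := LinearMap.isCoatom_ker_of_surjective hp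
  by_contra h
  exact hN (hs N (hco.2 _ (lt_of_le_of_ne le_sup_right fun h' => h (h' ▸ le_sup_left))))

/-- Dually, the image of the simple module is the unique minimal submodule. -/
theorem range_le_of_essential {I L : Type u} [AddCommGroup I] [Module R I] [AddCommGroup L]
    [Module R L] [IsSimpleModule R L] {i : L →ₗ[R] I}
    (hs : ∀ N : Submodule R I, N ⊓ LinearMap.range i = ⊥ → N = ⊥) {N : Submodule R I}
    (hN : N ≠ ⊥) : LinearMap.range i ≤ N := by
  have h : N.comap i ≠ ⊥ := by
    intro h
    refine hN (hs N ?_)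
    rw [eq_bot_iff]
    rintro _ ⟨hx, y, rfl⟩
    have : y ∈ N.comap i := hx
    rw [h, Submodule.mem_bot] at this
    simp [this]
  have := (eq_bot_or_eq_top _).resolve_left h
  rintro _ ⟨y, rfl⟩
  have hy : y ∈ N.comap i := this ▸ trivial
  exact hy

/-- A lift of `p` through `q` is onto because `ker q` is superfluous. It splits because `Q` is
projective, and the section is onto because `ker p` is superfluous. -/
theorem IsProjectiveCover.nonempty_equiv {P Q L : Type u} [AddCommGroup P] [Module R P]
    [AddCommGroup Q] [Module R Q] [AddCommGroup L] [Module R L]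
    (hP : IsProjectiveCover R P L) (hQ : IsProjectiveCover R Q L) : Nonempty (P ≃ₗ[R] Q) := by
  obtain ⟨_, p, hp, hps⟩ := hP
  obtain ⟨_, q, hq, hqs⟩ := hQ
  obtain ⟨f, hf⟩ := Module.projective_lifting_property q p hq
  have hfs : Function.Surjective f := by
    rw [← LinearMap.range_eq_top]
    refine hqs _ (eq_top_iff.2 fun y _ => ?_)
    obtain ⟨x, hx⟩ := hp (q y)
    refine Submodule.mem_sup.2 ⟨f x, ⟨x, rfl⟩, y - f x, ?_, by abel⟩
    have := LinearMap.congr_fun hf x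
    simp only [LinearMap.comp_apply] at this
    simp [this, hx]
  obtain ⟨s, hs⟩ := f.exists_rightInverse_of_surjective (LinearMap.range_eq_top.2 hfs)
  have hs' : ∀ y, f (s y) = y := fun y => LinearMap.congr_fun hs y
  have hst : LinearMap.range s = ⊤ := by
    refine hps _ (eq_top_iff.2 fun x _ => ?_)
    refine Submodule.mem_sup.2 ⟨s (f x), ⟨_, rfl⟩, x - s (f x), ?_, by abel⟩
    rw [← hf]
    simp [hs']
  refine ⟨LinearEquiv.ofBijective f ⟨fun x y hxy => ?_, hfs⟩⟩
  obtain ⟨x, rfl⟩ := LinearMap.range_eq_top.1 hst x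
  obtain ⟨y, rfl⟩ := LinearMap.range_eq_top.1 hst y
  rw [hs', hs'] at hxy
  rw [hxy]

theorem IsInjectiveHull.nonempty_equiv {P Q L : Type u} [AddCommGroup P] [Module R P]
    [AddCommGroup Q] [Module R Q] [AddCommGroup L] [Module R L]
    (hP : IsInjectiveHull R P L) (hQ : IsInjectiveHull R Q L) : Nonempty (P ≃ₗ[R] Q) := by
  obtain ⟨hPi, p, hp, hps⟩ := hP
  obtain ⟨hQi, q, hq, hqs⟩ := hQ
  obtain ⟨f, hf⟩ := hQi.out p hp q
  have hfi : Function.Injective f := by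
    rw [← LinearMap.ker_eq_bot]
    refine hps _ (eq_bot_iff.2 ?_)
    rintro _ ⟨hx, y, rfl⟩
    have h0 : q y = 0 := by rw [← hf]; exact hx
    rw [hq (h0.trans (map_zero q).symm), map_zero]
    exact Submodule.zero_mem _
  obtain ⟨r, hr⟩ := hPi.out f hfi LinearMap.id
  have hrk : LinearMap.ker r = ⊥ := by
    refine hqs _ (eq_bot_iff.2 ?_)
    rintro _ ⟨hx, y, rfl⟩
    have h0 : p y = 0 := by rw [← LinearMap.id_apply (R := R) (p y), ← hr, hf]; exact hx
    rw [hp (h0.trans (map_zero p).symm), map_zero]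
    exact Submodule.zero_mem _
  refine ⟨LinearEquiv.ofBijective f ⟨hfi, fun y => ⟨r y, ?_⟩⟩⟩
  apply LinearMap.ker_eq_bot.1 hrk
  rw [hr]
  rfl

theorem IsProjectiveCover.of_equiv {P L L' : Type u} [AddCommGroup P] [Module R P]
    [AddCommGroup L] [Module R L] [AddCommGroup L'] [Module R L']
    (hP : IsProjectiveCover R P L) (e : L ≃ₗ[R] L') : IsProjectiveCover R P L' := by
  obtain ⟨h, p, hp, hps⟩ := hP
  refine ⟨h, e.toLinearMap ∘ₗ p, e.surjective.comp hp, fun N hN => hps N ?_⟩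
  rwa [LinearMap.ker_comp_of_ker_eq_bot _ e.ker] at hN

theorem IsInjectiveHull.of_equiv {P L L' : Type u} [AddCommGroup P] [Module R P]
    [AddCommGroup L] [Module R L] [AddCommGroup L'] [Module R L']
    (hP : IsInjectiveHull R P L) (e : L' ≃ₗ[R] L) : IsInjectiveHull R P L' := by
  obtain ⟨h, p, hp, hps⟩ := hP
  refine ⟨h, p ∘ₗ e.toLinearMap, hp.comp e.injective, fun N hN => hps N ?_⟩
  rwa [LinearMap.range_comp_of_range_eq_top _ e.range] at hN

theorem mem_ringJacobson_iff {E : Type*} [Ring E] (f : E) :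
    f ∈ Ring.jacobson E ↔ ∀ y, ∃ z, z * (y * f + 1) = 1 := by
  rw [← Ideal.jacobson_bot, Ideal.mem_jacobson_iff]
  simp [sub_eq_zero, mul_add, mul_assoc]

/-- If `f` is not onto, then neither is `y * f`, so its image lies in the unique maximal submodule.
Hence `y * f + 1` is onto modulo that submodule, thus onto, thus bijective since `M` is noetherian.
-/
theorem mem_jacobson_end_iff_of_superfluous {M L : Type u} [AddCommGroup M] [Module R M]
    [IsNoetherian R M] [AddCommGroup L] [Module R L] [IsSimpleModule R L] {p : M →ₗ[R] L}
    (hp : Function.Surjective p)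
    (hs : ∀ N : Submodule R M, N ⊔ LinearMap.ker p = ⊤ → N = ⊤) (f : Module.End R M) :
    f ∈ Ring.jacobson (Module.End R M) ↔ ¬ Function.Surjective f := by
  have hbij : ∀ g : Module.End R M, Function.Surjective g → Function.Bijective g := fun g hg =>
    ⟨IsNoetherian.injective_of_surjective_endomorphism g hg, hg⟩
  have := IsSimpleModule.nontrivial R L
  have : Nontrivial M := hp.nontrivial
  rw [mem_ringJacobson_iff]
  constructor
  · intro h hf
    obtain ⟨u, rfl⟩ := (Module.End.isUnit_iff f).2 (hbij f hf)
    -- For `y = -u⁻¹` the criterion would read `z * 0 = 1`.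
    obtain ⟨z, hz⟩ := h (-(↑u⁻¹ : Module.End R M))
    simp at hz
  · intro hf y
    have hy : ¬ Function.Surjective (y * f) := by
      intro h
      have hy := hbij y (Function.Surjective.of_comp (g := f) h)
      refine hf fun x => ?_
      obtain ⟨w, hw⟩ := h (y x)
      exact ⟨w, hy.1 hw⟩
    have hr := le_ker_of_superfluous hp hs (fun h => hy (LinearMap.range_eq_top.1 h))
    have hsurj : Function.Surjective (y * f + 1 : Module.End R M) := by
      rw [← LinearMap.range_eq_top]
      refine hs _ (eq_top_iff.2 fun x _ => ?_)
      refine Submodule.mem_sup.2 ⟨_, ⟨x, rfl⟩, -(y * f) x, Submodule.neg_mem _ (hr ⟨x, rfl⟩), ?_⟩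
      simp
    obtain ⟨u, hu⟩ := (Module.End.isUnit_iff _).2 (hbij _ hsurj)
    exact ⟨↑u⁻¹, by rw [← hu, Units.inv_mul]⟩

/-- If `f` is not injective, it kills the simple socle. There `y * f + 1` is the identity, so it is
injective, hence bijective since `M` is artinian. -/
theorem mem_jacobson_end_iff_of_essential {M L : Type u} [AddCommGroup M] [Module R M]
    [IsArtinian R M] [AddCommGroup L] [Module R L] [IsSimpleModule R L] {i : L →ₗ[R] M}
    (hi : Function.Injective i)
    (hs : ∀ N : Submodule R M, N ⊓ LinearMap.range i = ⊥ → N = ⊥) (f : Module.End R M) :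
    f ∈ Ring.jacobson (Module.End R M) ↔ ¬ Function.Injective f := by
  have hbij : ∀ g : Module.End R M, Function.Injective g → Function.Bijective g := fun g hg =>
    ⟨hg, IsArtinian.surjective_of_injective_endomorphism g hg⟩
  have := IsSimpleModule.nontrivial R L
  have : Nontrivial M := hi.nontrivial
  rw [mem_ringJacobson_iff]
  constructor
  · intro h hf
    obtain ⟨u, rfl⟩ := (Module.End.isUnit_iff f).2 (hbij f hf)
    obtain ⟨z, hz⟩ := h (-(↑u⁻¹ : Module.End R M))
    simp at hz
  · intro hf y
    have hk := range_le_of_essential hs (fun h => hf (LinearMap.ker_eq_bot.1 h))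
    have hinj : Function.Injective (y * f + 1 : Module.End R M) := by
      rw [← LinearMap.ker_eq_bot]
      by_contra h
      obtain ⟨x, hx⟩ := exists_ne (0 : L)
      have h1 := range_le_of_essential hs h ⟨x, rfl⟩
      have h2 := hk ⟨x, rfl⟩
      rw [LinearMap.mem_ker] at h1 h2
      simp only [LinearMap.add_apply, Module.End.mul_apply, h2, map_zero, zero_add,
        Module.End.one_apply] at h1
      exact hx (hi (h1.trans (map_zero i).symm))
    obtain ⟨u, hu⟩ := (Module.End.isUnit_iff _).2 (hbij _ hinj)
    exact ⟨↑u⁻¹, by rw [← hu, Units.inv_mul]⟩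

end Covers

end Strat

namespace Strat

/-! ### Standard and costandard modules over a single ring. -/

namespace SimpleSystem

variable {A : Type u} [Ring A] {Λ : Type w} (S : SimpleSystem A Λ)

instance (l : Λ) : IsSimpleModule A (S.L l) := S.isSimple l

instance (l : Λ) : Module.Finite A (S.P l) := S.finite_P l

instance (l : Λ) : Module.Finite A (S.I l) := S.finite_I l

instance (l : Λ) : Module.Projective A (S.P l) := (S.isProjectiveCover l).1

/-- The projection of the projective cover onto the simple module. -/
noncomputable def cover (l : Λ) : S.P l →ₗ[A] S.L l := (S.isProjectiveCover l).2.choose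

theorem cover_surjective (l : Λ) : Function.Surjective (S.cover l) :=
  (S.isProjectiveCover l).2.choose_spec.1

theorem cover_superfluous (l : Λ) (N : Submodule A (S.P l))
    (h : N ⊔ LinearMap.ker (S.cover l) = ⊤) : N = ⊤ :=
  (S.isProjectiveCover l).2.choose_spec.2 N h

/-- The embedding of the simple module into its injective hull. -/
noncomputable def hull (l : Λ) : S.L l →ₗ[A] S.I l := (S.isInjectiveHull l).2.choose

theorem hull_injective (l : Λ) : Function.Injective (S.hull l) :=
  (S.isInjectiveHull l).2.choose_spec.1

theorem hull_essential (l : Λ) (N : Submodule A (S.I l))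
    (h : N ⊓ LinearMap.range (S.hull l) = ⊥) : N = ⊥ :=
  (S.isInjectiveHull l).2.choose_spec.2 N h

theorem hull_comp_cover_ne_zero (l : Λ) : S.hull l ∘ₗ S.cover l ≠ 0 := by
  have := IsSimpleModule.nontrivial A (S.L l)
  obtain ⟨y, hy⟩ := exists_ne (0 : S.L l)
  obtain ⟨x, rfl⟩ := S.cover_surjective l y
  intro h
  exact hy (S.hull_injective l ((LinearMap.congr_fun h x).trans (map_zero _).symm))

/-- A nonzero submodule of `I l` contains its socle, so `P l → L l → I l` lands in the image of `g`
and lifts by projectivity. -/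
theorem exists_comp_of_hom_to_hull {N : Type u} [AddCommGroup N] [Module A N] {l : Λ}
    {g : N →ₗ[A] S.I l} (hg : g ≠ 0) : ∃ f : S.P l →ₗ[A] N, g ∘ₗ f = S.hull l ∘ₗ S.cover l := by
  have hr : LinearMap.range (S.hull l) ≤ LinearMap.range g :=
    range_le_of_essential (S.hull_essential l) (fun h => hg (LinearMap.range_eq_bot.1 h))
  obtain ⟨f, hf⟩ := Module.projective_lifting_property g.rangeRestrict
    ((S.hull l ∘ₗ S.cover l).codRestrict (LinearMap.range g) fun x => hr ⟨_, rfl⟩)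
    g.surjective_rangeRestrict
  exact ⟨f, LinearMap.ext fun x => congrArg Subtype.val (LinearMap.congr_fun hf x)⟩

theorem exists_comp_of_hom_from_cover {N : Type u} [AddCommGroup N] [Module A N] {l : Λ}
    {f : S.P l →ₗ[A] N} (hf : f ≠ 0) : ∃ g : N →ₗ[A] S.I l, g ∘ₗ f = S.hull l ∘ₗ S.cover l := by
  have hk : LinearMap.ker f ≤ LinearMap.ker (S.cover l) :=
    le_ker_of_superfluous (S.cover_surjective l) (S.cover_superfluous l)
      (fun h => hf (LinearMap.ker_eq_top.1 h))
  have hk' : LinearMap.ker f ≤ LinearMap.ker (S.hull l ∘ₗ S.cover l) :=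
    hk.trans (LinearMap.ker_le_ker_comp _ _)
  obtain ⟨g, hg⟩ := (S.isInjectiveHull l).1.out ((LinearMap.ker f).liftQ f le_rfl)
    (LinearMap.ker_eq_bot.1 (Submodule.ker_liftQ_eq_bot _ _ _ le_rfl))
    ((LinearMap.ker f).liftQ (S.hull l ∘ₗ S.cover l) hk')
  exact ⟨g, LinearMap.ext fun x => hg (Submodule.Quotient.mk x)⟩

/-- For modules of finite length both sides say that `L l` is not a composition factor of `N`. This
bridge moves vanishing statements between covers and hulls without counting multiplicities. -/
theorem hom_to_hull_eq_zero_iff {N : Type u} [AddCommGroup N] [Module A N] {l : Λ} :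
    (∀ g : N →ₗ[A] S.I l, g = 0) ↔ ∀ f : S.P l →ₗ[A] N, f = 0 := by
  constructor
  · intro h f
    by_contra hf
    obtain ⟨g, hg⟩ := S.exists_comp_of_hom_from_cover hf
    rw [h g, LinearMap.zero_comp] at hg
    exact S.hull_comp_cover_ne_zero l hg.symm
  · intro h g
    by_contra hg
    obtain ⟨f, hf⟩ := S.exists_comp_of_hom_to_hull hg
    rw [h f, LinearMap.comp_zero] at hf
    exact S.hull_comp_cover_ne_zero l hf.symm

/-- The kernel of a nonzero `f` lies in the unique maximal submodule of `P m`, which induces a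
nonzero map `L l → L m` and hence an isomorphism. -/
theorem hom_cover_simple_eq_zero {l m : Λ} (h : m ≠ l) (f : S.P m →ₗ[A] S.L l) : f = 0 := by
  by_contra hf
  have hk : LinearMap.ker f ≤ LinearMap.ker (S.cover m) :=
    le_ker_of_superfluous (S.cover_surjective m) (S.cover_superfluous m)
      (fun h => hf (LinearMap.ker_eq_top.1 h))
  have hs := LinearMap.surjective_of_ne_zero hf
  let e := f.quotKerEquivOfSurjective hs
  let g : S.L l →ₗ[A] S.L m := (LinearMap.ker f).liftQ (S.cover m) hk ∘ₗ e.symm.toLinearMap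
  have hg : g ≠ 0 := by
    intro h0
    have := IsSimpleModule.nontrivial A (S.L m)
    obtain ⟨y, hy⟩ := exists_ne (0 : S.L m)
    obtain ⟨x, rfl⟩ := S.cover_surjective m y
    apply hy
    have := LinearMap.congr_fun h0 (e (Submodule.Quotient.mk x))
    simpa [g] using this
  exact h (S.eq_of_iso _ _ ⟨LinearEquiv.ofBijective g (LinearMap.bijective_of_ne_zero hg)⟩).symm

theorem hom_simple_hull_eq_zero {l m : Λ} (h : m ≠ l) (g : S.L l →ₗ[A] S.I m) : g = 0 :=
  S.hom_to_hull_eq_zero_iff.2 (S.hom_cover_simple_eq_zero h) g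

/-- Some simple quotient of `N` is an `L m`, and its projective cover lifts to `N`. -/
theorem exists_hom_ne_zero (N : Type u) [AddCommGroup N] [Module A N] [Module.Finite A N]
    [Nontrivial N] : ∃ (m : Λ) (f : S.P m →ₗ[A] N), f ≠ 0 := by
  obtain ⟨K, hK⟩ := IsCoatomic.exists_coatom (Submodule A N)
  have : IsSimpleModule A (N ⧸ K) := isSimpleModule_iff_isCoatom.2 hK
  obtain ⟨m, ⟨e⟩⟩ := S.exists_iso (N ⧸ K)
  obtain ⟨f, hf⟩ := Module.projective_lifting_property K.mkQ (e.symm.toLinearMap ∘ₗ S.cover m)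
    K.mkQ_surjective
  refine ⟨m, f, fun h => ?_⟩
  rw [h, LinearMap.comp_zero] at hf
  have := IsSimpleModule.nontrivial A (S.L m)
  obtain ⟨y, hy⟩ := exists_ne (0 : S.L m)
  obtain ⟨x, rfl⟩ := S.cover_surjective m y
  exact hy (e.symm.injective ((LinearMap.congr_fun hf x).symm.trans (map_zero _).symm))

theorem hom_hull_eq_zero_of_filt {J : Type*} {X : J → ModuleCat.{u} A} {m : Λ}
    (hX : ∀ j, ∀ g : X j →ₗ[A] S.I m, g = 0) {M : Type u} [AddCommGroup M] [Module A M]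
    (hM : Filt X M) (g : M →ₗ[A] S.I m) : g = 0 := by
  induction hM with
  | zero M => exact Subsingleton.elim _ _
  | cons i j q hi hex hq _ ih =>
    have h0 := ih (g ∘ₗ i)
    have hle : LinearMap.ker q ≤ LinearMap.ker g := fun x hx => by
      obtain ⟨y, rfl⟩ := (hex x).1 hx
      exact LinearMap.congr_fun h0 y
    ext x
    let e := q.quotKerEquivOfSurjective hq
    have := LinearMap.congr_fun (hX j ((LinearMap.ker q).liftQ g hle ∘ₗ e.symm.toLinearMap))
      (e (Submodule.Quotient.mk x))
    simpa using this

variable [LinearOrder Λ]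

/-- The projection of the projective cover onto the standard module. -/
def toStandard (l : Λ) : S.P l →ₗ[A] S.standard l := (S.traceAbove l).mkQ

theorem toStandard_surjective (l : Λ) : Function.Surjective (S.toStandard l) :=
  (S.traceAbove l).mkQ_surjective

theorem ker_toStandard (l : Λ) : LinearMap.ker (S.toStandard l) = S.traceAbove l :=
  (S.traceAbove l).ker_mkQ

/-- The inclusion of the costandard module into the injective hull. -/
def ofCostandard (l : Λ) : S.costandard l →ₗ[A] S.I l := (S.kernelAbove l).subtype

theorem ofCostandard_injective (l : Λ) : Function.Injective (S.ofCostandard l) :=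
  (S.kernelAbove l).injective_subtype

theorem range_le_traceAbove {l m : Λ} (h : l < m) (f : S.P m →ₗ[A] S.P l) :
    LinearMap.range f ≤ S.traceAbove l :=
  le_iSup_of_le (⟨m, h⟩ : {m : Λ // l < m})
    (le_iSup (fun f : S.P m →ₗ[A] S.P l => LinearMap.range f) f)

theorem traceAbove_le {l : Λ} {N : Submodule A (S.P l)}
    (h : ∀ m, l < m → ∀ f : S.P m →ₗ[A] S.P l, LinearMap.range f ≤ N) : S.traceAbove l ≤ N :=
  iSup_le fun m => iSup_le fun f => h m m.2 f

theorem mem_kernelAbove {l : Λ} {x : S.I l} :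
    x ∈ S.kernelAbove l ↔ ∀ m, l < m → ∀ f : S.I l →ₗ[A] S.I m, f x = 0 := by
  simp [kernelAbove, Submodule.mem_iInf]

/-- The map lifts to `P l`, where its image is part of the trace that `Δ l` divides out. -/
theorem hom_standard_eq_zero {l m : Λ} (h : l < m) (f : S.P m →ₗ[A] S.standard l) : f = 0 := by
  obtain ⟨g, rfl⟩ := Module.projective_lifting_property (S.toStandard l) f
    (S.toStandard_surjective l)
  ext x
  have hx : g x ∈ LinearMap.ker (S.toStandard l) :=
    (S.ker_toStandard l).symm ▸ S.range_le_traceAbove h g ⟨x, rfl⟩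
  exact hx

theorem hom_costandard_eq_zero {l m : Λ} (h : l < m) (g : S.costandard l →ₗ[A] S.I m) :
    g = 0 := by
  obtain ⟨f, hf⟩ := (S.isInjectiveHull m).1.out (S.ofCostandard l) (S.ofCostandard_injective l) g
  ext x
  rw [← hf]
  exact S.mem_kernelAbove.1 x.2 m h f

theorem hom_cover_costandard_eq_zero {l m : Λ} (h : l < m) (f : S.P m →ₗ[A] S.costandard l) :
    f = 0 :=
  S.hom_to_hull_eq_zero_iff.1 (S.hom_costandard_eq_zero h) f

/-- Universal property: `Δ l` is the largest quotient of `P l` receiving no nonzero map from `P m`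
with `m > l`. -/
theorem exists_standard_factor {Q : Type u} [AddCommGroup Q] [Module A Q] {l : Λ}
    (hQ : ∀ m, l < m → ∀ f : S.P m →ₗ[A] Q, f = 0) (g : S.P l →ₗ[A] Q) :
    ∃ g' : S.standard l →ₗ[A] Q, g' ∘ₗ S.toStandard l = g := by
  have h : S.traceAbove l ≤ LinearMap.ker g := S.traceAbove_le fun m hm f => by
    rintro _ ⟨x, rfl⟩
    exact LinearMap.congr_fun (hQ m hm (g ∘ₗ f)) x
  exact ⟨(S.traceAbove l).liftQ g h, LinearMap.ext fun x => rfl⟩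

theorem exists_costandard_factor {Q : Type u} [AddCommGroup Q] [Module A Q] {l : Λ}
    (hQ : ∀ m, l < m → ∀ f : Q →ₗ[A] S.I m, f = 0) (g : Q →ₗ[A] S.I l) :
    ∃ g' : Q →ₗ[A] S.costandard l, S.ofCostandard l ∘ₗ g' = g := by
  refine ⟨g.codRestrict (S.kernelAbove l) fun x => ?_, LinearMap.ext fun x => rfl⟩
  exact S.mem_kernelAbove.2 fun m hm f => LinearMap.congr_fun (hQ m hm (f ∘ₗ g)) x

theorem exists_standardTop (l : Λ) :
    ∃ t : S.standard l →ₗ[A] S.L l, t ∘ₗ S.toStandard l = S.cover l :=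
  S.exists_standard_factor (fun _ hm f => S.hom_cover_simple_eq_zero hm.ne' f) (S.cover l)

/-- The projection of the standard module onto its simple top. -/
noncomputable def standardTop (l : Λ) : S.standard l →ₗ[A] S.L l := (S.exists_standardTop l).choose

theorem standardTop_toStandard (l : Λ) (x : S.P l) :
    S.standardTop l (S.toStandard l x) = S.cover l x :=
  LinearMap.congr_fun (S.exists_standardTop l).choose_spec x

theorem standardTop_surjective (l : Λ) : Function.Surjective (S.standardTop l) := fun y => by
  obtain ⟨x, rfl⟩ := S.cover_surjective l y
  exact ⟨_, S.standardTop_toStandard l x⟩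

theorem standardTop_superfluous (l : Λ) (N : Submodule A (S.standard l))
    (h : N ⊔ LinearMap.ker (S.standardTop l) = ⊤) : N = ⊤ := by
  have hN : N.comap (S.toStandard l) = ⊤ := by
    refine S.cover_superfluous l _ (eq_top_iff.2 fun x _ => ?_)
    obtain ⟨y, hy, z, hz, hyz⟩ := Submodule.mem_sup.1
      (h ▸ Submodule.mem_top : S.toStandard l x ∈ N ⊔ LinearMap.ker (S.standardTop l))
    obtain ⟨y, rfl⟩ := S.toStandard_surjective l y
    refine Submodule.mem_sup.2 ⟨y, hy, x - y, ?_, by abel⟩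
    rw [LinearMap.mem_ker, ← standardTop_toStandard, map_sub, ← hyz, add_sub_cancel_left]
    exact hz
  refine eq_top_iff.2 fun y _ => ?_
  obtain ⟨x, rfl⟩ := S.toStandard_surjective l y
  exact (hN ▸ Submodule.mem_top : x ∈ N.comap (S.toStandard l))

theorem exists_costandardSocle (l : Λ) :
    ∃ s : S.L l →ₗ[A] S.costandard l, S.ofCostandard l ∘ₗ s = S.hull l :=
  S.exists_costandard_factor (fun _ hm f => S.hom_simple_hull_eq_zero hm.ne' f) (S.hull l)

/-- The embedding of the simple socle into the costandard module. -/
noncomputable def costandardSocle (l : Λ) : S.L l →ₗ[A] S.costandard l :=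
  (S.exists_costandardSocle l).choose

theorem ofCostandard_costandardSocle (l : Λ) (x : S.L l) :
    S.ofCostandard l (S.costandardSocle l x) = S.hull l x :=
  LinearMap.congr_fun (S.exists_costandardSocle l).choose_spec x

theorem costandardSocle_injective (l : Λ) : Function.Injective (S.costandardSocle l) :=
  fun x y h => S.hull_injective l (by rw [← ofCostandard_costandardSocle, h,
    ofCostandard_costandardSocle])

theorem costandardSocle_essential (l : Λ) (N : Submodule A (S.costandard l))
    (h : N ⊓ LinearMap.range (S.costandardSocle l) = ⊥) : N = ⊥ := by
  have hN : N.map (S.ofCostandard l) = ⊥ := by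
    refine S.hull_essential l _ (eq_bot_iff.2 ?_)
    rintro _ ⟨⟨x, hx, rfl⟩, y, hy⟩
    rw [← ofCostandard_costandardSocle] at hy
    have hy := S.ofCostandard_injective l hy
    have : x ∈ N ⊓ LinearMap.range (S.costandardSocle l) := ⟨hx, y, hy⟩
    rw [h, Submodule.mem_bot] at this
    simp [this]
  refine eq_bot_iff.2 fun x hx => ?_
  have h0 : S.ofCostandard l x ∈ N.map (S.ofCostandard l) := ⟨x, hx, rfl⟩
  rw [hN, Submodule.mem_bot] at h0
  exact S.ofCostandard_injective l (h0.trans (map_zero _).symm)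

/-- A recognition criterion: only one inclusion has to be checked by hand when a quotient of `P l`
is to be identified with `Δ l`. It serves to compute the standard modules of `A ⊗ B`. -/
theorem traceAbove_eq_ker {Q : Type u} [AddCommGroup Q] [Module A Q] {l : Λ} {π : S.P l →ₗ[A] Q}
    (hQ : ∀ m, l < m → ∀ f : S.P m →ₗ[A] Q, f = 0) (hk : LinearMap.ker π ≤ S.traceAbove l) :
    S.traceAbove l = LinearMap.ker π := by
  refine le_antisymm (S.traceAbove_le fun m hm f => ?_) hk
  rintro _ ⟨x, rfl⟩
  exact LinearMap.congr_fun (hQ m hm (π ∘ₗ f)) x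

theorem kernelAbove_eq_range {Q : Type u} [AddCommGroup Q] [Module A Q] {l : Λ} {j : Q →ₗ[A] S.I l}
    (hQ : ∀ m, l < m → ∀ f : Q →ₗ[A] S.I m, f = 0) (hk : S.kernelAbove l ≤ LinearMap.range j) :
    S.kernelAbove l = LinearMap.range j := by
  refine le_antisymm hk ?_
  rintro _ ⟨x, rfl⟩
  exact S.mem_kernelAbove.2 fun m hm f => LinearMap.congr_fun (hQ m hm (f ∘ₗ j)) x

/-! ### Radical endomorphisms, and multiplicity one in the quasi-hereditary case. -/

section Artinian

variable [IsArtinianRing A]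

instance (l : Λ) : Module.Finite A (S.standard l) :=
  .of_surjective (S.toStandard l) (S.toStandard_surjective l)

instance (l : Λ) : Module.Finite A (S.costandard l) :=
  .of_injective (S.ofCostandard l) (S.ofCostandard_injective l)

theorem mem_jacobson_end_standard_iff {l : Λ} (f : Module.End A (S.standard l)) :
    f ∈ Ring.jacobson (Module.End A (S.standard l)) ↔ ¬ Function.Surjective f :=
  mem_jacobson_end_iff_of_superfluous (S.standardTop_surjective l) (S.standardTop_superfluous l) f

theorem mem_jacobson_end_costandard_iff {l : Λ} (f : Module.End A (S.costandard l)) :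
    f ∈ Ring.jacobson (Module.End A (S.costandard l)) ↔ ¬ Function.Injective f :=
  mem_jacobson_end_iff_of_essential (S.costandardSocle_injective l)
    (S.costandardSocle_essential l) f

theorem range_le_radicalImage {l : Λ} (f : Module.End A (S.standard l))
    (hf : ¬ Function.Surjective f) : LinearMap.range f ≤ S.radicalImage l :=
  le_iSup₂_of_le f ((S.mem_jacobson_end_standard_iff f).2 hf) le_rfl

theorem radicalImage_le {l : Λ} {N : Submodule A (S.standard l)}
    (h : ∀ f : Module.End A (S.standard l), ¬ Function.Surjective f → LinearMap.range f ≤ N) :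
    S.radicalImage l ≤ N :=
  iSup₂_le fun f hf => h f ((S.mem_jacobson_end_standard_iff f).1 hf)

theorem mem_radicalKernel {l : Λ} {x : S.costandard l} :
    x ∈ S.radicalKernel l ↔
      ∀ f : Module.End A (S.costandard l), ¬ Function.Injective f → f x = 0 := by
  simp only [radicalKernel, Submodule.mem_iInf, mem_jacobson_end_costandard_iff,
    LinearMap.mem_ker]

section QuasiHereditary

variable {S}

theorem end_standard_eq_zero (hS : ∀ l, S.radicalImage l = ⊥) {l : Λ}
    {f : Module.End A (S.standard l)}
    (hf : ¬ Function.Surjective f) : f = 0 := by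
  have := S.range_le_radicalImage f hf
  rwa [hS, le_bot_iff, LinearMap.range_eq_bot] at this

theorem hom_cover_standard_eq_zero (hS : ∀ l, S.radicalImage l = ⊥) {l : Λ}
    {f : S.P l →ₗ[A] S.standard l}
    (hf : ¬ Function.Surjective f) : f = 0 := by
  obtain ⟨g, rfl⟩ := S.exists_standard_factor (fun m hm f => S.hom_standard_eq_zero hm f) f
  have hg : g = 0 := end_standard_eq_zero hS fun h => hf (h.comp (S.toStandard_surjective l))
  rw [hg, LinearMap.zero_comp]

/-- Followed by the inclusion into `Δ l`, the map is never onto, so it vanishes: `L l` occurs in `Δ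
l` only at the top. -/
theorem hom_cover_ker_standardTop_eq_zero (hS : ∀ l, S.radicalImage l = ⊥) {l : Λ}
    (f : S.P l →ₗ[A] LinearMap.ker (S.standardTop l)) : f = 0 := by
  have h : (LinearMap.ker (S.standardTop l)).subtype ∘ₗ f = 0 := by
    refine hom_cover_standard_eq_zero hS fun hs => ?_
    have := IsSimpleModule.nontrivial A (S.L l)
    obtain ⟨y, hy⟩ := exists_ne (0 : S.L l)
    obtain ⟨x, rfl⟩ := S.standardTop_surjective l y
    obtain ⟨z, rfl⟩ := hs x
    exact hy (f z).2
  ext x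
  exact LinearMap.congr_fun h x

/-- The map factors through `Δ l`, and the radical of `Δ l` has no nonzero map to `I l` because it
has none from `P l`. -/
theorem ker_cover_le_ker (hS : ∀ l, S.radicalImage l = ⊥) {l : Λ} (f : S.P l →ₗ[A] S.costandard l) :
    LinearMap.ker (S.cover l) ≤ LinearMap.ker f := by
  obtain ⟨g, rfl⟩ := S.exists_standard_factor
    (fun m hm f => S.hom_cover_costandard_eq_zero hm f) f
  have h := S.hom_to_hull_eq_zero_iff.2 (hom_cover_ker_standardTop_eq_zero hS)
    (S.ofCostandard l ∘ₗ g ∘ₗ (LinearMap.ker (S.standardTop l)).subtype)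
  intro x hx
  have hx' : S.toStandard l x ∈ LinearMap.ker (S.standardTop l) := by
    rw [LinearMap.mem_ker, standardTop_toStandard]
    exact hx
  exact S.ofCostandard_injective l
    ((LinearMap.congr_fun h ⟨_, hx'⟩).trans (map_zero (S.ofCostandard l)).symm)

/-- By `ker_cover_le_ker` the image of `f` is a quotient of `L l`. When nonzero it contains the
socle of `∇ l`, hence equals it. -/
theorem range_le_costandardSocle (hS : ∀ l, S.radicalImage l = ⊥) {l : Λ}
    (f : S.P l →ₗ[A] S.costandard l) :
    LinearMap.range f ≤ LinearMap.range (S.costandardSocle l) := by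
  by_cases hf : f = 0
  · simp [hf]
  have hk := ker_cover_le_ker hS f
  have h1 := range_le_of_essential (S.costandardSocle_essential l)
    (N := LinearMap.range f) (fun h => hf (LinearMap.range_eq_bot.1 h))
  -- The elements that `f` sends into the socle already cover the simple top, and `f` does not see
  -- the rest.
  have h2 : Submodule.map (S.cover l)
      ((LinearMap.range (S.costandardSocle l)).comap f) = ⊤ := by
    refine (eq_bot_or_eq_top _).resolve_left fun h => ?_
    have := IsSimpleModule.nontrivial A (S.L l)
    obtain ⟨y, hy⟩ := exists_ne (0 : S.L l)
    obtain ⟨x, hx⟩ := h1 ⟨y, rfl⟩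
    have hx0 : S.cover l x ∈ Submodule.map (S.cover l)
        ((LinearMap.range (S.costandardSocle l)).comap f) := ⟨x, ⟨y, hx.symm⟩, rfl⟩
    rw [h, Submodule.mem_bot] at hx0
    have : f x = 0 := hk hx0
    rw [this] at hx
    exact hy (S.costandardSocle_injective l (hx.symm.trans (map_zero _).symm))
  rintro _ ⟨x, rfl⟩
  obtain ⟨y, hy, hxy⟩ := (h2 ▸ Submodule.mem_top : S.cover l x ∈ Submodule.map (S.cover l)
      ((LinearMap.range (S.costandardSocle l)).comap f))
  have : f (x - y) = 0 := hk (by rw [LinearMap.mem_ker, map_sub, hxy, sub_self])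
  rw [map_sub, sub_eq_zero] at this
  rw [this]
  exact hy

/-- The condition on `Δ` passes to `∇`. A nonzero `f` would be nonzero on the image of some `P l → ∇
l`, but that image lies in the socle, which a non-injective `f` kills. -/
theorem end_costandard_eq_zero (hS : ∀ l, S.radicalImage l = ⊥) {l : Λ}
    {f : Module.End A (S.costandard l)}
    (hf : ¬ Function.Injective f) : f = 0 := by
  by_contra h
  have hf' : S.ofCostandard l ∘ₗ f ≠ 0 := fun h0 => h (LinearMap.ext fun x =>
    S.ofCostandard_injective l ((LinearMap.congr_fun h0 x).trans (map_zero _).symm))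
  obtain ⟨g, hg⟩ := S.exists_comp_of_hom_to_hull hf'
  have h1 := range_le_of_essential (S.costandardSocle_essential l)
    (N := LinearMap.ker f) (fun h => hf (LinearMap.ker_eq_bot.1 h))
  refine S.hull_comp_cover_ne_zero l (hg.symm.trans (LinearMap.ext fun x => ?_))
  have : f (g x) = 0 := h1 (range_le_costandardSocle hS g ⟨x, rfl⟩)
  simp [this]

/-- Both are `L l`. Every index other than `l` is larger, so no cover maps nontrivially to the
radical of `Δ l` or to `∇ l` modulo its socle. -/
theorem nonempty_standard_equiv_costandard (hS : ∀ l, S.radicalImage l = ⊥) {l : Λ}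
    (hl : ∀ m, l ≤ m) :
    Nonempty (S.standard l ≃ₗ[A] S.costandard l) := by
  have h1 : Function.Injective (S.standardTop l) := by
    rw [← LinearMap.ker_eq_bot]
    by_contra h
    have : Nontrivial (LinearMap.ker (S.standardTop l)) := Submodule.nontrivial_iff_ne_bot.2 h
    obtain ⟨m, f, hf⟩ := S.exists_hom_ne_zero (LinearMap.ker (S.standardTop l))
    rcases (hl m).eq_or_lt with rfl | hm
    · exact hf (hom_cover_ker_standardTop_eq_zero hS f)
    · have h := S.hom_standard_eq_zero hm ((LinearMap.ker (S.standardTop l)).subtype ∘ₗ f)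
      exact hf (LinearMap.ext fun x => Subtype.ext (LinearMap.congr_fun h x))
  have h2 : Function.Surjective (S.costandardSocle l) := by
    rw [← LinearMap.range_eq_top]
    by_contra h
    let Q := LinearMap.range (S.costandardSocle l)
    have : Nontrivial (S.costandard l ⧸ Q) := Submodule.Quotient.nontrivial_iff.2 h
    obtain ⟨m, f, hf⟩ := S.exists_hom_ne_zero (S.costandard l ⧸ Q)
    obtain ⟨g, rfl⟩ := Module.projective_lifting_property Q.mkQ f Q.mkQ_surjective
    rcases (hl m).eq_or_lt with rfl | hm
    · refine hf (LinearMap.ext fun x => ?_)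
      exact (Submodule.Quotient.mk_eq_zero _).2 (range_le_costandardSocle hS g ⟨x, rfl⟩)
    · rw [S.hom_cover_costandard_eq_zero hm g, LinearMap.comp_zero] at hf
      exact hf rfl
  exact ⟨(LinearEquiv.ofBijective _ ⟨h1, S.standardTop_surjective l⟩).trans
    (LinearEquiv.ofBijective _ ⟨S.costandardSocle_injective l, h2⟩)⟩

end QuasiHereditary

/-- Together `h1` and `h2` say that `ker g` is the sum of the images of the non-surjective
endomorphisms of `M`. The proper standard module can thus be computed in any model `M` of `Δ l`. -/
theorem nonempty_properStandard_equiv {M Q : Type u} [AddCommGroup M] [Module A M]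
    [AddCommGroup Q] [Module A Q] {l : Λ} (e : S.standard l ≃ₗ[A] M) {g : M →ₗ[A] Q}
    (hg : Function.Surjective g)
    (h1 : ∀ f : M →ₗ[A] M, ¬ Function.Surjective f → LinearMap.range f ≤ LinearMap.ker g)
    (h2 : ∀ N : Submodule A M,
      (∀ f : M →ₗ[A] M, ¬ Function.Surjective f → LinearMap.range f ≤ N) → LinearMap.ker g ≤ N) :
    Nonempty (S.properStandard l ≃ₗ[A] Q) := by
  have hk : S.radicalImage l = LinearMap.ker (g ∘ₗ e.toLinearMap) := by
    apply le_antisymm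
    · refine S.radicalImage_le fun f hf => ?_
      rintro _ ⟨x, rfl⟩
      have hf' : ¬ Function.Surjective (e.toLinearMap ∘ₗ f ∘ₗ e.symm.toLinearMap) := fun h =>
        hf fun y => by
          obtain ⟨x, hx⟩ := h (e y)
          exact ⟨e.symm x, e.injective hx⟩
      have := h1 _ hf' ⟨e x, rfl⟩
      simpa using this
    · intro x hx
      have := h2 ((S.radicalImage l).comap e.symm.toLinearMap) (fun f hf => ?_)
        (show e x ∈ LinearMap.ker g from hx)
      · simpa using this
      · rintro _ ⟨y, rfl⟩
        have hf' : ¬ Function.Surjective (e.symm.toLinearMap ∘ₗ f ∘ₗ e.toLinearMap) := fun h =>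
          hf fun y => by
            obtain ⟨x, hx⟩ := h (e.symm y)
            exact ⟨e x, e.symm.injective hx⟩
        have := S.range_le_radicalImage _ hf' ⟨e.symm y, rfl⟩
        simpa using this
  exact ⟨(Submodule.quotEquivOfEq _ _ hk).trans
    (LinearMap.quotKerEquivOfSurjective _ (hg.comp e.surjective))⟩

theorem nonempty_properCostandard_equiv {M Q : Type u} [AddCommGroup M] [Module A M]
    [AddCommGroup Q] [Module A Q] {l : Λ} (e : M ≃ₗ[A] S.costandard l) {j : Q →ₗ[A] M}
    (hj : Function.Injective j)
    (h : ∀ x, x ∈ LinearMap.range j ↔ ∀ f : M →ₗ[A] M, ¬ Function.Injective f → f x = 0) :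
    Nonempty (Q ≃ₗ[A] S.properCostandard l) := by
  have hk : LinearMap.range (e.toLinearMap ∘ₗ j) = S.radicalKernel l := by
    ext x
    rw [mem_radicalKernel]
    have : x ∈ LinearMap.range (e.toLinearMap ∘ₗ j) ↔ e.symm x ∈ LinearMap.range j := by
      constructor
      · rintro ⟨y, rfl⟩
        exact ⟨y, by simp⟩
      · rintro ⟨y, hy⟩
        exact ⟨y, by simp [hy]⟩
    rw [this, h]
    constructor
    · intro hx f hf
      have hf' : ¬ Function.Injective (e.symm.toLinearMap ∘ₗ f ∘ₗ e.toLinearMap) := fun h =>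
        hf fun y z hyz => by
          have := @h (e.symm y) (e.symm z) (by simpa using hyz)
          exact e.symm.injective this
      simpa using hx _ hf'
    · intro hx f hf
      have hf' : ¬ Function.Injective (e.toLinearMap ∘ₗ f ∘ₗ e.symm.toLinearMap) := fun h =>
        hf fun y z hyz => by
          have := @h (e y) (e z) (by simpa using hyz)
          exact e.injective this
      simpa using hx _ hf'
  exact ⟨(LinearEquiv.ofInjective (e.toLinearMap ∘ₗ j) (e.injective.comp hj)).trans
    (LinearEquiv.ofEq _ _ hk)⟩

end Artinian

/-- Splitting off the factors of largest index from a costandard filtration. -/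
theorem exists_exact_of_filt_costandard {s : Finset Λ} {a : Λ} (hs : ∀ m ∈ s, m < a)
    {M : Type u} [AddCommGroup M] [Module A M]
    (hM : Filt (fun m : {m // m ∈ insert a s} => S.costandard m) M) :
    ∃ (ι : Type) (_ : Finite ι) (q : M →ₗ[A] ι → S.costandard a), Function.Surjective q ∧
      Filt (fun m : {m // m ∈ s} => S.costandard m) (LinearMap.ker q) := by
  induction hM with
  | zero M =>
    exact ⟨Empty, inferInstance, 0, fun x => ⟨0, Subsingleton.elim _ _⟩, .zero _⟩
  | @cons N M _ _ _ _ i j q₀ hi hex hq₀ hN ih =>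
    obtain ⟨ι, _, q, hq, hK⟩ := ih
    have hM := Filt.cons i j q₀ hi hex hq₀ hN
    -- All factors of `M` have index at most `a`.
    have hzero : ∀ m, a < m → ∀ f : M →ₗ[A] S.I m, f = 0 := fun m hm =>
      S.hom_hull_eq_zero_of_filt (fun j g => S.hom_costandard_eq_zero (lt_of_le_of_lt
        (by rcases Finset.mem_insert.1 j.2 with h | h
            exacts [h.le, (hs _ h).le]) hm) g) hM
    -- Each coordinate of `q` extends from `N` to `M` by injectivity of `I a`; by `hzero` the
    -- extension still lands in `∇ a`.
    have hext : ∀ b : ι, ∃ r : M →ₗ[A] S.costandard a, ∀ x, r (i x) = q x b := fun b => by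
      obtain ⟨h, hh⟩ := (S.isInjectiveHull a).1.out i hi
        (S.ofCostandard a ∘ₗ LinearMap.proj b ∘ₗ q)
      obtain ⟨r, hr⟩ := S.exists_costandard_factor hzero h
      refine ⟨r, fun x => S.ofCostandard_injective a ?_⟩
      exact (LinearMap.congr_fun hr (i x)).trans (hh x)
    choose r' hr' using hext
    let r : M →ₗ[A] ι → S.costandard a := LinearMap.pi r'
    have hr : ∀ x, r (i x) = q x := fun x => funext fun b => hr' b x
    -- A top factor of index `a` becomes the extra coordinate `none`, with the kernel unchanged up
    -- to isomorphism. Any other top factor is added on top of the kernel.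
    rcases Finset.mem_insert.1 j.2 with hj | hj
    · obtain ⟨q₁, hex, hq₁⟩ : ∃ q₁ : M →ₗ[A] S.costandard a, Function.Exact i q₁ ∧
          Function.Surjective q₁ := by
        rw [← hj]
        exact ⟨q₀, hex, hq₀⟩
      let r₁ : M →ₗ[A] Option ι → S.costandard a :=
        LinearMap.pi fun o => o.elim q₁ r'
      have hrn : ∀ x, r₁ x none = q₁ x := fun _ => rfl
      have hrs : ∀ x b, r₁ x (some b) = r x b := fun _ _ => rfl
      refine ⟨Option ι, inferInstance, r₁, fun y => ?_, ?_⟩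
      · obtain ⟨x, hx⟩ := hq₁ (y none)
        obtain ⟨z, hz⟩ := hq ((fun b => y (some b)) - r x)
        refine ⟨x + i z, funext fun o => ?_⟩
        cases o with
        | none =>
          rw [hrn, map_add, hx]
          exact (congrArg _ (hex.apply_apply_eq_zero z)).trans (add_zero _)
        | some b => simp [hrs, hr, hz]
      · refine hK.of_equiv (LinearEquiv.ofBijective
          ((i ∘ₗ (LinearMap.ker q).subtype).codRestrict (LinearMap.ker r₁) fun x => ?_) ⟨?_, ?_⟩)
        · rw [LinearMap.mem_ker]
          funext o
          cases o with
          | none => exact hex.apply_apply_eq_zero _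
          | some b =>
            rw [hrs]
            simp only [LinearMap.comp_apply, hr]
            exact congrFun x.2 b
        · intro x y hxy
          exact Subtype.ext (hi (congrArg Subtype.val hxy))
        · rintro ⟨x, hx⟩
          obtain ⟨y, rfl⟩ := (hex x).1 (congrFun (LinearMap.mem_ker.1 hx) none)
          refine ⟨⟨y, ?_⟩, rfl⟩
          rw [LinearMap.mem_ker, ← hr]
          exact funext fun b => congrFun (LinearMap.mem_ker.1 hx) (some b)
    · refine ⟨ι, inferInstance, r, fun y => ?_, ?_⟩
      · obtain ⟨x, rfl⟩ := hq y
        exact ⟨i x, hr x⟩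
      · refine .cons ((i ∘ₗ (LinearMap.ker q).subtype).codRestrict (LinearMap.ker r) fun x => ?_)
          ⟨j, hj⟩ (q₀ ∘ₗ (LinearMap.ker r).subtype) ?_ ?_ ?_ hK
        · rw [LinearMap.mem_ker]
          simp only [LinearMap.comp_apply, hr]
          exact x.2
        · intro x y hxy
          exact Subtype.ext (hi (congrArg Subtype.val hxy))
        · rintro ⟨x, hx⟩
          constructor
          · intro h
            obtain ⟨y, rfl⟩ := (hex x).1 h
            refine ⟨⟨y, ?_⟩, rfl⟩
            rw [LinearMap.mem_ker, ← hr]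
            exact hx
          · rintro ⟨y, hy⟩
            have hy' : i y = x := congrArg Subtype.val hy
            subst hy'
            exact hex.apply_apply_eq_zero _
        · intro y
          obtain ⟨x, rfl⟩ := hq₀ y
          obtain ⟨z, hz⟩ := hq (r x)
          refine ⟨⟨x - i z, ?_⟩, ?_⟩
          · rw [LinearMap.mem_ker, map_sub, hr, hz, sub_self]
          · simp only [LinearMap.comp_apply, Submodule.subtype_apply, map_sub]
            exact (congrArg _ (hex.apply_apply_eq_zero z)).trans (sub_zero _)

end SimpleSystem

end Strat

namespace Strat

/-! ### Restricting modules over A ⊗ B to the two factors. -/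

section Bimodules

variable (k A B : Type u) [Field k] [Ring A] [Ring B] [Algebra k A] [Algebra k B]

/-- A module over `A ⊗ B` regarded as a module over `A`, over `B` and over `k`. -/
def Bi (M : Type u) : Type u := let _ := (k, A, B); M

namespace Bi

variable (M : Type u) [AddCommGroup M] [Module (A ⊗[k] B) M]

instance : AddCommGroup (Bi k A B M) := inferInstanceAs (AddCommGroup M)

instance : Module k (Bi k A B M) := Module.compHom M (algebraMap k (A ⊗[k] B))

instance : Module A (Bi k A B M) :=
  Module.compHom M (Algebra.TensorProduct.includeLeftRingHom : A →+* A ⊗[k] B)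

instance : Module B (Bi k A B M) :=
  Module.compHom M (Algebra.TensorProduct.includeRight : B →ₐ[k] A ⊗[k] B).toRingHom

/-- The identity map onto the underlying bimodule. -/
def mk : M ≃+ Bi k A B M := AddEquiv.refl M

variable {k A B M}

theorem smul_mk_left (a : A) (m : M) : a • mk k A B M m = mk k A B M ((a ⊗ₜ[k] (1 : B)) • m) := rfl

theorem smul_mk_right (b : B) (m : M) : b • mk k A B M m = mk k A B M (((1 : A) ⊗ₜ[k] b) • m) := rfl

theorem smul_smul_mk (a : A) (b : B) (m : M) :
    a • b • mk k A B M m = mk k A B M ((a ⊗ₜ[k] b) • m) := by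
  rw [smul_mk_right, smul_mk_left, smul_smul]
  simp

theorem mk_symm_smul_right (b : B) (m : Bi k A B M) :
    (mk k A B M).symm (b • m) = ((1 : A) ⊗ₜ[k] b) • (mk k A B M).symm m := rfl

instance : IsScalarTower k A (Bi k A B M) where
  smul_assoc c a m := by
    change ((c • a) ⊗ₜ[k] (1 : B)) • (mk k A B M).symm m =
      algebraMap k (A ⊗[k] B) c • (a ⊗ₜ[k] (1 : B)) • (mk k A B M).symm m
    rw [smul_smul, ← Algebra.smul_def, TensorProduct.smul_tmul']

instance : IsScalarTower k B (Bi k A B M) where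
  smul_assoc c b m := by
    change ((1 : A) ⊗ₜ[k] (c • b)) • (mk k A B M).symm m =
      algebraMap k (A ⊗[k] B) c • ((1 : A) ⊗ₜ[k] b) • (mk k A B M).symm m
    rw [smul_smul, ← Algebra.smul_def, TensorProduct.tmul_smul]

instance : SMulCommClass A B (Bi k A B M) where
  smul_comm a b m := by
    change (a ⊗ₜ[k] (1 : B)) • ((1 : A) ⊗ₜ[k] b) • (mk k A B M).symm m =
      ((1 : A) ⊗ₜ[k] b) • (a ⊗ₜ[k] (1 : B)) • (mk k A B M).symm m
    rw [smul_smul, smul_smul]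
    simp

instance : SMulCommClass B A (Bi k A B M) := .symm _ _ _

variable {M' : Type u} [AddCommGroup M'] [Module (A ⊗[k] B) M']

/-- A linear map over `A ⊗ B` as an `A`-linear map. -/
def mapLeft (f : M →ₗ[A ⊗[k] B] M') : Bi k A B M →ₗ[A] Bi k A B M' where
  toFun := f
  map_add' := f.map_add
  map_smul' a m := f.map_smul (a ⊗ₜ 1) m

/-- A linear map over `A ⊗ B` as a `B`-linear map. -/
def mapRight (f : M →ₗ[A ⊗[k] B] M') : Bi k A B M →ₗ[B] Bi k A B M' where
  toFun := f
  map_add' := f.map_add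
  map_smul' b m := f.map_smul (1 ⊗ₜ b) m

@[simp] theorem mapLeft_mk (f : M →ₗ[A ⊗[k] B] M') (m : M) :
    mapLeft f (mk k A B M m) = mk k A B M' (f m) := rfl

/-- The action of an element of `B` as an `A`-linear map. -/
def rightSMul (b : B) : Bi k A B M →ₗ[A] Bi k A B M where
  toFun m := b • m
  map_add' := smul_add b
  map_smul' a m := smul_comm b a m

end Bi

variable {k A B}

/-- Additive maps compatible with pure tensors are linear. -/
def linearMapOfTmul {M M' : Type u} [AddCommGroup M] [Module (A ⊗[k] B) M] [AddCommGroup M']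
    [Module (A ⊗[k] B) M'] (f : M →+ M')
    (hf : ∀ (a : A) (b : B) (m : M), f ((a ⊗ₜ[k] b) • m) = (a ⊗ₜ[k] b) • f m) :
    M →ₗ[A ⊗[k] B] M' where
  toFun := f
  map_add' := f.map_add
  map_smul' d m := by
    induction d using TensorProduct.induction_on with
    | zero => simp
    | tmul a b => exact hf a b m
    | add x y hx hy => simp only [add_smul, map_add, RingHom.id_apply] at *; rw [hx, hy]

theorem Filt.bi {J J' : Type*} {X : J → ModuleCat.{u} (A ⊗[k] B)} {Y : J' → ModuleCat.{u} A}
    {M : Type u} [AddCommGroup M] [Module (A ⊗[k] B) M] (hM : Filt X M)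
    (h : ∀ j, Filt Y (Bi k A B (X j))) : Filt Y (Bi k A B M) := by
  induction hM with
  | zero M =>
    have : Subsingleton (Bi k A B M) := inferInstanceAs (Subsingleton M)
    exact .zero _
  | cons i j q hi hex hq _ ih =>
    exact ih.ext (h j) (Bi.mapLeft i) (Bi.mapLeft q) hi hex hq

/-- A submodule stable under both actions. -/
def submoduleOfBi {M : Type u} [AddCommGroup M] [Module (A ⊗[k] B) M]
    (N : Submodule A (Bi k A B M)) (hN : ∀ (b : B), ∀ m ∈ N, b • m ∈ N) :
    Submodule (A ⊗[k] B) M where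
  carrier := {m | Bi.mk k A B M m ∈ N}
  add_mem' := N.add_mem
  zero_mem' := N.zero_mem
  smul_mem' d m hm := by
    change Bi.mk k A B M m ∈ N at hm
    change Bi.mk k A B M (d • m) ∈ N
    induction d using TensorProduct.induction_on with
    | zero => simp
    | tmul a b =>
      rw [← Bi.smul_smul_mk]
      exact N.smul_mem a (hN b _ hm)
    | add x y hx hy =>
      rw [add_smul, map_add]
      exact N.add_mem hx hy

end Bimodules

/-! ### External tensor products and induction X ↦ X ⊗ B. -/

section ExternalTensor

variable (k : Type u) {A B : Type u} [Field k] [Ring A] [Ring B] [Algebra k A] [Algebra k B]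

/-- The external tensor product of an `A`-module and a `B`-module. -/
def ExtTensor (X N : Type u) [AddCommGroup X] [Module k X] [AddCommGroup N] [Module k N] :
    Type u := X ⊗[k] N

variable (X N : Type u) [AddCommGroup X] [Module k X] [AddCommGroup N] [Module k N]

noncomputable instance : AddCommGroup (ExtTensor k X N) := inferInstanceAs (AddCommGroup (X ⊗[k] N))

noncomputable instance : Module k (ExtTensor k X N) := inferInstanceAs (Module k (X ⊗[k] N))

variable [Module A X] [IsScalarTower k A X] [Module B N] [IsScalarTower k B N]

/-- The action of `A ⊗ B` on an external tensor product. -/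
noncomputable def extTensorAction : A ⊗[k] B →ₐ[k] Module.End k (X ⊗[k] N) :=
  (Module.endTensorEndAlgHom (R := k) (A := k) (M := X) (N := N)).comp
    (Algebra.TensorProduct.map (Algebra.lsmul k k X) (Algebra.lsmul k k N))

noncomputable instance : Module (A ⊗[k] B) (ExtTensor k X N) :=
  Module.compHom (X ⊗[k] N) (extTensorAction k (A := A) (B := B) X N).toRingHom

variable {k X N}

/-- A pure tensor in the external tensor product. -/
noncomputable def ExtTensor.tmul (x : X) (n : N) : ExtTensor k X N := x ⊗ₜ[k] n

theorem ExtTensor.smul_tmul (a : A) (b : B) (x : X) (n : N) :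
    (a ⊗ₜ[k] b) • (ExtTensor.tmul x n : ExtTensor k X N) = ExtTensor.tmul (a • x) (b • n) := rfl

@[elab_as_elim]
theorem ExtTensor.induction_on {p : ExtTensor k X N → Prop} (t : ExtTensor k X N) (zero : p 0)
    (tmul : ∀ x n, p (.tmul x n)) (add : ∀ s t, p s → p t → p (s + t)) : p t :=
  TensorProduct.induction_on t zero tmul add

/-- An additive map from an external tensor product that is compatible with the actions on pure
tensors is linear. -/
noncomputable def ExtTensor.linearMap {M : Type u} [AddCommGroup M] [Module (A ⊗[k] B) M]
    (f : ExtTensor k X N →+ M)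
    (hf : ∀ (a : A) (b : B) (x : X) (n : N),
      f (.tmul (a • x) (b • n)) = (a ⊗ₜ[k] b) • f (.tmul x n)) :
    ExtTensor k X N →ₗ[A ⊗[k] B] M :=
  linearMapOfTmul f fun a b m => by
    induction m using ExtTensor.induction_on with
    | zero => simp
    | tmul x n => exact hf a b x n
    | add x y hx hy => rw [smul_add, map_add, hx, hy, map_add, smul_add]

variable {X' : Type u} [AddCommGroup X'] [Module k X'] [Module A X'] [IsScalarTower k A X']
  {N' : Type u} [AddCommGroup N'] [Module k N'] [Module B N'] [IsScalarTower k B N']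

/-- Functoriality of the external tensor product in both variables. -/
noncomputable def ExtTensor.map (f : X →ₗ[A] X') (g : N →ₗ[B] N') :
    ExtTensor k X N →ₗ[A ⊗[k] B] ExtTensor k X' N' :=
  ExtTensor.linearMap
    (TensorProduct.map (f.restrictScalars k) (g.restrictScalars k)).toAddMonoidHom
    fun a b x n => by
      change (f (a • x)) ⊗ₜ[k] (g (b • n)) = ExtTensor.tmul (a • f x) (b • g n)
      rw [map_smul, map_smul]
      rfl

theorem ExtTensor.map_tmul (f : X →ₗ[A] X') (g : N →ₗ[B] N') (x : X) (n : N) :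
    ExtTensor.map f g (.tmul x n : ExtTensor k X N) = .tmul (f x) (g n) := rfl

theorem ExtTensor.hom_ext {M : Type u} [AddCommGroup M] [Module (A ⊗[k] B) M]
    {f g : ExtTensor k X N →ₗ[A ⊗[k] B] M} (h : ∀ x n, f (.tmul x n) = g (.tmul x n)) : f = g := by
  ext t
  induction t using ExtTensor.induction_on with
  | zero => simp
  | tmul x n => exact h x n
  | add x y hx hy => rw [map_add, map_add, hx, hy]

theorem ExtTensor.map_left_injective (N : Type u) [AddCommGroup N] [Module k N] [Module B N]
    [IsScalarTower k B N] {f : X →ₗ[A] X'} (hf : Function.Injective f) :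
    Function.Injective (ExtTensor.map f LinearMap.id : ExtTensor k X N →ₗ[A ⊗[k] B] _) :=
  Module.Flat.rTensor_preserves_injective_linearMap (f.restrictScalars k) hf

theorem ExtTensor.map_left_surjective (N : Type u) [AddCommGroup N] [Module k N] [Module B N]
    [IsScalarTower k B N] {f : X →ₗ[A] X'} (hf : Function.Surjective f) :
    Function.Surjective (ExtTensor.map f LinearMap.id : ExtTensor k X N →ₗ[A ⊗[k] B] _) :=
  LinearMap.rTensor_surjective N (g := f.restrictScalars k) hf

theorem ExtTensor.map_right_injective (X : Type u) [AddCommGroup X] [Module k X] [Module A X]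
    [IsScalarTower k A X] {g : N →ₗ[B] N'} (hg : Function.Injective g) :
    Function.Injective (ExtTensor.map LinearMap.id g : ExtTensor k X N →ₗ[A ⊗[k] B] _) :=
  Module.Flat.lTensor_preserves_injective_linearMap (g.restrictScalars k) hg

theorem ExtTensor.map_right_surjective (X : Type u) [AddCommGroup X] [Module k X] [Module A X]
    [IsScalarTower k A X] {g : N →ₗ[B] N'} (hg : Function.Surjective g) :
    Function.Surjective (ExtTensor.map LinearMap.id g : ExtTensor k X N →ₗ[A ⊗[k] B] _) :=
  LinearMap.lTensor_surjective X (g := g.restrictScalars k) hg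

variable {X'' : Type u} [AddCommGroup X''] [Module k X''] [Module A X''] [IsScalarTower k A X'']
  {N'' : Type u} [AddCommGroup N''] [Module k N''] [Module B N''] [IsScalarTower k B N'']

theorem ExtTensor.map_left_exact (N : Type u) [AddCommGroup N] [Module k N] [Module B N]
    [IsScalarTower k B N] {f : X →ₗ[A] X'} {g : X' →ₗ[A] X''} (h : Function.Exact f g)
    (hg : Function.Surjective g) :
    Function.Exact (ExtTensor.map f LinearMap.id : ExtTensor k X N →ₗ[A ⊗[k] B] _)
      (ExtTensor.map g LinearMap.id : ExtTensor k X' N →ₗ[A ⊗[k] B] _) :=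
  rTensor_exact (f := f.restrictScalars k) (g := g.restrictScalars k) N h hg

theorem ExtTensor.map_right_exact (X : Type u) [AddCommGroup X] [Module k X] [Module A X]
    [IsScalarTower k A X] {f : N →ₗ[B] N'} {g : N' →ₗ[B] N''} (h : Function.Exact f g)
    (hg : Function.Surjective g) :
    Function.Exact (ExtTensor.map LinearMap.id f : ExtTensor k X N →ₗ[A ⊗[k] B] _)
      (ExtTensor.map LinearMap.id g : ExtTensor k X N' →ₗ[A ⊗[k] B] _) :=
  lTensor_exact (f := f.restrictScalars k) (g := g.restrictScalars k) X h hg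

/-- Contraction with a functional on the second factor, as an additive map. -/
noncomputable def ExtTensor.contractAux (χ : N →ₗ[k] k) : ExtTensor k X N →+ X :=
  ((TensorProduct.rid k X).toLinearMap ∘ₗ LinearMap.lTensor X χ).toAddMonoidHom

theorem ExtTensor.contractAux_tmul (χ : N →ₗ[k] k) (x : X) (n : N) :
    ExtTensor.contractAux χ (ExtTensor.tmul x n : ExtTensor k X N) = χ n • x := by
  change TensorProduct.rid k X (x ⊗ₜ χ n) = _
  simp

/-- Contraction of an external tensor product with a functional on the second factor. -/
noncomputable def ExtTensor.contract (χ : N →ₗ[k] k) : Bi k A B (ExtTensor k X N) →ₗ[A] X where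
  toFun t := ExtTensor.contractAux χ ((Bi.mk k A B _).symm t)
  map_add' s t := by simp
  map_smul' a t := by
    obtain ⟨t, rfl⟩ := (Bi.mk k A B _).surjective t
    rw [Bi.smul_mk_left, AddEquiv.symm_apply_apply, AddEquiv.symm_apply_apply, RingHom.id_apply]
    induction t using ExtTensor.induction_on with
    | zero => simp
    | tmul x n =>
      rw [ExtTensor.smul_tmul, one_smul, contractAux_tmul, contractAux_tmul, smul_comm]
    | add x y hx hy => rw [smul_add, map_add, hx, hy, map_add, smul_add]

theorem ExtTensor.contract_tmul (χ : N →ₗ[k] k) (x : X) (n : N) :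
    ExtTensor.contract χ (Bi.mk k A B _ (ExtTensor.tmul x n : ExtTensor k X N)) = χ n • x :=
  ExtTensor.contractAux_tmul χ x n

/-- With respect to a basis of `N`, the coefficients of `t` are its contractions with the coordinate
functionals. -/
theorem ExtTensor.eq_zero_of_contract {t : Bi k A B (ExtTensor k X N)}
    (h : ∀ χ : N →ₗ[k] k, ExtTensor.contract χ t = 0) : t = 0 := by
  classical
  let b := Module.Basis.ofVectorSpace k N
  have key : ∀ (t : ExtTensor k X N) i,
      TensorProduct.equivFinsuppOfBasisRight (M := X) b t i =
        ExtTensor.contractAux (b.coord i) t := fun t i => by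
    induction t using ExtTensor.induction_on with
    | zero => exact (DFunLike.congr_fun (map_zero _) i).trans (map_zero _).symm
    | tmul x n =>
      rw [contractAux_tmul]
      exact (DFunLike.congr_fun
        (TensorProduct.equivFinsuppOfBasisRight_apply_tmul b x n) i).trans (by simp)
    | add x y hx hy =>
      rw [map_add, ← hx, ← hy]
      exact DFunLike.congr_fun (map_add _ _ _) i
  apply (TensorProduct.equivFinsuppOfBasisRight (M := X) b).injective
  refine Eq.trans ?_ (map_zero _).symm
  ext i
  exact (key _ i).trans (h (b.coord i))

/-- Over `A` the module `X ⊗ N` is a sum of copies of `X`, so the contractions detect maps into it.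
-/
theorem ExtTensor.hom_eq_zero {Z : Type u} [AddCommGroup Z] [Module A Z]
    (h : ∀ f : Z →ₗ[A] X, f = 0) (f : Z →ₗ[A] Bi k A B (ExtTensor k X N)) : f = 0 := by
  ext z
  exact ExtTensor.eq_zero_of_contract fun χ =>
    LinearMap.congr_fun (h (ExtTensor.contract χ ∘ₗ f)) z

/-- The extension of an `A`-linear map to the external tensor product with `B`. -/
noncomputable def ExtTensor.lift {M : Type u} [AddCommGroup M] [Module (A ⊗[k] B) M]
    (g : X →ₗ[A] Bi k A B M) : ExtTensor k X B →ₗ[A ⊗[k] B] M :=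
  ExtTensor.linearMap (N := B)
    (TensorProduct.liftAddHom (R := k)
      { toFun := fun x =>
          { toFun := fun b => (Bi.mk k A B M).symm (b • g x)
            map_zero' := by simp
            map_add' := fun b b' => by simp [add_smul] }
        map_zero' := by ext; simp
        map_add' := fun x y => by ext; simp }
      (fun c x b => by
        have h : g (c • x) = c • g x := map_smul (g.restrictScalars k) c x
        simp only [AddMonoidHom.coe_mk, ZeroHom.coe_mk, h]
        rw [smul_comm, smul_assoc]))
    (fun a b x n => by
      have h : (b • n) • g (a • x) = a • b • n • g x := by
        rw [map_smul g, smul_eq_mul, mul_smul, smul_comm n a, smul_comm b a]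
      exact (congrArg (Bi.mk k A B M).symm h).trans
        (Bi.smul_smul_mk a b ((Bi.mk k A B M).symm (n • g x))))

theorem ExtTensor.lift_tmul {M : Type u} [AddCommGroup M] [Module (A ⊗[k] B) M]
    (g : X →ₗ[A] Bi k A B M) (x : X) (b : B) :
    ExtTensor.lift g (.tmul x b) = (Bi.mk k A B M).symm (b • g x) := rfl

/-- The embedding of an `A`-module into its external tensor product with `B`. -/
noncomputable def ExtTensor.unit : X →ₗ[A] Bi k A B (ExtTensor k X B) where
  toFun x := Bi.mk k A B _ (.tmul x 1)
  map_add' x y := TensorProduct.add_tmul x y (1 : B)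
  map_smul' a x := by
    rw [RingHom.id_apply, Bi.smul_mk_left, ExtTensor.smul_tmul, one_smul]

theorem ExtTensor.tmul_eq_smul (x : X) (b : B) :
    (ExtTensor.tmul x b : ExtTensor k X B) =
      ((1 : A) ⊗ₜ[k] b) • (ExtTensor.tmul x (1 : B) : ExtTensor k X B) := by
  rw [ExtTensor.smul_tmul, one_smul, smul_eq_mul, mul_one]

/-- The elements `x ⊗ 1` generate `X ⊗ B` over `B`. -/
theorem ExtTensor.eq_zero_of_unit {M : Type u} [AddCommGroup M] [Module (A ⊗[k] B) M]
    (f : ExtTensor k X B →ₗ[A ⊗[k] B] M) (h : Bi.mapLeft f ∘ₗ ExtTensor.unit = 0) : f = 0 := by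
  refine ExtTensor.hom_ext fun x b => ?_
  rw [ExtTensor.tmul_eq_smul (A := A), map_smul]
  have : f (.tmul x 1) = 0 := LinearMap.congr_fun h x
  rw [this, smul_zero]
  rfl

end ExternalTensor

end Strat

namespace Strat

/-! ### Coinduction X ↦ Hom_k(B, X). -/

section Coinduced

variable (k A B : Type u) [Field k] [Ring A] [Ring B] [Algebra k A] [Algebra k B]

/-- The coinduced module `Hom_k(B, X)` of an `A`-module. -/
def Coind (X : Type u) [AddCommGroup X] [Module k X] : Type u := B →ₗ[k] X

variable (X : Type u) [AddCommGroup X] [Module k X]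

instance : AddCommGroup (Coind k B X) := inferInstanceAs (AddCommGroup (B →ₗ[k] X))

/-- The action is `(b • φ) x = φ (x * b)`: right multiplication in the argument gives a left module.
-/
instance : Module B (Coind k B X) where
  smul b φ := LinearMap.comp (M₂ := B) φ (LinearMap.mulRight k b)
  one_smul φ := LinearMap.ext fun x => congrArg φ.toFun (mul_one x)
  mul_smul b c φ := LinearMap.ext fun x => congrArg φ.toFun (mul_assoc x b c).symm
  smul_zero _ := rfl
  smul_add _ _ _ := rfl
  add_smul b c φ := LinearMap.ext fun x =>
    (congrArg φ.toFun (mul_add x b c)).trans (φ.map_add' _ _)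
  zero_smul φ := LinearMap.ext fun x =>
    (congrArg φ.toFun (mul_zero x)).trans (LinearMap.map_zero φ)

variable [Module A X] [IsScalarTower k A X]

instance : Module A (Coind k B X) := inferInstanceAs (Module A (B →ₗ[k] X))

instance : IsScalarTower k A (Coind k B X) := inferInstanceAs (IsScalarTower k A (B →ₗ[k] X))

instance : IsScalarTower k B (Coind k B X) where
  smul_assoc c b φ := LinearMap.ext fun x =>
    (congrArg φ.toFun (mul_smul_comm c x b)).trans (LinearMap.map_smul φ c _)

instance : SMulCommClass A B (Coind k B X) where
  smul_comm _ _ _ := rfl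

instance : Module (A ⊗[k] B) (Coind k B X) := TensorProduct.Algebra.module

variable {k A B X}

/-- The value of an element of the coinduced module. -/
def Coind.eval (φ : Coind k B X) (b : B) : X := (show B →ₗ[k] X from φ) b

/-- An element of the coinduced module. -/
def Coind.mk (φ : B →ₗ[k] X) : Coind k B X := φ

@[simp] theorem Coind.eval_mk (φ : B →ₗ[k] X) (b : B) : (Coind.mk φ).eval b = φ b := rfl

theorem Coind.smul_eval (a : A) (b : B) (φ : Coind k B X) (x : B) :
    ((a ⊗ₜ[k] b) • φ).eval x = a • φ.eval (x * b) := rfl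

theorem Coind.smul_right_eval (b : B) (φ : Coind k B X) (x : B) :
    (b • φ).eval x = φ.eval (x * b) := rfl

@[simp] theorem Coind.add_eval (φ ψ : Coind k B X) (x : B) :
    (φ + ψ).eval x = φ.eval x + ψ.eval x := rfl

@[simp] theorem Coind.zero_eval (x : B) : (0 : Coind k B X).eval x = 0 := rfl

theorem Coind.eval_add (φ : Coind k B X) (x y : B) : φ.eval (x + y) = φ.eval x + φ.eval y :=
  LinearMap.map_add (show B →ₗ[k] X from φ) x y

theorem Coind.eval_smul (φ : Coind k B X) (c : k) (y : B) : φ.eval (c • y) = c • φ.eval y :=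
  LinearMap.map_smul (show B →ₗ[k] X from φ) c y

theorem Coind.ext {φ ψ : Coind k B X} (h : ∀ x, φ.eval x = ψ.eval x) : φ = ψ := LinearMap.ext h

/-- Evaluation at one. -/
def Coind.counit : Bi k A B (Coind k B X) →ₗ[A] X where
  toFun φ := ((Bi.mk k A B _).symm φ).eval 1
  map_add' _ _ := rfl
  map_smul' a φ := congrArg (a • ·) (congrArg ((Bi.mk k A B _).symm φ).eval (mul_one 1))

/-- The map into a coinduced module determined by an `A`-linear map. -/
def Coind.lift {M : Type u} [AddCommGroup M] [Module (A ⊗[k] B) M]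
    (g : Bi k A B M →ₗ[A] X) : M →ₗ[A ⊗[k] B] Coind k B X :=
  linearMapOfTmul
    { toFun := fun m => Coind.mk
        { toFun := fun b => g (b • Bi.mk k A B M m)
          map_add' := fun b b' => by rw [add_smul, map_add]
          map_smul' := fun c b => by
            rw [smul_assoc]
            exact map_smul (g.restrictScalars k) c _ }
      map_zero' := Coind.ext fun b => by simp
      map_add' := fun x y => Coind.ext fun b => by simp }
    (fun a b m => Coind.ext fun x => by
      simp only [AddMonoidHom.coe_mk, ZeroHom.coe_mk, Coind.smul_eval, Coind.eval_mk,
        LinearMap.coe_mk, AddHom.coe_mk]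
      rw [← Bi.smul_smul_mk, ← map_smul g, mul_smul, smul_comm x a])

theorem Coind.lift_eval {M : Type u} [AddCommGroup M] [Module (A ⊗[k] B) M]
    (g : Bi k A B M →ₗ[A] X) (m : M) (b : B) :
    (Coind.lift g m).eval b = g (b • Bi.mk k A B M m) := rfl

theorem Coind.eval_eq_counit (φ : Coind k B X) (b : B) :
    φ.eval b = Coind.counit (A := A) (b • Bi.mk k A B _ φ) := by
  change _ = (((1 : A) ⊗ₜ[k] b) • φ).eval 1
  rw [Coind.smul_eval, one_smul, one_mul]

theorem Coind.eval_apply_eq {M : Type u} [AddCommGroup M] [Module (A ⊗[k] B) M]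
    (f : M →ₗ[A ⊗[k] B] Coind k B X) (m : M) (b : B) :
    (f m).eval b = (f (((1 : A) ⊗ₜ[k] b) • m)).eval 1 := by
  rw [map_smul, Coind.smul_eval, one_smul, one_mul]

variable {X' : Type u} [AddCommGroup X'] [Module k X'] [Module A X'] [IsScalarTower k A X']

/-- Functoriality of coinduction. -/
def Coind.map (f : X →ₗ[A] X') : Coind k B X →ₗ[A ⊗[k] B] Coind k B X' :=
  linearMapOfTmul
    { toFun := fun φ => Coind.mk (f.restrictScalars k ∘ₗ (show B →ₗ[k] X from φ))
      map_zero' := Coind.ext fun _ => map_zero f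
      map_add' := fun _ _ => Coind.ext fun _ => map_add f _ _ }
    (fun _ _ _ => Coind.ext fun _ => map_smul f _ _)

theorem Coind.map_eval (f : X →ₗ[A] X') (φ : Coind k B X) (b : B) :
    (Coind.map f φ).eval b = f (φ.eval b) := rfl

theorem Coind.map_injective {f : X →ₗ[A] X'} (hf : Function.Injective f) :
    Function.Injective (Coind.map f : Coind k B X →ₗ[A ⊗[k] B] _) := fun _ _ h =>
  Coind.ext fun b => hf (congrArg (fun χ => χ.eval b) h)

/-- Coinduction is right adjoint to restriction to `A`, and restriction preserves injective maps. -/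
theorem Coind.injective [Module.Injective A X] : Module.Injective (A ⊗[k] B) (Coind k B X) where
  out Y Z _ _ _ _ f hf g := by
    obtain ⟨h, hh⟩ := Module.Injective.out (Q := X) (Bi.mapLeft f) hf
      (Coind.counit ∘ₗ Bi.mapLeft g)
    refine ⟨Coind.lift h, fun y => Coind.ext fun b => ?_⟩
    rw [Coind.lift_eval, Coind.eval_eq_counit (A := A)]
    have h1 := hh (b • Bi.mk k A B Y y)
    rw [Bi.smul_mk_right, Bi.mapLeft_mk, map_smul, ← Bi.smul_mk_right] at h1
    rw [h1, Bi.smul_mk_right, ← map_smul]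
    rfl

variable (A) in
theorem Coind.bi_smul_eval (b : B) (φ : Bi k A B (Coind k B X)) (x : B) :
    ((Bi.mk k A B _).symm (b • φ)).eval x = ((Bi.mk k A B _).symm φ).eval (x * b) := by
  rw [Bi.mk_symm_smul_right, Coind.smul_eval, one_smul]

-- `B`-maps from `Y` to `Hom_k(B, X)` correspond to `k`-linear maps `Y → X`, and these extend along
-- injections because `k` is a field.
variable (A X) in
theorem Coind.injective_right : Module.Injective B (Bi k A B (Coind k B X)) where
  out Y Z _ _ _ _ f hf g := by
    let _ : Module k Y := Module.compHom Y (algebraMap k B)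
    let _ : Module k Z := Module.compHom Z (algebraMap k B)
    have : IsScalarTower k B Y := .of_algebraMap_smul fun _ _ => rfl
    have : IsScalarTower k B Z := .of_algebraMap_smul fun _ _ => rfl
    -- The `k`-linear map corresponding to `g`; it is extended to `Z` through a `k`-linear
    -- retraction `r` of `f`.
    let g₁ : Y →ₗ[k] X :=
      { toFun := fun y => ((Bi.mk k A B _).symm (g y)).eval 1
        map_add' := fun x y => by simp
        map_smul' := fun c y => by
          rw [← algebraMap_smul B c y, map_smul, Coind.bi_smul_eval, one_mul,
            Algebra.algebraMap_eq_smul_one, Coind.eval_smul, RingHom.id_apply] }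
    obtain ⟨r, hr⟩ := (f.restrictScalars k).exists_leftInverse_of_injective
      (LinearMap.ker_eq_bot.2 hf)
    have hr' : ∀ y, r (f y) = y := fun y => LinearMap.congr_fun hr y
    refine ⟨
      { toFun := fun z => Bi.mk k A B _ (Coind.mk
          (g₁ ∘ₗ r ∘ₗ (LinearMap.toSpanSingleton B Z z).restrictScalars k))
        map_add' := fun x y => ?_
        map_smul' := fun b z => ?_ }, fun y => ?_⟩
    · apply (Bi.mk k A B _).symm.injective
      refine Coind.ext fun b => ?_
      simp
    · apply (Bi.mk k A B _).symm.injective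
      refine Coind.ext fun x => ?_
      rw [RingHom.id_apply, Coind.bi_smul_eval]
      simp [mul_smul]
    · apply (Bi.mk k A B _).symm.injective
      refine Coind.ext fun b => ?_
      have h1 : r (b • f y) = b • y := by rw [← map_smul, hr']
      simp [h1, g₁, Coind.bi_smul_eval]

end Coinduced

/-! ### Inflation along an augmentation of B. -/

section Inflation

variable {k B : Type u} (A : Type u) [Field k] [Ring A] [Ring B] [Algebra k A] [Algebra k B]
  (ε : B →ₐ[k] k)

/-- The algebra homomorphism `A ⊗ B → A` induced by an augmentation of `B`. -/
noncomputable def augmentation : A ⊗[k] B →ₐ[k] A :=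
  Algebra.TensorProduct.lift (AlgHom.id k A) ((Algebra.ofId k A).comp ε)
    fun a b => show Commute _ _ from (Algebra.commutes (ε b) a).symm

theorem augmentation_tmul (a : A) (b : B) : augmentation A ε (a ⊗ₜ[k] b) = ε b • a := by
  rw [augmentation, Algebra.TensorProduct.lift_tmul, AlgHom.id_apply, AlgHom.comp_apply,
    Algebra.ofId_apply, ← Algebra.commutes, ← Algebra.smul_def]

variable {A}

/-- The inflation of an `A`-module along an augmentation of `B`. -/
def Infl (X : Type u) : Type u := let _ := ε; X

variable (X : Type u) [AddCommGroup X]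

instance : AddCommGroup (Infl ε X) := inferInstanceAs (AddCommGroup X)

variable [Module A X]

noncomputable instance : Module (A ⊗[k] B) (Infl ε X) :=
  Module.compHom X (augmentation A ε).toRingHom

/-- The identity map onto the inflation. -/
def Infl.mk : X ≃+ Infl ε X := AddEquiv.refl X

variable {X} [Module k X] [IsScalarTower k A X]

theorem Infl.smul_mk (a : A) (b : B) (x : X) :
    (a ⊗ₜ[k] b) • Infl.mk ε X x = Infl.mk ε X (ε b • a • x) := by
  change (augmentation A ε (a ⊗ₜ[k] b)) • x = ε b • a • x
  rw [augmentation_tmul, smul_assoc]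

/-- Restricting an inflation gives back the original module. -/
noncomputable def Infl.biEquiv : Bi k A B (Infl ε X) ≃ₗ[A] X where
  toFun x := (Infl.mk ε X).symm ((Bi.mk k A B _).symm x)
  invFun x := Bi.mk k A B _ (Infl.mk ε X x)
  left_inv x := rfl
  right_inv x := rfl
  map_add' x y := rfl
  map_smul' a x := by
    obtain ⟨x, rfl⟩ := (Bi.mk k A B _).surjective x
    obtain ⟨x, rfl⟩ := (Infl.mk ε X).surjective x
    rw [Bi.smul_mk_left, Infl.smul_mk]
    simp

variable {X' : Type u} [AddCommGroup X'] [Module k X'] [Module A X'] [IsScalarTower k A X']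

/-- The map from an inflation determined by an `A`-linear map into the elements on which `B` acts
through the augmentation. -/
noncomputable def Infl.desc {M : Type u} [AddCommGroup M] [Module (A ⊗[k] B) M]
    (g : X →ₗ[A] Bi k A B M) (hg : ∀ (b : B) (x : X), b • g x = ε b • g x) :
    Infl ε X →ₗ[A ⊗[k] B] M :=
  linearMapOfTmul
    ((Bi.mk k A B M).symm.toAddMonoidHom.comp
      (g.toAddMonoidHom.comp (Infl.mk ε X).symm.toAddMonoidHom))
    fun a b m => by
      obtain ⟨x, rfl⟩ := (Infl.mk ε X).surjective m
      rw [Infl.smul_mk]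
      change (Bi.mk k A B M).symm (g (ε b • a • x)) = (a ⊗ₜ[k] b) • (Bi.mk k A B M).symm (g x)
      have h : g (ε b • a • x) = a • b • g x := by
        refine (map_smul (g.restrictScalars k) (ε b) (a • x)).trans ?_
        rw [hg, LinearMap.restrictScalars_apply, map_smul, smul_comm]
      exact (congrArg (Bi.mk k A B M).symm h).trans
        (Bi.smul_smul_mk a b ((Bi.mk k A B M).symm (g x)))

theorem Infl.desc_mk {M : Type u} [AddCommGroup M] [Module (A ⊗[k] B) M]
    (g : X →ₗ[A] Bi k A B M) (hg : ∀ (b : B) (x : X), b • g x = ε b • g x) (x : X) :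
    Infl.desc ε g hg (Infl.mk ε X x) = (Bi.mk k A B M).symm (g x) := rfl

/-- Functoriality of inflation. -/
noncomputable def Infl.map (f : X →ₗ[A] X') : Infl ε X →ₗ[A ⊗[k] B] Infl ε X' :=
  linearMapOfTmul ((Infl.mk ε X').toAddMonoidHom.comp
    (f.toAddMonoidHom.comp (Infl.mk ε X).symm.toAddMonoidHom)) fun a b m => by
      obtain ⟨x, rfl⟩ := (Infl.mk ε X).surjective m
      rw [Infl.smul_mk]
      change Infl.mk ε X' (f (ε b • a • x)) = (a ⊗ₜ[k] b) • Infl.mk ε X' (f x)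
      rw [Infl.smul_mk]
      congr 1
      refine (map_smul (f.restrictScalars k) (ε b) (a • x)).trans ?_
      rw [LinearMap.restrictScalars_apply, map_smul]

/-- Functoriality of inflation on isomorphisms. -/
noncomputable def Infl.congr (e : X ≃ₗ[A] X') : Infl ε X ≃ₗ[A ⊗[k] B] Infl ε X' :=
  LinearEquiv.ofBijective (Infl.map ε e.toLinearMap) e.bijective

/-- The projection of the induced module onto the inflation. -/
noncomputable def ExtTensor.aug : ExtTensor k X B →ₗ[A ⊗[k] B] Infl ε X :=
  ExtTensor.linearMap (N := B)
    ((Infl.mk ε X).toAddMonoidHom.comp (ExtTensor.contractAux ε.toLinearMap)) fun a b x n => by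
      change Infl.mk ε X (ExtTensor.contractAux _ _) =
        (a ⊗ₜ[k] b) • Infl.mk ε X (ExtTensor.contractAux _ _)
      rw [ExtTensor.contractAux_tmul, ExtTensor.contractAux_tmul, Infl.smul_mk]
      simp only [AlgHom.toLinearMap_apply, smul_eq_mul, map_mul, mul_smul]
      rw [smul_comm a (ε n) x]

theorem ExtTensor.aug_apply (t : ExtTensor k X B) :
    ExtTensor.aug (A := A) ε t = Infl.mk ε X (ExtTensor.contractAux ε.toLinearMap t) := rfl

theorem ExtTensor.aug_tmul (x : X) (b : B) :
    ExtTensor.aug (A := A) ε (.tmul x b) = Infl.mk ε X (ε b • x) := by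
  rw [aug_apply, contractAux_tmul]
  rfl

theorem ExtTensor.aug_surjective :
    Function.Surjective (ExtTensor.aug ε : ExtTensor k X B →ₗ[A ⊗[k] B] Infl ε X) := fun y => by
  obtain ⟨x, rfl⟩ := (Infl.mk ε X).surjective y
  exact ⟨.tmul x 1, by rw [aug_tmul, map_one, one_smul]⟩

/-- Since `b` acts on an inflation as the scalar `ε b`, the elements `x ⊗ b` and `ε b • x ⊗ 1` have
the same image. -/
theorem ExtTensor.map_to_infl_eq (g : ExtTensor k X B →ₗ[A ⊗[k] B] Infl ε X')
    (t : ExtTensor k X B) :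
    g t = g (.tmul (ExtTensor.contractAux ε.toLinearMap t) 1) := by
  induction t using ExtTensor.induction_on with
  | zero =>
    have : (ExtTensor.tmul (0 : X) (1 : B) : ExtTensor k X B) = 0 := TensorProduct.zero_tmul _ _
    rw [map_zero, map_zero, this, map_zero]
  | tmul x b =>
    have h : (ExtTensor.tmul (ε b • x) (1 : B) : ExtTensor k X B) =
        ((1 : A) ⊗ₜ[k] algebraMap k B (ε b)) • .tmul x 1 := by
      rw [ExtTensor.smul_tmul, one_smul, smul_eq_mul, mul_one, Algebra.algebraMap_eq_smul_one]
      exact TensorProduct.smul_tmul _ _ _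
    rw [contractAux_tmul, AlgHom.toLinearMap_apply, h, map_smul, ExtTensor.tmul_eq_smul (A := A),
      map_smul]
    obtain ⟨y, hy⟩ := (Infl.mk ε X').surjective (g (.tmul x 1))
    rw [← hy, Infl.smul_mk, Infl.smul_mk, AlgHom.commutes]
    rfl
  | add s t hs ht =>
    have : (ExtTensor.tmul (contractAux ε.toLinearMap s + contractAux ε.toLinearMap t) (1 : B) :
        ExtTensor k X B) = .tmul (contractAux ε.toLinearMap s) 1 +
          .tmul (contractAux ε.toLinearMap t) 1 := TensorProduct.add_tmul _ _ _
    rw [map_add, map_add, this, map_add, hs, ht]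

/-- The embedding of the inflation into the coinduced module. -/
noncomputable def Infl.toCoind : Infl ε X →ₗ[A ⊗[k] B] Coind k B X :=
  Coind.lift (Infl.biEquiv ε).toLinearMap

theorem Infl.toCoind_eval (x : X) (b : B) :
    (Infl.toCoind (A := A) ε (Infl.mk ε X x)).eval b = ε b • x := by
  rw [toCoind, Coind.lift_eval, Bi.smul_mk_right, Infl.smul_mk, one_smul]
  rfl

theorem Infl.toCoind_injective :
    Function.Injective (Infl.toCoind ε : Infl ε X →ₗ[A ⊗[k] B] Coind k B X) := fun x y h => by
  obtain ⟨x, rfl⟩ := (Infl.mk ε X).surjective x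
  obtain ⟨y, rfl⟩ := (Infl.mk ε X).surjective y
  have := congrArg (fun φ => φ.eval 1) h
  simp only [toCoind_eval, map_one, one_smul] at this
  rw [this]

theorem Infl.map_to_coind_eval (f : Infl ε X →ₗ[A ⊗[k] B] Coind k B X') (x : X) (b : B) :
    (f (Infl.mk ε X x)).eval b = (f (Infl.mk ε X (ε b • x))).eval 1 := by
  rw [Coind.eval_apply_eq, Infl.smul_mk, one_smul]

end Inflation

/-! ### The augmentation of a local algebra over an algebraically closed field. -/

section Augmentation

variable {B : Type u} [Ring B]

theorem isUnit_of_mul_eq_one_left (k : Type u) [Field k] [Algebra k B] [FiniteDimensional k B]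
    {x y : B} (h : x * y = 1) : IsUnit y := by
  have hinj : Function.Injective (LinearMap.mulLeft k y) := fun a b hab => by
    have := congrArg (x * ·) (show y * a = y * b from hab)
    simpa [← mul_assoc, h] using this
  obtain ⟨z, hz⟩ := LinearMap.surjective_of_injective hinj 1
  have hz : y * z = 1 := hz
  have hxz : x = z := by rw [← mul_one x, ← hz, ← mul_assoc, h, one_mul]
  exact ⟨⟨y, x, hxz ▸ hz, h⟩, rfl⟩

/-- If `b • n ≠ 0`, then `x • b • n = n` for some `x` by simplicity. As `x * b` is not a unit,
locality makes `1 - x * b` a unit that kills `n`. -/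
theorem smul_eq_zero_of_not_isUnit (k : Type u) [Field k] [Algebra k B] [FiniteDimensional k B]
    [IsLocalRing B] {N : Type u} [AddCommGroup N] [Module B N] [IsSimpleModule B N]
    {b : B} (hb : ¬ IsUnit b) (n : N) : b • n = 0 := by
  by_contra h
  obtain ⟨x, hx⟩ := (isSimpleModule_iff_toSpanSingleton_surjective.1
    (inferInstance : IsSimpleModule B N)).2 _ h n
  have hx : x • b • n = n := hx
  have h1 : ¬ IsUnit (x * b) := fun h => hb <| by
    obtain ⟨u, hu⟩ := h
    refine isUnit_of_mul_eq_one_left k (x := ↑u⁻¹ * x) ?_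
    rw [mul_assoc, ← hu, Units.inv_mul]
  have h2 : IsUnit (1 - x * b) :=
    (IsLocalRing.isUnit_or_isUnit_of_add_one (add_sub_cancel (x * b) 1)).resolve_left h1
  have h3 : (1 - x * b) • n = 0 := by rw [sub_smul, one_smul, mul_smul, hx, sub_self]
  have h4 : n = 0 := (h2.smul_eq_zero).1 h3
  exact h (by rw [h4, smul_zero])

variable {k : Type u} [Field k] [Algebra k B] [FiniteDimensional k B]

/-- Take for `c` an eigenvalue of left multiplication by `b`. -/
theorem exists_not_isUnit_sub [IsAlgClosed k] [Nontrivial B] (b : B) :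
    ∃ c : k, ¬ IsUnit (b - algebraMap k B c) := by
  obtain ⟨c, hc⟩ := Module.End.exists_eigenvalue (LinearMap.mulLeft k b)
  obtain ⟨x, hx, hx0⟩ := hc.exists_hasEigenvector
  refine ⟨c, fun h => hx0 ?_⟩
  have hx : b * x = c • x := Module.End.mem_eigenspace_iff.1 hx
  have : (b - algebraMap k B c) * x = 0 := by
    rw [sub_mul, hx, ← Algebra.smul_def, sub_self]
  exact (h.mul_right_eq_zero).1 this

variable (k B) in
/-- A finite-dimensional local algebra over an algebraically closed field has an augmentation, whose
kernel consists of the nonunits. -/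
theorem exists_augmentation [IsAlgClosed k] [IsLocalRing B] :
    ∃ ε : B →ₐ[k] k, ∀ b, ε b = 0 ↔ ¬ IsUnit b := by
  obtain ⟨I, hI⟩ := Ideal.exists_maximal B
  have : IsSimpleModule B (B ⧸ I) := isSimpleModule_iff_isCoatom.2 hI.out
  have := IsSimpleModule.nontrivial B (B ⧸ I)
  obtain ⟨v, hv⟩ := exists_ne (0 : B ⧸ I)
  -- Each `b` differs from a scalar by a nonunit, so it acts on the simple module `B ⧸ I` as that
  -- scalar. This scalar is the augmentation.
  have key : ∀ b : B, ∃ c : k, ∀ n : B ⧸ I, b • n = algebraMap k B c • n := fun b => by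
    obtain ⟨c, hc⟩ := exists_not_isUnit_sub (k := k) b
    refine ⟨c, fun n => ?_⟩
    rw [← sub_eq_zero, ← sub_smul]
    exact smul_eq_zero_of_not_isUnit k hc n
  choose c hc using key
  have hinj : ∀ x y : k, algebraMap k B x • v = algebraMap k B y • v → x = y := fun x y h => by
    by_contra hxy
    rw [← sub_eq_zero, ← sub_smul, ← map_sub] at h
    exact hv (((isUnit_iff_ne_zero.2 (sub_ne_zero.2 hxy)).map (algebraMap k B)).smul_eq_zero.1 h)
  have halg : ∀ x, c (algebraMap k B x) = x := fun x => hinj _ _ (hc _ v).symm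
  refine ⟨⟨⟨⟨⟨c, ?_⟩, fun x y => ?_⟩, ?_, fun x y => ?_⟩, halg⟩, fun b => ?_⟩
  · simpa using halg 1
  · refine hinj _ _ ?_
    rw [← hc, map_mul, mul_smul, mul_smul, ← hc, hc y v, hc x]
  · simpa using halg 0
  · refine hinj _ _ ?_
    rw [← hc, map_add, add_smul, add_smul, ← hc, ← hc]
  · change c b = 0 ↔ _
    constructor
    · intro h hb
      have := hc b v
      rw [h, map_zero, zero_smul] at this
      exact hv (hb.smul_eq_zero.1 this)
    · intro hb
      refine hinj _ _ ?_
      rw [← hc, smul_eq_zero_of_not_isUnit k hb, map_zero, zero_smul]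

theorem smul_eq_of_isSimpleModule [IsLocalRing B] {ε : B →ₐ[k] k}
    (hε : ∀ b, ε b = 0 ↔ ¬ IsUnit b) {N : Type u} [AddCommGroup N]
    [Module B N] [Module k N] [IsScalarTower k B N] [IsSimpleModule B N] (b : B) (n : N) :
    b • n = ε b • n := by
  have h : ¬ IsUnit (b - algebraMap k B (ε b)) := by
    rw [← hε, map_sub, AlgHom.commutes]
    simp
  rw [← sub_eq_zero, ← algebraMap_smul B (ε b) n, ← sub_smul]
  exact smul_eq_zero_of_not_isUnit k h n

end Augmentation

end Strat

namespace Strat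

/-! ### Finite generation of induced and coinduced modules. -/

section Finiteness

variable {k A B : Type u} [Field k] [Ring A] [Ring B] [Algebra k A] [Algebra k B]
  {X : Type u} [AddCommGroup X] [Module k X] [Module A X] [IsScalarTower k A X]
  {N : Type u} [AddCommGroup N] [Module k N] [Module B N] [IsScalarTower k B N]

instance : IsScalarTower k (A ⊗[k] B) (ExtTensor k X N) := .of_algebraMap_smul fun c t => by
  induction t using ExtTensor.induction_on with
  | zero => simp
  | tmul x n =>
    rw [Algebra.TensorProduct.algebraMap_apply, ExtTensor.smul_tmul, one_smul, algebraMap_smul]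
    rfl
  | add x y hx hy => rw [smul_add, smul_add, hx, hy]

instance : IsScalarTower k (A ⊗[k] B) (Coind k B X) := .of_algebraMap_smul fun c φ => by
  refine Coind.ext fun x => ?_
  rw [Algebra.TensorProduct.algebraMap_apply, Coind.smul_eval, mul_one, algebraMap_smul]
  rfl

instance [FiniteDimensional k X] [FiniteDimensional k N] :
    Module.Finite (A ⊗[k] B) (ExtTensor k X N) := by
  have : Module.Finite k (ExtTensor k X N) := inferInstanceAs (Module.Finite k (X ⊗[k] N))
  exact Module.Finite.of_restrictScalars_finite k _ _

instance [FiniteDimensional k X] [FiniteDimensional k B] :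
    Module.Finite (A ⊗[k] B) (Coind k B X) := by
  have : Module.Finite k (Coind k B X) := inferInstanceAs (Module.Finite k (B →ₗ[k] X))
  exact Module.Finite.of_restrictScalars_finite k _ _

end Finiteness

/-! ### Induction keeps simple tops, coinduction keeps simple socles. -/

section Inducing

variable {k A B : Type u} [Field k] [Ring A] [Ring B] [Algebra k A] [Algebra k B]

instance ExtTensor.projective {P : Type u} [AddCommGroup P] [Module k P] [Module A P]
    [IsScalarTower k A P] [Module.Projective A P] :
    Module.Projective (A ⊗[k] B) (ExtTensor k P B) := by
  refine Module.Projective.of_lifting_property'' fun f hf => ?_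
  obtain ⟨h, hh⟩ := Module.projective_lifting_property (Bi.mapLeft f)
    (ExtTensor.unit : P →ₗ[A] Bi k A B (ExtTensor k P B)) hf
  refine ⟨ExtTensor.lift h, ExtTensor.hom_ext fun x b => ?_⟩
  have h1 : f ((Bi.mk k A B _).symm (h x)) = ExtTensor.tmul x 1 := LinearMap.congr_fun hh x
  rw [LinearMap.comp_apply, ExtTensor.lift_tmul, Bi.mk_symm_smul_right, map_smul, h1,
    ← ExtTensor.tmul_eq_smul]
  rfl

variable {Λ : Type w} {S : SimpleSystem A Λ} {ε : B →ₐ[k] k}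

open scoped ModuleCat

variable [FiniteDimensional k B]

/-- A maximal submodule `K` above `N` has an inflated simple quotient, so `X ⊗ B → (X ⊗ B) ⧸ K` is
determined by a map from `X`. The kernel of that map is the unique maximal submodule `ker p`, hence
`K` also contains the kernel of `X ⊗ B → L`, a contradiction. Stated for any `X` with simple top, it
serves both `P l` and `Δ l`. -/
theorem infl_comp_aug_superfluous
    (hZ : ∀ (Z : Type u) [AddCommGroup Z] [Module (A ⊗[k] B) Z] [IsSimpleModule (A ⊗[k] B) Z],
      ∃ m, Nonempty (Infl ε (S.L m) ≃ₗ[A ⊗[k] B] Z))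
    {X L : Type u} [AddCommGroup X] [Module k X] [Module A X] [IsScalarTower k A X]
    [FiniteDimensional k X] [AddCommGroup L] [Module k L] [Module A L] [IsScalarTower k A L]
    [IsSimpleModule A L] {p : X →ₗ[A] L} (hp : Function.Surjective p)
    (hs : ∀ N : Submodule A X, N ⊔ LinearMap.ker p = ⊤ → N = ⊤)
    (N : Submodule (A ⊗[k] B) (ExtTensor k X B))
    (hN : N ⊔ LinearMap.ker (Infl.map ε p ∘ₗ ExtTensor.aug ε : _ →ₗ[A ⊗[k] B] _) = ⊤) : N = ⊤ := by
  by_contra hne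
  obtain ⟨K, hK, hNK⟩ := (eq_top_or_exists_le_coatom N).resolve_left hne
  have : IsSimpleModule (A ⊗[k] B) (ExtTensor k X B ⧸ K) := isSimpleModule_iff_isCoatom.2 hK
  obtain ⟨m, ⟨e⟩⟩ := hZ (ExtTensor k X B ⧸ K)
  let g : ExtTensor k X B →ₗ[A ⊗[k] B] Infl ε (S.L m) := e.symm.toLinearMap ∘ₗ K.mkQ
  have hgK : ∀ t, g t = 0 ↔ t ∈ K := fun t => by simp [g]
  let h : X →ₗ[A] S.L m :=
    (Infl.biEquiv ε).toLinearMap ∘ₗ Bi.mapLeft g ∘ₗ ExtTensor.unit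
  have hh : ∀ x, h x = 0 ↔ g (.tmul x 1) = 0 := fun x => Iff.rfl
  have h0 : h ≠ 0 := fun h0 => hK.1 <| eq_top_iff.2 fun t _ => by
    rw [← hgK, ExtTensor.map_to_infl_eq, ← hh, h0, LinearMap.zero_apply]
  have hco : IsCoatom (LinearMap.ker h) :=
    LinearMap.isCoatom_ker_of_surjective (LinearMap.surjective_of_ne_zero h0)
  have hco' : IsCoatom (LinearMap.ker p) := LinearMap.isCoatom_ker_of_surjective hp
  have hle := le_ker_of_superfluous hp hs hco.1
  have heq : LinearMap.ker p = LinearMap.ker h := by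
    rcases hco.le_iff.1 hle with h | h
    · exact absurd h hco'.1
    · exact h
  refine hK.1 (eq_top_iff.2 (hN ▸ sup_le hNK fun t ht => ?_))
  rw [← hgK, ExtTensor.map_to_infl_eq, ← hh]
  have hpt : ExtTensor.contractAux ε.toLinearMap t ∈ LinearMap.ker p := ht
  rw [heq] at hpt
  exact hpt

/-- Dual argument: a simple submodule `K` of `N` is an inflated simple, and evaluation at `1` embeds
that simple into `X`, where its image contains the socle `L`. -/
theorem coind_comp_toCoind_essential [FiniteDimensional k A]
    (hZ : ∀ (Z : Type u) [AddCommGroup Z] [Module (A ⊗[k] B) Z] [IsSimpleModule (A ⊗[k] B) Z],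
      ∃ m, Nonempty (Infl ε (S.L m) ≃ₗ[A ⊗[k] B] Z))
    {X L : Type u} [AddCommGroup X] [Module k X] [Module A X] [IsScalarTower k A X]
    [FiniteDimensional k X] [AddCommGroup L] [Module k L] [Module A L] [IsScalarTower k A L]
    [IsSimpleModule A L] {i : L →ₗ[A] X} (hi : Function.Injective i)
    (hs : ∀ N : Submodule A X, N ⊓ LinearMap.range i = ⊥ → N = ⊥)
    (N : Submodule (A ⊗[k] B) (Coind k B X))
    (hN : N ⊓ LinearMap.range (Coind.map i ∘ₗ Infl.toCoind ε : _ →ₗ[A ⊗[k] B] _) = ⊥) :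
    N = ⊥ := by
  have : IsArtinianRing (A ⊗[k] B) := IsArtinianRing.of_finite k _
  by_contra hne
  obtain ⟨K, hK, hNK⟩ := (eq_bot_or_exists_atom_le N).resolve_left hne
  have : IsSimpleModule (A ⊗[k] B) K := isSimpleModule_iff_isAtom.2 hK
  obtain ⟨m, ⟨e⟩⟩ := hZ K
  let j : Infl ε (S.L m) →ₗ[A ⊗[k] B] Coind k B X := K.subtype ∘ₗ e.toLinearMap
  let h : S.L m →ₗ[A] X :=
    Coind.counit ∘ₗ Bi.mapLeft j ∘ₗ (Infl.biEquiv ε).symm.toLinearMap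
  have hh : ∀ x, h x = (j (Infl.mk ε _ x)).eval 1 := fun x => rfl
  have h0 : h ≠ 0 := fun h0 => by
    have hj : ∀ x, j x = 0 := fun x => by
      obtain ⟨x, rfl⟩ := (Infl.mk ε _).surjective x
      refine Coind.ext fun b => ?_
      rw [Infl.map_to_coind_eval, ← hh, h0]
      rfl
    have := IsSimpleModule.nontrivial (A ⊗[k] B) K
    obtain ⟨y, hy⟩ := exists_ne (0 : K)
    obtain ⟨x, rfl⟩ := e.surjective y
    exact hy (Subtype.ext (hj x))
  have hr := range_le_of_essential hs (N := LinearMap.range h)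
    (fun h' => h0 (LinearMap.range_eq_bot.1 h'))
  have := IsSimpleModule.nontrivial A L
  obtain ⟨y, hy⟩ := exists_ne (0 : L)
  obtain ⟨x, hx⟩ := hr ⟨y, rfl⟩
  have hjx : j (Infl.mk ε _ x) = Coind.map i (Infl.toCoind (A := A) ε (Infl.mk ε _ y)) := by
    refine Coind.ext fun b => ?_
    rw [Infl.map_to_coind_eval, ← hh, Coind.map_eval, Infl.toCoind_eval]
    refine (map_smul (h.restrictScalars k) (ε b) x).trans ?_
    refine Eq.trans ?_ (map_smul (i.restrictScalars k) (ε b) y).symm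
    exact congrArg _ hx
  have hmem : j (Infl.mk ε _ x) ∈
      N ⊓ LinearMap.range (Coind.map i ∘ₗ Infl.toCoind ε : _ →ₗ[A ⊗[k] B] _) :=
    ⟨hNK (e _).2, ⟨Infl.mk ε _ y, hjx.symm⟩⟩
  rw [hN, Submodule.mem_bot, hjx] at hmem
  have := congrArg (fun φ => φ.eval 1) hmem
  simp only [Coind.map_eval, Infl.toCoind_eval, map_one, one_smul, Coind.zero_eval] at this
  exact hy (hi (this.trans (map_zero i).symm))

end Inducing

/-! ### Filtrations of external tensor products. -/

section FiltTensor

variable {k A B : Type u} [Field k] [Ring A] [Ring B] [Algebra k A] [Algebra k B]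

open scoped ModuleCat

/-- Tensoring over a field is exact. The `k`-structure on `M` is quantified inside the conclusion so
that the induction can give each submodule the structure induced from `A`. -/
theorem Filt.extTensor {J J' : Type*} {X : J → ModuleCat.{u} A}
    {Y : J' → ModuleCat.{u} (A ⊗[k] B)} {N : Type u} [AddCommGroup N] [Module k N] [Module B N]
    [IsScalarTower k B N] (hY : ∀ j, Filt Y (ExtTensor k (X j) N)) {M : Type u} [AddCommGroup M]
    [Module A M] (h : Filt X M) :
    ∀ [Module k M] [IsScalarTower k A M], Filt Y (ExtTensor k M N) := by
  induction h with
  | zero M =>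
    intro _ _
    have : Subsingleton (ExtTensor k M N) := inferInstanceAs (Subsingleton (M ⊗[k] N))
    exact .zero _
  | @cons M' M _ _ _ _ i j q hi hex hq hN ih =>
    intro _ _
    let _ : Module k M' := Module.compHom M' (algebraMap k A)
    have : IsScalarTower k A M' := .of_algebraMap_smul fun _ _ => rfl
    exact ih.ext (hY j) (ExtTensor.map i LinearMap.id) (ExtTensor.map q LinearMap.id)
      (ExtTensor.map_left_injective N hi) (ExtTensor.map_left_exact N hex hq)
      (ExtTensor.map_left_surjective N hq)

variable {ε : B →ₐ[k] k}

/-- If `B` acts through its augmentation on a one-dimensional module then the external tensor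
product with it is the inflation. -/
theorem nonempty_infl_equiv_extTensor [FiniteDimensional k B] [IsLocalRing B]
    (hε : ∀ b, ε b = 0 ↔ ¬ IsUnit b) {X N : Type u}
    [AddCommGroup X] [Module k X] [Module A X] [IsScalarTower k A X] [AddCommGroup N]
    [Module k N] [Module B N] [IsScalarTower k B N] [IsSimpleModule B N] :
    Nonempty (Infl ε X ≃ₗ[A ⊗[k] B] ExtTensor k X N) := by
  have := IsSimpleModule.nontrivial B N
  obtain ⟨v, hv⟩ := exists_ne (0 : N)
  let g : X →ₗ[A] Bi k A B (ExtTensor k X N) :=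
    { toFun := fun x => Bi.mk k A B _ (.tmul x v)
      map_add' := fun x y => TensorProduct.add_tmul x y v
      map_smul' := fun a x => by
        rw [RingHom.id_apply, Bi.smul_mk_left, ExtTensor.smul_tmul, one_smul] }
  have hg : ∀ x, g x = Bi.mk k A B _ (.tmul x v) := fun _ => rfl
  have hgε : ∀ (b : B) (x : X), b • g x = ε b • g x := fun b x => by
    rw [hg, Bi.smul_mk_right, ExtTensor.smul_tmul, one_smul, smul_eq_of_isSimpleModule hε b v,
      ← algebraMap_smul A (ε b) (Bi.mk k A B (ExtTensor k X N) _), Bi.smul_mk_left,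
      ExtTensor.smul_tmul, one_smul, algebraMap_smul]
    exact congrArg _ (TensorProduct.smul_tmul _ _ _).symm
  refine ⟨LinearEquiv.ofBijective (Infl.desc ε g hgε) ⟨?_, fun t => ?_⟩⟩
  · rw [injective_iff_map_eq_zero]
    intro x hx
    obtain ⟨x, rfl⟩ := (Infl.mk ε X).surjective x
    rw [Infl.desc_mk] at hx
    obtain ⟨χ, hχ⟩ := not_forall.1 (mt (Module.forall_dual_apply_eq_zero_iff k v).1 hv)
    have h1 : ExtTensor.contract χ (g x) = 0 := by
      have : g x = 0 := hx
      rw [this, map_zero]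
    rw [hg, ExtTensor.contract_tmul] at h1
    rw [(smul_eq_zero.1 h1).resolve_left hχ, map_zero]
  · induction t using ExtTensor.induction_on with
    | zero => exact ⟨0, map_zero _⟩
    | tmul x n =>
      obtain ⟨b, rfl⟩ := (isSimpleModule_iff_toSpanSingleton_surjective.1
        (inferInstance : IsSimpleModule B N)).2 v hv n
      refine ⟨Infl.mk ε X (ε b • x), ?_⟩
      rw [Infl.desc_mk, hg, AddEquiv.symm_apply_apply, LinearMap.toSpanSingleton_apply,
        smul_eq_of_isSimpleModule hε b v]
      exact TensorProduct.smul_tmul _ _ _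
    | add s t hs ht =>
      obtain ⟨x, rfl⟩ := hs
      obtain ⟨y, rfl⟩ := ht
      exact ⟨x + y, map_add _ _ _⟩

/-- Every simple quotient of `N` over the local algebra `B` contributes one factor `Infl ε X`;
induct on the dimension of `N`. -/
theorem filt_extTensor_of_finiteDimensional [FiniteDimensional k B] [IsLocalRing B]
    (hε : ∀ b, ε b = 0 ↔ ¬ IsUnit b) {X : Type u}
    [AddCommGroup X] [Module k X] [Module A X] [IsScalarTower k A X] {J : Type*}
    {Y : J → ModuleCat.{u} (A ⊗[k] B)} (hY : Filt Y (Infl ε X)) (n : ℕ) :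
    ∀ {N : Type u} [AddCommGroup N] [Module k N] [Module B N] [IsScalarTower k B N]
      [FiniteDimensional k N], Module.finrank k N = n → Filt Y (ExtTensor k X N) := by
  induction n using Nat.strong_induction_on with
  | _ n ih =>
    intro N _ _ _ _ _ hn
    rcases subsingleton_or_nontrivial N with hN | hN
    · have : Subsingleton (ExtTensor k X N) := inferInstanceAs (Subsingleton (X ⊗[k] N))
      exact .zero _
    have : Module.Finite B N := Module.Finite.of_restrictScalars_finite k B N
    obtain ⟨K, hK⟩ := IsCoatomic.exists_coatom (Submodule B N)
    have : IsSimpleModule B (N ⧸ K) := isSimpleModule_iff_isCoatom.2 hK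
    obtain ⟨e⟩ := nonempty_infl_equiv_extTensor (A := A) hε (X := X) (N := N ⧸ K)
    have : FiniteDimensional k K := inferInstanceAs (FiniteDimensional k (K.restrictScalars k))
    have hlt : Module.finrank k K < n := by
      rw [← hn]
      refine Submodule.finrank_lt (s := K.restrictScalars k) fun h => hK.1 ?_
      exact (Submodule.restrictScalars_eq_top_iff k B N).1 h
    exact (ih _ hlt rfl : Filt Y (ExtTensor k X K)).ext (hY.of_equiv e)
      (ExtTensor.map LinearMap.id K.subtype) (ExtTensor.map LinearMap.id K.mkQ)
      (ExtTensor.map_right_injective X K.injective_subtype)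
      (ExtTensor.map_right_exact X (LinearMap.exact_subtype_mkQ K) K.mkQ_surjective)
      (ExtTensor.map_right_surjective X K.mkQ_surjective)

end FiltTensor

end Strat

namespace Strat

/-! ### The covers, hulls, standard and costandard modules of A ⊗ B. -/

open scoped ModuleCat

variable {k A B : Type u} [Field k] [Ring A] [Ring B] [Algebra k A] [Algebra k B]
  {Λ : Type w} {S : SimpleSystem A Λ} {SD : SimpleSystem (A ⊗[k] B) Λ} {ε : B →ₐ[k] k}

/-- The simple modules of the second system are the inflations of those of the first. -/
def IsInflation (S : SimpleSystem A Λ) (SD : SimpleSystem (A ⊗[k] B) Λ) (ε : B →ₐ[k] k) : Prop :=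
  ∀ l, Nonempty (Infl ε (S.L l) ≃ₗ[A ⊗[k] B] SD.L l)

theorem isInflation_of_isExternalTensor [FiniteDimensional k B] [IsLocalRing B]
    (hε : ∀ b, ε b = 0 ↔ ¬ IsUnit b) (LB : ModuleCat.{u} B) [IsSimpleModule B LB]
    (h : ∀ l, IsExternalTensor k (S.L l) LB (SD.L l)) : IsInflation S SD ε := fun l => by
  obtain ⟨e⟩ := nonempty_infl_equiv_extTensor (A := A) hε (X := S.L l) (N := LB)
  obtain ⟨f, hf⟩ := h l
  exact ⟨e.trans (LinearEquiv.ofBijective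
    (ExtTensor.linearMap (N := LB) f.toLinearMap.toAddMonoidHom hf) f.bijective)⟩

section Basic

theorem IsInflation.exists_equiv (hL : IsInflation S SD ε) (Z : Type u) [AddCommGroup Z]
    [Module (A ⊗[k] B) Z] [IsSimpleModule (A ⊗[k] B) Z] :
    ∃ m, Nonempty (Infl ε (S.L m) ≃ₗ[A ⊗[k] B] Z) := by
  obtain ⟨m, ⟨e⟩⟩ := SD.exists_iso Z
  exact ⟨m, (hL m).map fun f => f.trans e.symm⟩

theorem IsInflation.isSimpleModule (hL : IsInflation S SD ε) (l : Λ) :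
    IsSimpleModule (A ⊗[k] B) (Infl ε (S.L l)) :=
  (hL l).elim fun e => .congr e

variable [FiniteDimensional k A] [FiniteDimensional k B]

instance (l : Λ) : FiniteDimensional k (S.P l) := Module.Finite.trans A _

instance (l : Λ) : FiniteDimensional k (S.I l) := Module.Finite.trans A _

theorem IsInflation.nonempty_cover_equiv (hL : IsInflation S SD ε) (l : Λ) :
    Nonempty (SD.P l ≃ₗ[A ⊗[k] B] ExtTensor k (S.P l) B) := by
  obtain ⟨e⟩ := hL l
  refine IsProjectiveCover.nonempty_equiv (SD.isProjectiveCover l) (IsProjectiveCover.of_equiv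
    ⟨inferInstance, Infl.map ε (S.cover l) ∘ₗ ExtTensor.aug ε, ?_, ?_⟩ e)
  · exact Function.Surjective.comp (g := Infl.map ε (S.cover l)) (S.cover_surjective l)
      (ExtTensor.aug_surjective (A := A) ε)
  · exact infl_comp_aug_superfluous hL.exists_equiv (S.cover_surjective l) (S.cover_superfluous l)

theorem IsInflation.nonempty_hull_equiv (hL : IsInflation S SD ε) (l : Λ) :
    Nonempty (Coind k B (S.I l) ≃ₗ[A ⊗[k] B] SD.I l) := by
  obtain ⟨e⟩ := hL l
  have : Module.Injective A (S.I l) := (S.isInjectiveHull l).1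
  refine IsInjectiveHull.nonempty_equiv (IsInjectiveHull.of_equiv
    ⟨Coind.injective, Coind.map (S.hull l) ∘ₗ Infl.toCoind ε, ?_, ?_⟩ e.symm) (SD.isInjectiveHull l)
  · exact (Coind.map_injective (S.hull_injective l)).comp (Infl.toCoind_injective ε)
  · exact coind_comp_toCoind_essential hL.exists_equiv (S.hull_injective l) (S.hull_essential l)

end Basic

section Standard

variable [LinearOrder Λ] [FiniteDimensional k A] [FiniteDimensional k B]

instance (l : Λ) : FiniteDimensional k (S.standard l) :=
  have : IsArtinianRing A := IsArtinianRing.of_finite k A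
  Module.Finite.trans A _

instance (l : Λ) : FiniteDimensional k (S.costandard l) :=
  have : IsArtinianRing A := IsArtinianRing.of_finite k A
  Module.Finite.trans A _

/-- The standard modules of `A ⊗ B` are induced from those of `A`, and so are the kernels of the
projections onto them. -/
theorem IsInflation.nonempty_standard_equiv (hL : IsInflation S SD ε) (l : Λ) :
    Nonempty (SD.standard l ≃ₗ[A ⊗[k] B] ExtTensor k (S.standard l) B) ∧
      Nonempty (ExtTensor k (S.traceAbove l) B ≃ₗ[A ⊗[k] B] SD.traceAbove l) := by
  obtain ⟨e⟩ := hL.nonempty_cover_equiv l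
  let τ : ExtTensor k (S.P l) B →ₗ[A ⊗[k] B] ExtTensor k (S.standard l) B :=
    ExtTensor.map (S.toStandard l) LinearMap.id
  let σ : ExtTensor k (S.traceAbove l) B →ₗ[A ⊗[k] B] ExtTensor k (S.P l) B :=
    ExtTensor.map (S.traceAbove l).subtype LinearMap.id
  have hex : Function.Exact σ τ := ExtTensor.map_left_exact B
    (LinearMap.exact_subtype_mkQ (S.traceAbove l)) (S.toStandard_surjective l)
  have hσ : Function.Injective σ :=
    ExtTensor.map_left_injective B (S.traceAbove l).injective_subtype
  have hτ : Function.Surjective τ := ExtTensor.map_left_surjective B (S.toStandard_surjective l)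
  -- Maps out of `P m ⊗ B` are determined by their restriction to `P m`, and over `A` the target is
  -- a sum of copies of `Δ l`.
  have hQ : ∀ m, l < m → ∀ f : SD.P m →ₗ[A ⊗[k] B] ExtTensor k (S.standard l) B, f = 0 := by
    intro m hm f
    obtain ⟨em⟩ := hL.nonempty_cover_equiv m
    have h0 := ExtTensor.eq_zero_of_unit (f ∘ₗ em.symm.toLinearMap)
      (ExtTensor.hom_eq_zero (S.hom_standard_eq_zero hm) _)
    ext x
    have := LinearMap.congr_fun h0 (em x)
    simpa using this
  have hmem : ∀ y ∈ S.traceAbove l, ∀ b : B, e.symm (.tmul y b) ∈ SD.traceAbove l := by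
    -- The elements with all their tensors in the trace form an `A`-submodule, so only images of
    -- maps `f` from `P m` need checking; there `f ⊗ id` does the job.
    let T : Submodule A (S.P l) :=
      { carrier := {y | ∀ b : B, e.symm (.tmul y b) ∈ SD.traceAbove l}
        add_mem' := fun {x y} hx hy b => by
          have : (ExtTensor.tmul (x + y) b : ExtTensor k (S.P l) B) = .tmul x b + .tmul y b :=
            TensorProduct.add_tmul _ _ _
          rw [this, map_add]
          exact Submodule.add_mem _ (hx b) (hy b)
        zero_mem' := fun b => by
          have : (ExtTensor.tmul 0 b : ExtTensor k (S.P l) B) = 0 := TensorProduct.zero_tmul _ _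
          rw [this, map_zero]
          exact Submodule.zero_mem _
        smul_mem' := fun a x hx b => by
          have : (ExtTensor.tmul (a • x) b : ExtTensor k (S.P l) B) =
              (a ⊗ₜ[k] (1 : B)) • .tmul x b := by
            rw [ExtTensor.smul_tmul, one_smul]
          rw [this, map_smul]
          exact Submodule.smul_mem _ _ (hx b) }
    have hT : S.traceAbove l ≤ T := S.traceAbove_le fun m hm f => by
      rintro _ ⟨z, rfl⟩ b
      obtain ⟨em⟩ := hL.nonempty_cover_equiv m
      refine SD.range_le_traceAbove hm
        (e.symm.toLinearMap ∘ₗ ExtTensor.map f LinearMap.id ∘ₗ em.toLinearMap)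
        ⟨em.symm (.tmul z b), ?_⟩
      simp only [LinearMap.comp_apply, LinearEquiv.coe_coe, LinearEquiv.apply_symm_apply,
        ExtTensor.map_tmul, LinearMap.id_apply]
    exact hT
  have hk : LinearMap.ker (τ ∘ₗ e.toLinearMap) ≤ SD.traceAbove l := by
    intro x hx
    obtain ⟨s, hs⟩ := (hex (e x)).1 hx
    rw [← e.symm_apply_apply x, ← hs]
    clear hs hx
    induction s using ExtTensor.induction_on with
    | zero => simp
    | tmul y b => exact hmem y y.2 b
    | add s t hs ht =>
      rw [map_add, map_add]
      exact Submodule.add_mem _ hs ht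
  have hker := SD.traceAbove_eq_ker hQ hk
  refine ⟨⟨(Submodule.quotEquivOfEq _ _ hker).trans
    (LinearMap.quotKerEquivOfSurjective (τ ∘ₗ e.toLinearMap) (hτ.comp e.surjective))⟩, ⟨?_⟩⟩
  refine (LinearEquiv.ofInjective (e.symm.toLinearMap ∘ₗ σ) (e.symm.injective.comp hσ)).trans
    (LinearEquiv.ofEq _ _ ?_)
  rw [hker]
  ext x
  rw [LinearMap.mem_ker, LinearMap.comp_apply]
  refine Iff.trans ?_ (hex (e x)).symm
  constructor
  · rintro ⟨s, rfl⟩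
    exact ⟨s, by simp⟩
  · rintro ⟨s, hs⟩
    exact ⟨s, by simp [hs]⟩

/-- The costandard modules of `A ⊗ B` are coinduced from those of `A`. -/
theorem IsInflation.nonempty_costandard_equiv (hL : IsInflation S SD ε) (l : Λ) :
    Nonempty (Coind k B (S.costandard l) ≃ₗ[A ⊗[k] B] SD.costandard l) := by
  obtain ⟨e⟩ := hL.nonempty_hull_equiv l
  let j : Coind k B (S.costandard l) →ₗ[A ⊗[k] B] SD.I l :=
    e.toLinearMap ∘ₗ Coind.map (S.ofCostandard l)
  have hj : Function.Injective j :=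
    e.injective.comp (Coind.map_injective (S.ofCostandard_injective l))
  have hQ : ∀ m, l < m → ∀ f : Coind k B (S.costandard l) →ₗ[A ⊗[k] B] SD.I m, f = 0 := by
    intro m hm
    refine SD.hom_to_hull_eq_zero_iff.2 fun f => ?_
    obtain ⟨em⟩ := hL.nonempty_cover_equiv m
    have h0 : f ∘ₗ em.symm.toLinearMap = 0 := by
      refine ExtTensor.eq_zero_of_unit _ (LinearMap.ext fun x => ?_)
      refine Coind.ext fun b => ?_
      refine (Coind.eval_eq_counit (A := A) ((f ∘ₗ em.symm.toLinearMap) (.tmul x 1)) b).trans ?_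
      exact LinearMap.congr_fun (S.hom_cover_costandard_eq_zero hm
        (Coind.counit ∘ₗ Bi.rightSMul b ∘ₗ Bi.mapLeft (f ∘ₗ em.symm.toLinearMap) ∘ₗ
          ExtTensor.unit)) x
    ext1 x
    have := LinearMap.congr_fun h0 (em x)
    simpa using this
  have hk : SD.kernelAbove l ≤ LinearMap.range j := by
    intro x hx
    -- Coinducing `g : I l → I m` gives a map between the hulls of `A ⊗ B`. It kills `x`, so `g`
    -- kills every value of `x`.
    have hmem : ∀ b, (e.symm x).eval b ∈ S.kernelAbove l := fun b =>
      S.mem_kernelAbove.2 fun m hm g => by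
        obtain ⟨em⟩ := hL.nonempty_hull_equiv m
        have h := SD.mem_kernelAbove.1 hx m hm
          (em.toLinearMap ∘ₗ Coind.map g ∘ₗ e.symm.toLinearMap)
        have h' : Coind.map g (e.symm x) = (0 : Coind k B (S.I m)) := em.injective
          (h.trans (map_zero em).symm)
        rw [← Coind.map_eval, h', Coind.zero_eval]
    refine ⟨Coind.mk
      { toFun := fun b => (⟨(e.symm x).eval b, hmem b⟩ : S.kernelAbove l)
        map_add' := fun b c => Subtype.ext (Coind.eval_add _ _ _)
        map_smul' := fun c b => Subtype.ext ?_ }, ?_⟩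
    · refine (Coind.eval_smul _ _ _).trans ?_
      exact (map_smul ((S.ofCostandard l).restrictScalars k) c
        (show S.costandard l from ⟨_, hmem b⟩)).symm
    · refine (congrArg e (Coind.ext fun b => ?_)).trans (e.apply_symm_apply x)
      rfl
  exact ⟨(LinearEquiv.ofInjective j hj).trans
    (LinearEquiv.ofEq _ _ (SD.kernelAbove_eq_range hQ hk).symm)⟩

/-- The images of the non-surjective endomorphisms of `Δ ⊗ B` sum to `Δ ⊗ ker ε`. Modulo `ker ε`
such an endomorphism reduces to a non-surjective, hence zero, endomorphism of `Δ`; conversely right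
multiplications by elements of `ker ε` reach all of `Δ ⊗ ker ε`. -/
theorem IsInflation.nonempty_properStandard_equiv (hL : IsInflation S SD ε)
    (hS : ∀ l, S.radicalImage l = ⊥) (l : Λ) :
    Nonempty (SD.properStandard l ≃ₗ[A ⊗[k] B] Infl ε (S.standard l)) := by
  have : IsArtinianRing A := IsArtinianRing.of_finite k _
  have : IsArtinianRing (A ⊗[k] B) := IsArtinianRing.of_finite k _
  have := IsSimpleModule.nontrivial A (S.L l)
  have : Nontrivial (S.standard l) := (S.standardTop_surjective l).nontrivial
  obtain ⟨⟨e⟩, -⟩ := hL.nonempty_standard_equiv l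
  refine SD.nonempty_properStandard_equiv e (ExtTensor.aug_surjective (A := A) ε) ?_ ?_
  · intro f hf
    let g := ExtTensor.aug (A := A) ε ∘ₗ f
    -- The reduction of `f` modulo the augmentation.
    let fb : S.standard l →ₗ[A] S.standard l :=
      (Infl.biEquiv ε).toLinearMap ∘ₗ Bi.mapLeft g ∘ₗ ExtTensor.unit
    have hfb : ¬ Function.Surjective fb := fun h => hf <| by
      rw [← LinearMap.range_eq_top]
      refine infl_comp_aug_superfluous hL.exists_equiv (S.standardTop_surjective l)
        (S.standardTop_superfluous l) _ (eq_top_iff.2 fun t _ => ?_)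
      obtain ⟨x, hx⟩ := h (ExtTensor.contractAux ε.toLinearMap t)
      refine Submodule.mem_sup.2 ⟨f (.tmul x 1), ⟨_, rfl⟩, t - f (.tmul x 1), ?_, by abel⟩
      have hx' : ExtTensor.aug (A := A) ε (f (.tmul x 1)) = ExtTensor.aug (A := A) ε t := hx
      rw [LinearMap.mem_ker, LinearMap.comp_apply, map_sub, hx', sub_self, map_zero]
    have h0 : fb = 0 := SimpleSystem.end_standard_eq_zero hS hfb
    have hg : g = 0 := ExtTensor.eq_zero_of_unit _ (LinearMap.ext fun x =>
      (Infl.biEquiv (A := A) (B := B) ε).injective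
        ((LinearMap.congr_fun h0 x).trans (map_zero _).symm))
    rintro _ ⟨x, rfl⟩
    exact LinearMap.congr_fun hg x
  · intro N hN t ht
    have key : ∀ t : ExtTensor k (S.standard l) B,
        t - .tmul (ExtTensor.contractAux ε.toLinearMap t) 1 ∈ N := fun t => by
      induction t using ExtTensor.induction_on with
      | zero =>
        have : (ExtTensor.tmul (0 : S.standard l) (1 : B) : ExtTensor k (S.standard l) B) = 0 :=
          TensorProduct.zero_tmul _ _
        simp [this]
      | tmul x b =>
        -- The part of `b` in `ker ε`; right multiplication by it is an endomorphism of `Δ ⊗ B`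
        -- sending `x ⊗ 1` to `x ⊗ r`.
        let r := b - algebraMap k B (ε b)
        have hr : ε r = 0 := by simp [r]
        let f : ExtTensor k (S.standard l) B →ₗ[A ⊗[k] B] ExtTensor k (S.standard l) B :=
          ExtTensor.map LinearMap.id (LinearMap.toSpanSingleton B B r)
        have hf : ∀ t, ExtTensor.aug (A := A) ε (f t) = 0 := fun t => by
          have h : ExtTensor.aug (A := A) ε ∘ₗ f = 0 := ExtTensor.hom_ext fun y c => by
            rw [LinearMap.comp_apply, ExtTensor.map_tmul, ExtTensor.aug_tmul,
              LinearMap.toSpanSingleton_apply, smul_eq_mul, map_mul, hr, mul_zero, zero_smul,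
              map_zero, LinearMap.zero_apply]
          exact LinearMap.congr_fun h t
        have hns : ¬ Function.Surjective f := fun h => by
          obtain ⟨y, hy⟩ := exists_ne (0 : S.standard l)
          obtain ⟨t, ht⟩ := h (.tmul y 1)
          have h0 := hf t
          rw [ht, ExtTensor.aug_tmul, map_one, one_smul] at h0
          exact hy h0
        have := hN f hns ⟨.tmul x 1, rfl⟩
        rw [ExtTensor.map_tmul, LinearMap.toSpanSingleton_apply, one_smul] at this
        rw [ExtTensor.contractAux_tmul]
        convert this using 1
        change x ⊗ₜ[k] b - (ε b • x) ⊗ₜ[k] (1 : B) = x ⊗ₜ[k] (b - algebraMap k B (ε b))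
        rw [TensorProduct.tmul_sub, Algebra.algebraMap_eq_smul_one, TensorProduct.smul_tmul]
      | add s t hs ht =>
        have : (ExtTensor.tmul (ExtTensor.contractAux ε.toLinearMap s +
          ExtTensor.contractAux ε.toLinearMap t) (1 : B) : ExtTensor k (S.standard l) B) =
            .tmul (ExtTensor.contractAux ε.toLinearMap s) 1 +
            .tmul (ExtTensor.contractAux ε.toLinearMap t) 1 := TensorProduct.add_tmul _ _ _
        rw [map_add, this, add_sub_add_comm]
        exact N.add_mem hs ht
    have h := key t
    have ht' : ExtTensor.contractAux ε.toLinearMap t = 0 := ht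
    have h0 : (ExtTensor.tmul (0 : S.standard l) (1 : B) : ExtTensor k (S.standard l) B) = 0 :=
      TensorProduct.zero_tmul _ _
    rwa [ht', h0, sub_zero] at h

/-- Dually, the elements killed by all non-injective endomorphisms are those `φ` vanishing on `ker
ε`, that is `φ b = ε b • φ 1`. The maps `φ ↦ φ (r * ·)` with `ε r = 0` test for this. -/
theorem IsInflation.nonempty_properCostandard_equiv (hL : IsInflation S SD ε)
    (hS : ∀ l, S.radicalImage l = ⊥) (l : Λ) :
    Nonempty (Infl ε (S.costandard l) ≃ₗ[A ⊗[k] B] SD.properCostandard l) := by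
  have : IsArtinianRing A := IsArtinianRing.of_finite k _
  have : IsArtinianRing (A ⊗[k] B) := IsArtinianRing.of_finite k _
  have := IsSimpleModule.nontrivial A (S.L l)
  have : Nontrivial (S.costandard l) := (S.costandardSocle_injective l).nontrivial
  obtain ⟨e⟩ := hL.nonempty_costandard_equiv l
  refine SD.nonempty_properCostandard_equiv e (Infl.toCoind_injective ε) fun φ => ⟨?_, ?_⟩
  · rintro ⟨x, rfl⟩ f hf
    obtain ⟨x, rfl⟩ := (Infl.mk ε _).surjective x
    let g := f ∘ₗ Infl.toCoind (A := A) ε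
    let fb : S.costandard l →ₗ[A] S.costandard l :=
      Coind.counit ∘ₗ Bi.mapLeft g ∘ₗ (Infl.biEquiv ε).symm.toLinearMap
    have hfb : ∀ x, fb x = (g (Infl.mk ε _ x)).eval 1 := fun _ => rfl
    have hni : ¬ Function.Injective fb := fun h => by
      have := hL.isSimpleModule l
      obtain ⟨y, hy⟩ := exists_ne (0 : S.L l)
      have hr := range_le_of_essential (N := LinearMap.ker f)
        (coind_comp_toCoind_essential hL.exists_equiv (S.costandardSocle_injective l)
        (S.costandardSocle_essential l)) (fun h => hf (LinearMap.ker_eq_bot.1 h))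
      have h1 := hr ⟨Infl.mk ε _ y, rfl⟩
      have h2 : fb (S.costandardSocle l y) = 0 := by
        rw [hfb]
        have h3 : Coind.map (S.costandardSocle l) (Infl.toCoind (A := A) ε (Infl.mk ε _ y)) =
            Infl.toCoind (A := A) ε (Infl.mk ε _ (S.costandardSocle l y)) := by
          refine Coind.ext fun b => ?_
          rw [Coind.map_eval, Infl.toCoind_eval, Infl.toCoind_eval]
          exact map_smul ((S.costandardSocle l).restrictScalars k) _ _
        rw [LinearMap.mem_ker, LinearMap.comp_apply, h3] at h1
        exact congrArg (fun φ => φ.eval 1) h1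
      exact hy (S.costandardSocle_injective l
        (h (h2.trans (by rw [map_zero, map_zero]))))
    have h0 : fb = 0 := SimpleSystem.end_costandard_eq_zero hS hni
    refine Coind.ext fun b => ?_
    refine (Infl.map_to_coind_eval ε g x b).trans ?_
    rw [← hfb, h0]
    rfl
  · intro h
    have hφ : ∀ r, ε r = 0 → φ.eval r = 0 := fun r hr => by
      let f : Coind k B (S.costandard l) →ₗ[A ⊗[k] B] Coind k B (S.costandard l) :=
        linearMapOfTmul
          { toFun := fun φ => Coind.mk
              ((show B →ₗ[k] S.costandard l from φ) ∘ₗ LinearMap.mulLeft k r)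
            map_zero' := rfl
            map_add' := fun _ _ => rfl }
          fun a b φ => Coind.ext fun x =>
            congrArg (a • ·) (congrArg φ.eval (mul_assoc r x b))
      have hf : ∀ φ b, (f φ).eval b = φ.eval (r * b) := fun _ _ => rfl
      have hni : ¬ Function.Injective f := fun hi => by
        obtain ⟨y, hy⟩ := exists_ne (0 : S.costandard l)
        have h0 : f (Infl.toCoind (A := A) ε (Infl.mk ε _ y)) = 0 := Coind.ext fun b => by
          rw [hf, Infl.toCoind_eval, map_mul, hr, zero_mul, zero_smul]
          rfl
        have h1 := Infl.toCoind_injective (A := A) ε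
          ((hi (h0.trans (map_zero f).symm)).trans (map_zero _).symm)
        exact hy h1
      have h1 := congrArg (fun ψ => ψ.eval 1) (h f hni)
      simpa [hf] using h1
    refine ⟨Infl.mk ε _ (φ.eval 1), Coind.ext fun b => ?_⟩
    rw [Infl.toCoind_eval, ← Coind.eval_smul]
    have h1 := hφ (b - algebraMap k B (ε b)) (by simp)
    have h2 := Coind.eval_add φ (b - algebraMap k B (ε b)) (ε b • 1)
    rw [h1, zero_add] at h2
    rw [← h2, Algebra.algebraMap_eq_smul_one, sub_add_cancel]

end Standard

end Strat

namespace Strat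

open scoped ModuleCat

/-! ### Contraction on the first factor. -/

section Contraction

variable {k A B : Type u} [Field k] [Ring A] [Ring B] [Algebra k A] [Algebra k B]
  {X N : Type u} [AddCommGroup X] [Module k X] [AddCommGroup N] [Module k N]

/-- Contraction with a functional on the first factor, as an additive map. -/
noncomputable def ExtTensor.contractLeftAux (χ : X →ₗ[k] k) : ExtTensor k X N →+ N :=
  ((TensorProduct.lid k N).toLinearMap ∘ₗ LinearMap.rTensor N χ).toAddMonoidHom

theorem ExtTensor.contractLeftAux_tmul (χ : X →ₗ[k] k) (x : X) (n : N) :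
    ExtTensor.contractLeftAux χ (ExtTensor.tmul x n : ExtTensor k X N) = χ x • n := by
  change TensorProduct.lid k N (χ x ⊗ₜ n) = _
  simp

variable [Module A X] [IsScalarTower k A X] [Module B N] [IsScalarTower k B N]

/-- Contraction of an external tensor product with a functional on the first factor. -/
noncomputable def ExtTensor.contractLeft (χ : X →ₗ[k] k) :
    Bi k A B (ExtTensor k X N) →ₗ[B] N where
  toFun t := ExtTensor.contractLeftAux χ ((Bi.mk k A B _).symm t)
  map_add' s t := by simp
  map_smul' b t := by
    obtain ⟨t, rfl⟩ := (Bi.mk k A B _).surjective t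
    rw [Bi.smul_mk_right, AddEquiv.symm_apply_apply, AddEquiv.symm_apply_apply, RingHom.id_apply]
    induction t using ExtTensor.induction_on with
    | zero => simp
    | tmul x n =>
      rw [ExtTensor.smul_tmul, one_smul, contractLeftAux_tmul, contractLeftAux_tmul, smul_comm]
    | add x y hx hy => rw [smul_add, map_add, hx, hy, map_add, smul_add]

theorem ExtTensor.contractLeft_tmul (χ : X →ₗ[k] k) (x : X) (n : N) :
    ExtTensor.contractLeft χ (Bi.mk k A B _ (ExtTensor.tmul x n : ExtTensor k X N)) = χ x • n :=
  ExtTensor.contractLeftAux_tmul χ x n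

end Contraction

/-! ### Projectivity over B and isotypic bimodules. -/

section Projective

theorem projective_finsupp {R : Type*} [Ring R] (ι : Type*) (N : Type*) [AddCommGroup N]
    [Module R N] [Module.Projective R N] : Module.Projective R (ι →₀ N) := by
  classical
  exact Module.Projective.of_equiv (finsuppLequivDFinsupp (M := N) (ι := ι) R).symm

/-- `P` is a direct summand of some `A ^ n`, so `P →ₗ[A] W` is a `B`-summand of `W ^ n`. -/
theorem projective_hom {A B P W : Type*} [Ring A] [Ring B] [AddCommGroup P] [Module A P]
    [Module.Finite A P] [Module.Projective A P] [AddCommGroup W] [Module A W] [Module B W]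
    [SMulCommClass A B W] [SMulCommClass B A W] [Module.Projective B W] :
    Module.Projective B (P →ₗ[A] W) := by
  obtain ⟨n, π, hπ⟩ := Module.Finite.exists_fin' A P
  obtain ⟨s, hs⟩ := π.exists_rightInverse_of_surjective (LinearMap.range_eq_top.2 hπ)
  have hs' : ∀ y, π (s y) = y := fun y => LinearMap.congr_fun hs y
  have : Module.Projective B (Fin n → W) :=
    have := projective_finsupp (R := B) (Fin n) W
    Module.Projective.of_equiv (Finsupp.linearEquivFunOnFinite B W (Fin n))
  let i : (P →ₗ[A] W) →ₗ[B] (Fin n → W) :=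
    { toFun := fun g j => g (π (Pi.single j 1))
      map_add' := fun _ _ => rfl
      map_smul' := fun _ _ => rfl }
  let r : (Fin n → W) →ₗ[B] (P →ₗ[A] W) :=
    { toFun := fun t =>
        { toFun := fun y => ∑ j, s y j • t j
          map_add' := fun x y => by simp [add_smul, Finset.sum_add_distrib]
          map_smul' := fun a y => by simp [Finset.smul_sum, mul_smul] }
      map_add' := fun x y => by ext; simp [Finset.sum_add_distrib]
      map_smul' := fun b y => by
        ext p
        simp only [Pi.smul_apply, LinearMap.coe_mk, AddHom.coe_mk, RingHom.id_apply,
          LinearMap.smul_apply, Finset.smul_sum]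
        exact Finset.sum_congr rfl fun j _ => smul_comm _ _ _ }
  refine Module.Projective.of_split i r (LinearMap.ext fun g => LinearMap.ext fun y => ?_)
  change ∑ j, s y j • g (π (Pi.single j 1)) = g y
  conv_rhs => rw [← hs' y, pi_eq_sum_univ' (s y), map_sum, map_sum]
  simp only [map_smul]

theorem projective_of_exact {R M N Q : Type*} [Ring R] [AddCommGroup M] [Module R M]
    [AddCommGroup N] [Module R N] [AddCommGroup Q] [Module R Q] [Module.Projective R M]
    [Module.Projective R Q] {i : N →ₗ[R] M} {q : M →ₗ[R] Q} (hi : Function.Injective i)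
    (hex : Function.Exact i q) (hq : Function.Surjective q) : Module.Projective R N := by
  obtain ⟨s, hs⟩ := q.exists_rightInverse_of_surjective (LinearMap.range_eq_top.2 hq)
  have hs' : ∀ y, q (s y) = y := fun y => LinearMap.congr_fun hs y
  have hmem : ∀ x, x - s (q x) ∈ LinearMap.range i := fun x => (hex _).1 (by simp [hs'])
  let r : M →ₗ[R] N := (LinearEquiv.ofInjective i hi).symm.toLinearMap ∘ₗ
    (LinearMap.id - s ∘ₗ q).codRestrict (LinearMap.range i) hmem
  refine Module.Projective.of_split i r (LinearMap.ext fun x => hi ?_)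
  have h : i (r (i x)) = i x - s (q (i x)) :=
    congrArg Subtype.val ((LinearEquiv.ofInjective i hi).apply_symm_apply ⟨_, hmem (i x)⟩)
  rw [LinearMap.comp_apply, h, hex.apply_apply_eq_zero, map_zero, sub_zero]
  rfl

variable {k A B : Type u} [Field k] [Ring A] [Ring B] [Algebra k A] [Algebra k B]
  {X N : Type u} [AddCommGroup X] [Module k X] [Module A X] [IsScalarTower k A X] [AddCommGroup N]
  [Module k N] [Module B N] [IsScalarTower k B N]

/-- A `k`-basis of `X` identifies `X ⊗ N` over `B` with a direct sum of copies of `N`. -/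
theorem ExtTensor.projective_right [Module.Projective B N] :
    Module.Projective B (Bi k A B (ExtTensor k X N)) := by
  classical
  let b := Module.Basis.ofVectorSpace k X
  let e := TensorProduct.equivFinsuppOfBasisLeft (N := N) b
  have he : ∀ (x : X) (n : N),
      e (x ⊗ₜ n) = (b.repr x).mapRange (· • n) (zero_smul _ _) := fun x n =>
    TensorProduct.equivFinsuppOfBasisLeft_apply_tmul b x n
  have := projective_finsupp (R := B) (Module.Basis.ofVectorSpaceIndex k X) N
  refine Module.Projective.of_equiv
    (LinearEquiv.ofBijective
      { toFun := fun t => e ((Bi.mk k A B (ExtTensor k X N)).symm t)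
        map_add' := fun s t => map_add e _ _
        map_smul' := fun c t => ?_ } e.bijective :
      Bi k A B (ExtTensor k X N) ≃ₗ[B] Module.Basis.ofVectorSpaceIndex k X →₀ N).symm
  obtain ⟨t, rfl⟩ := (Bi.mk k A B _).surjective t
  rw [Bi.smul_mk_right, AddEquiv.symm_apply_apply, AddEquiv.symm_apply_apply, RingHom.id_apply]
  induction t using ExtTensor.induction_on with
  | zero =>
    rw [smul_zero]
    exact (map_zero e).trans ((congrArg _ (map_zero e)).trans (smul_zero c)).symm
  | tmul x n =>
    rw [ExtTensor.smul_tmul, one_smul]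
    refine (he _ _).trans (Eq.trans ?_ (congrArg _ (he _ _)).symm)
    ext j
    simp only [Finsupp.mapRange_apply, Finsupp.smul_apply]
    exact smul_comm _ _ _
  | add s t hs ht =>
    rw [smul_add]
    refine (map_add e _ _).trans ((congrArg₂ _ hs ht).trans ?_)
    rw [← smul_add]
    exact congrArg _ (map_add e _ _).symm

/-- A finite-dimensional nonzero projective module over a local algebra maps onto the algebra. -/
theorem exists_surjective_of_projective [FiniteDimensional k B] [IsLocalRing B]
    [FiniteDimensional k N] [Module.Projective B N] [Nontrivial N] :
    ∃ φ : N →ₗ[B] B, Function.Surjective φ := by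
  have : Module.Finite B N := Module.Finite.of_restrictScalars_finite k B N
  obtain ⟨K, hK⟩ := IsCoatomic.exists_coatom (Submodule B N)
  have hZ : IsSimpleModule B (N ⧸ K) := isSimpleModule_iff_isCoatom.2 hK
  have := IsSimpleModule.nontrivial B (N ⧸ K)
  obtain ⟨v, hv⟩ := exists_ne (0 : N ⧸ K)
  obtain ⟨n, hn⟩ := K.mkQ_surjective v
  obtain ⟨φ, hφ⟩ := Module.projective_lifting_property (LinearMap.toSpanSingleton B (N ⧸ K) v)
    K.mkQ ((isSimpleModule_iff_toSpanSingleton_surjective.1 hZ).2 v hv)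
  have h1 : φ n • v = v := (LinearMap.congr_fun hφ n).trans hn
  -- `φ n` fixes `v ≠ 0`, whereas nonunits kill a simple module.
  have hu : IsUnit (φ n) := by
    by_contra h
    rw [smul_eq_zero_of_not_isUnit k h] at h1
    exact hv h1.symm
  obtain ⟨z, hz⟩ := hu
  exact ⟨φ, fun b => ⟨(b * ↑z⁻¹) • n, by
    rw [map_smul, ← hz, smul_eq_mul, Units.inv_mul_cancel_right]⟩⟩

/-- Projectives over a local algebra are free: copies of `B` are split off one at a time, by
induction on dimension. -/
theorem filt_extTensor_of_projective [FiniteDimensional k B] [IsLocalRing B] {J : Type*}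
    {Y : J → ModuleCat.{u} (A ⊗[k] B)} (hY : Filt Y (ExtTensor k X B)) (n : ℕ) :
    ∀ {N : Type u} [AddCommGroup N] [Module k N] [Module B N] [IsScalarTower k B N]
      [FiniteDimensional k N] [Module.Projective B N], Module.finrank k N = n →
      Filt Y (ExtTensor k X N) := by
  induction n using Nat.strong_induction_on with
  | _ n ih =>
    intro N _ _ _ _ _ _ hn
    rcases subsingleton_or_nontrivial N with hN | hN
    · have : Subsingleton (ExtTensor k X N) := inferInstanceAs (Subsingleton (X ⊗[k] N))
      exact .zero _
    obtain ⟨φ, hφ⟩ := exists_surjective_of_projective (k := k) (B := B) (N := N)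
    have hex := LinearMap.exact_subtype_ker_map φ
    let K := LinearMap.ker φ
    have : Module.Projective B K := projective_of_exact K.injective_subtype hex hφ
    have : FiniteDimensional k K := inferInstanceAs (FiniteDimensional k (K.restrictScalars k))
    have hlt : Module.finrank k K < n := by
      rw [← hn]
      refine Submodule.finrank_lt (s := K.restrictScalars k) fun h => ?_
      have h1 := (Submodule.restrictScalars_eq_top_iff k B N).1 h
      obtain ⟨x, hx⟩ := hφ 1
      have hx0 : φ x = 0 := (h1 ▸ Submodule.mem_top : x ∈ K)
      exact one_ne_zero (hx.symm.trans hx0)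
    exact (ih _ hlt rfl : Filt Y (ExtTensor k X K)).ext hY
      (ExtTensor.map LinearMap.id K.subtype) (ExtTensor.map LinearMap.id φ)
      (ExtTensor.map_right_injective X K.injective_subtype)
      (ExtTensor.map_right_exact X hex hφ)
      (ExtTensor.map_right_surjective X hφ)

/-- If `X` has only scalar endomorphisms and the restriction of `M` to `A` is a finite power of
`X`, then `M` is an external tensor product. -/
theorem nonempty_extTensor_hom_equiv (hX : ∀ f : X →ₗ[A] X, ∃ c : k, ∀ x, f x = c • x)
    {M : Type u} [AddCommGroup M] [Module (A ⊗[k] B) M] {ι : Type*} [Finite ι]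
    (e : Bi k A B M ≃ₗ[A] ι → X) :
    ∃ Φ : ExtTensor k X (X →ₗ[A] Bi k A B M) ≃ₗ[A ⊗[k] B] M,
      ∀ x f, Φ (.tmul x f) = (Bi.mk k A B M).symm (f x) := by
  classical
  have := Fintype.ofFinite ι
  let ev : ExtTensor k X (X →ₗ[A] Bi k A B M) →ₗ[A ⊗[k] B] M :=
    ExtTensor.linearMap
      (TensorProduct.liftAddHom (R := k)
        { toFun := fun x =>
            { toFun := fun f => (Bi.mk k A B M).symm (f x)
              map_zero' := rfl
              map_add' := fun _ _ => rfl }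
          map_zero' := by ext f; exact map_zero f
          map_add' := fun x y => by ext f; exact map_add f x y }
        fun c x f => map_smul (f.restrictScalars k) c x)
      fun a b x f => by
        change (Bi.mk k A B M).symm (b • f (a • x)) = (a ⊗ₜ[k] b) • (Bi.mk k A B M).symm (f x)
        have h : b • f (a • x) = a • b • f x := by rw [map_smul, smul_comm]
        exact (congrArg (Bi.mk k A B M).symm h).trans
          (Bi.smul_smul_mk a b ((Bi.mk k A B M).symm (f x)))
  have hev : ∀ x f, ev (.tmul x f) = (Bi.mk k A B M).symm (f x) := fun _ _ => rfl
  -- The inclusions of the copies of `X`. As endomorphisms of `X` are scalars, they span the Hom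
  -- space over `k`, which makes `inv` inverse to evaluation.
  let fi : ι → (X →ₗ[A] Bi k A B M) := fun i =>
    e.symm.toLinearMap ∘ₗ LinearMap.single A (fun _ => X) i
  let inv : M → ExtTensor k X (X →ₗ[A] Bi k A B M) := fun m =>
    ∑ i, .tmul (e (Bi.mk k A B M m) i) (fi i)
  have hinv_add : ∀ m m', inv (m + m') = inv m + inv m' := fun m m' => by
    simp only [inv]
    rw [← Finset.sum_add_distrib]
    refine Finset.sum_congr rfl fun i _ => ?_
    rw [map_add, map_add, Pi.add_apply]
    exact TensorProduct.add_tmul _ _ _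
  have h1 : ∀ m, ev (inv m) = m := fun m => by
    simp only [inv, map_sum, hev]
    rw [← map_sum (Bi.mk k A B M).symm]
    apply (Bi.mk k A B M).injective
    rw [AddEquiv.apply_symm_apply]
    apply e.injective
    rw [map_sum]
    simp only [fi, LinearMap.comp_apply, LinearEquiv.coe_coe, LinearEquiv.apply_symm_apply,
      LinearMap.coe_single]
    exact Finset.univ_sum_single _
  have h2 : ∀ t, inv (ev t) = t := fun t => by
    induction t using ExtTensor.induction_on with
    | zero =>
      have : inv 0 = inv 0 + inv 0 := by rw [← hinv_add, add_zero]
      rw [map_zero]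
      exact left_eq_add.1 this
    | tmul x f =>
      have hc : ∀ i, ∃ c : k, ∀ x, e (f x) i = c • x := fun i =>
        hX (LinearMap.proj i ∘ₗ e.toLinearMap ∘ₗ f)
      choose c hc using hc
      have hf : f = ∑ i, c i • fi i := by
        refine LinearMap.ext fun y => e.injective ?_
        rw [LinearMap.sum_apply, map_sum]
        funext i
        rw [hc, Finset.sum_apply, Finset.sum_eq_single i]
        · rw [LinearMap.smul_apply]
          have := congrFun (map_smul (e.toLinearMap.restrictScalars k) (c i) (fi i y)) i
          refine Eq.trans ?_ this.symm
          simp [fi]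
        · intro j _ hj
          rw [LinearMap.smul_apply]
          have := congrFun (map_smul (e.toLinearMap.restrictScalars k) (c j) (fi j y)) i
          refine this.trans ?_
          simp [fi, hj.symm]
        · simp
      rw [hev]
      simp only [inv, AddEquiv.apply_symm_apply, hc]
      conv_rhs => rw [hf]
      refine Eq.trans (Finset.sum_congr rfl fun i _ => ?_)
        (TensorProduct.tmul_sum x Finset.univ fun i => c i • fi i).symm
      exact TensorProduct.smul_tmul _ _ _
    | add s t hs ht => rw [map_add, hinv_add, hs, ht]
  exact ⟨LinearEquiv.ofBijective ev ⟨fun s t h => by rw [← h2 s, h, h2],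
    fun m => ⟨inv m, h1 m⟩⟩, hev⟩

end Projective

end Strat

namespace Strat

open scoped ModuleCat

variable {k A B : Type u} [Field k] [Ring A] [Ring B] [Algebra k A] [Algebra k B]

/-! ### B-projective modules with a costandard filtration over A. -/

section CostandardFiltrations

variable [FiniteDimensional k A] [FiniteDimensional k B] [IsLocalRing B] [IsAlgClosed k]
  {Λ : Type w} [LinearOrder Λ] {S : SimpleSystem A Λ}

theorem Filt.subsingleton {R : Type u} [Ring R] {J : Type*} [IsEmpty J] {X : J → ModuleCat.{u} R}
    {M : Type u} [AddCommGroup M] [Module R M] (h : Filt X M) : Subsingleton M := by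
  cases h with
  | zero => assumption
  | cons i j => exact isEmptyElim j

-- Subtracting an eigenvalue makes `f` non-injective, and non-injective endomorphisms of `∇ l` are
-- zero.
variable (k) in
theorem end_costandard_eq_smul (hS : ∀ l, S.radicalImage l = ⊥) {l : Λ}
    (f : S.costandard l →ₗ[A] S.costandard l) : ∃ c : k, ∀ x, f x = c • x := by
  have : IsArtinianRing A := IsArtinianRing.of_finite k A
  have := IsSimpleModule.nontrivial A (S.L l)
  have : Nontrivial (S.costandard l) := (S.costandardSocle_injective l).nontrivial
  obtain ⟨c, hc⟩ := Module.End.exists_eigenvalue (K := k) (f.restrictScalars k)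
  obtain ⟨v, hv, hv0⟩ := hc.exists_hasEigenvector
  have hv : f v = c • v := Module.End.mem_eigenspace_iff.1 hv
  let g : S.costandard l →ₗ[A] S.costandard l := f - c • LinearMap.id
  have hg : ∀ x, g x = f x - c • x := fun _ => rfl
  have hni : ¬ Function.Injective g := fun h => hv0 (h (by rw [hg, hv, sub_self, map_zero]))
  refine ⟨c, fun x => ?_⟩
  rw [← sub_eq_zero, ← hg]
  exact LinearMap.congr_fun (SimpleSystem.end_costandard_eq_zero hS hni) x

instance hom_finiteDimensional {X W : Type u} [AddCommGroup X] [Module k X] [Module A X]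
    [IsScalarTower k A X] [FiniteDimensional k X] [AddCommGroup W] [Module k W] [Module A W]
    [IsScalarTower k A W] [FiniteDimensional k W] : FiniteDimensional k (X →ₗ[A] W) :=
  Module.Finite.of_injective (LinearMap.restrictScalarsₗ k A X W k)
    (LinearMap.restrictScalars_injective k)

/-- A module over `A ⊗ B` that is projective over `B` and has a costandard filtration over `A` is
filtered by modules induced from costandard modules. -/
theorem filt_extTensor_of_filt_bi (hS : ∀ l, S.radicalImage l = ⊥) (s : Finset Λ) :
    ∀ {M : Type u} [AddCommGroup M] [Module (A ⊗[k] B) M],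
      Filt (fun m : {m // m ∈ s} => S.costandard m) (Bi k A B M) →
      Module.Projective B (Bi k A B M) →
      Filt (fun m : Λ => ModuleCat.of (A ⊗[k] B) (ExtTensor k (S.costandard m) B)) M := by
  have : IsArtinianRing A := IsArtinianRing.of_finite k A
  induction s using Finset.induction_on_max with
  | empty =>
    intro M _ _ hM _
    have : Subsingleton (Bi k A B M) := hM.subsingleton
    have : Subsingleton M := this
    exact .zero _
  | insert a s hs ih =>
    intro M _ _ hM hP
    obtain ⟨ι, _, q, hq, hK⟩ := S.exists_exact_of_filt_costandard hs hM
    have hhom : ∀ g : LinearMap.ker q →ₗ[A] S.I a, g = 0 :=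
      S.hom_hull_eq_zero_of_filt (fun j g => S.hom_costandard_eq_zero (hs _ j.2) g) hK
    -- For fixed `b`, the map `m ↦ q (b • m)` on `ker q` is `A`-linear into a power of `∇ a`, so it
    -- vanishes by `hhom`.
    have hstable : ∀ b : B, ∀ m ∈ LinearMap.ker q, b • m ∈ LinearMap.ker q := by
      intro b m hm
      rw [LinearMap.mem_ker]
      funext i
      apply S.ofCostandard_injective a
      exact (LinearMap.congr_fun (hhom (S.ofCostandard a ∘ₗ LinearMap.proj i ∘ₗ q ∘ₗ
        Bi.rightSMul b ∘ₗ (LinearMap.ker q).subtype)) ⟨m, hm⟩).trans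
          (map_zero (S.ofCostandard a)).symm
    let M' := submoduleOfBi (LinearMap.ker q) hstable
    let eK : LinearMap.ker q ≃ₗ[A] Bi k A B M' :=
      { toFun := fun x => x
        invFun := fun x => x
        left_inv := fun _ => rfl
        right_inv := fun _ => rfl
        map_add' := fun _ _ => rfl
        map_smul' := fun _ _ => rfl }
    have hex : Function.Exact (Bi.mapLeft M'.subtype) (Bi.mapLeft M'.mkQ) :=
      LinearMap.exact_subtype_mkQ M'
    have hqs : Function.Surjective (Bi.mapLeft M'.mkQ : Bi k A B M →ₗ[A] _) := M'.mkQ_surjective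
    have hker : LinearMap.ker (Bi.mapLeft M'.mkQ : Bi k A B M →ₗ[A] _) = LinearMap.ker q := by
      ext x
      refine (hex x).trans ⟨?_, fun hx => ⟨⟨x, hx⟩, rfl⟩⟩
      rintro ⟨y, rfl⟩
      exact y.2
    let e : Bi k A B (M ⧸ M') ≃ₗ[A] ι → S.costandard a :=
      ((LinearMap.quotKerEquivOfSurjective _ hqs).symm.trans
        (Submodule.quotEquivOfEq _ _ hker)).trans (LinearMap.quotKerEquivOfSurjective q hq)
    -- Over `A` the quotient is a power of `∇ a`, whose endomorphisms are scalars, so it is `∇ a ⊗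
    -- N` with `N` as below.
    obtain ⟨Φ, hΦ⟩ := nonempty_extTensor_hom_equiv (end_costandard_eq_smul k hS) e
    have hfinX : FiniteDimensional k (Bi k A B (M ⧸ M')) :=
      Module.Finite.equiv (e.restrictScalars k).symm
    let N := S.costandard a →ₗ[A] Bi k A B (M ⧸ M')
    -- composition with the quotient map is bijective on maps from the projective cover
    let c : (S.P a →ₗ[A] Bi k A B M) →ₗ[B] (S.P a →ₗ[A] Bi k A B (M ⧸ M')) :=
      { toFun := fun g => Bi.mapLeft M'.mkQ ∘ₗ g
        map_add' := fun f g => LinearMap.comp_add _ _ _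
        map_smul' := fun b g => LinearMap.ext fun x =>
          map_smul (Bi.mapRight M'.mkQ : Bi k A B M →ₗ[B] _) b (g x) }
    -- `ker q` has no nonzero map to `I a`, hence receives none from `P a`.
    have hci : Function.Injective c := by
      rw [injective_iff_map_eq_zero]
      intro g hg
      have hgk : ∀ x, g x ∈ LinearMap.ker q := fun x => by
        rw [← hker]
        exact LinearMap.congr_fun hg x
      have h0 := S.hom_to_hull_eq_zero_iff.1 hhom (g.codRestrict (LinearMap.ker q) hgk)
      exact LinearMap.ext fun x => congrArg Subtype.val (LinearMap.congr_fun h0 x)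
    have hcs : Function.Surjective c := fun g => Module.projective_lifting_property _ g hqs
    let ec := LinearEquiv.ofBijective c ⟨hci, hcs⟩
    -- Precomposition with a nonzero `f : P a → ∇ a` embeds `N` into the Hom space from `P a`, which
    -- is `B`-projective through `ec`. Under `Φ` the value `g (f y)` is `f y ⊗ g`, so contracting
    -- with `χ` and dividing by `χ (f y)` recovers `g`.
    have hN : Module.Projective B N := by
      have h0 : S.ofCostandard a ≠ 0 := fun h => by
        have := IsSimpleModule.nontrivial A (S.L a)
        obtain ⟨y, hy⟩ := exists_ne (0 : S.L a)
        apply hy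
        apply S.hull_injective a
        rw [← S.ofCostandard_costandardSocle, h, LinearMap.zero_apply, map_zero]
      obtain ⟨f, hf⟩ := S.exists_comp_of_hom_to_hull h0
      obtain ⟨y, hy⟩ : ∃ y, f y ≠ 0 := by
        by_contra! h
        exact S.hull_comp_cover_ne_zero a (hf.symm.trans (LinearMap.ext fun y => by simp [h y]))
      obtain ⟨χ, hχ⟩ := not_forall.1 (mt (Module.forall_dual_apply_eq_zero_iff k (f y)).1 hy)
      have := projective_hom (A := A) (B := B) (P := S.P a) (W := Bi k A B M)
      let i : N →ₗ[B] (S.P a →ₗ[A] Bi k A B (M ⧸ M')) :=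
        { toFun := fun g => g ∘ₗ f
          map_add' := fun _ _ => rfl
          map_smul' := fun _ _ => rfl }
      let r : (S.P a →ₗ[A] Bi k A B (M ⧸ M')) →ₗ[B] N :=
        { toFun := fun g => (χ (f y))⁻¹ •
            ExtTensor.contractLeft χ (Bi.mapRight Φ.symm.toLinearMap (g y))
          map_add' := fun g h => by simp
          map_smul' := fun b g => by
            rw [LinearMap.smul_apply, map_smul, map_smul, RingHom.id_apply, smul_comm] }
      refine Module.Projective.of_split (ec.symm.toLinearMap ∘ₗ i) (r ∘ₗ ec.toLinearMap)
        (LinearMap.ext fun g => ?_)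
      simp only [LinearMap.comp_apply, LinearEquiv.coe_coe, LinearEquiv.apply_symm_apply,
        LinearMap.id_apply]
      change (χ (f y))⁻¹ • ExtTensor.contractLeft χ
        (Bi.mapRight Φ.symm.toLinearMap (g (f y))) = g
      have h1 : Bi.mapRight Φ.symm.toLinearMap (g (f y)) =
          Bi.mk k A B (ExtTensor k (S.costandard a) N) (.tmul (f y) g) := by
        have h2 := hΦ (f y) g
        have h3 := congrArg Φ.symm h2
        rw [Φ.symm_apply_apply] at h3
        exact h3.symm
      rw [h1, ExtTensor.contractLeft_tmul, smul_smul, inv_mul_cancel₀ hχ, one_smul]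
    have hX : Module.Projective B (Bi k A B (M ⧸ M')) := by
      have := ExtTensor.projective_right (A := A) (X := S.costandard a) (k := k) (B := B) (N := N)
      exact Module.Projective.of_equiv (LinearEquiv.ofBijective
        (Bi.mapRight Φ.toLinearMap : Bi k A B (ExtTensor k (S.costandard a) N) →ₗ[B] _)
        Φ.bijective)
    have hM' : Module.Projective B (Bi k A B M') :=
      projective_of_exact (i := Bi.mapRight M'.subtype) (q := Bi.mapRight M'.mkQ)
        M'.injective_subtype (LinearMap.exact_subtype_mkQ M') M'.mkQ_surjective
    refine Filt.quotient M' (ih (hK.of_equiv eK) hM') (Filt.of_equiv ?_ Φ)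
    exact filt_extTensor_of_projective (B := B) (X := S.costandard a)
      (.single (j := a) (LinearEquiv.refl _ _)) _ rfl

end CostandardFiltrations

/-! ### Injectivity over B and self-injective local algebras. -/

section Injective

theorem injective_of_retract {R : Type u} [Ring R] {M N : Type u} [AddCommGroup M] [Module R M]
    [AddCommGroup N] [Module R N] [h : Module.Injective R M] (i : N →ₗ[R] M) (r : M →ₗ[R] N)
    (hr : ∀ x, r (i x) = x) : Module.Injective R N where
  out X Y _ _ _ _ f hf g := by
    obtain ⟨t, ht⟩ := h.out f hf (i ∘ₗ g)
    exact ⟨r ∘ₗ t, fun x => by rw [LinearMap.comp_apply, ht, LinearMap.comp_apply, hr]⟩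

theorem injective_of_exact {R : Type u} [Ring R] {M N Q : Type u} [AddCommGroup M] [Module R M]
    [AddCommGroup N] [Module R N] [AddCommGroup Q] [Module R Q] (hN : Module.Injective R N)
    (hQ : Module.Injective R Q) {i : N →ₗ[R] M} {q : M →ₗ[R] Q} (hi : Function.Injective i)
    (hex : Function.Exact i q) (hq : Function.Surjective q) : Module.Injective R M where
  out X Y _ _ _ _ f hf g := by
    obtain ⟨r, hr⟩ := hN.out i hi LinearMap.id
    obtain ⟨u, hu⟩ := hN.out f hf (r ∘ₗ g)
    obtain ⟨v, hv⟩ := hQ.out f hf (q ∘ₗ g)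
    have hinj : Function.Injective (r.prod q) := by
      rw [injective_iff_map_eq_zero]
      intro x hx
      obtain ⟨y, rfl⟩ := (hex x).1 (congrArg Prod.snd hx)
      have : r (i y) = 0 := congrArg Prod.fst hx
      rw [hr] at this
      rw [show y = 0 from this, map_zero]
    have hsurj : Function.Surjective (r.prod q) := by
      rintro ⟨a, b⟩
      obtain ⟨x, rfl⟩ := hq b
      refine ⟨x + i (a - r x), Prod.ext ?_ ?_⟩
      · change r (x + i (a - r x)) = a
        rw [map_add, hr, LinearMap.id_apply, add_sub_cancel]
      · simp [hex.apply_apply_eq_zero]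
    let e := LinearEquiv.ofBijective (r.prod q) ⟨hinj, hsurj⟩
    refine ⟨e.symm.toLinearMap ∘ₗ u.prod v, fun x => e.injective ?_⟩
    rw [LinearMap.comp_apply, LinearEquiv.coe_coe, LinearEquiv.apply_symm_apply]
    exact Prod.ext (hu x) (hv x)

theorem Filt.injective_bi {J : Type*} {X : J → ModuleCat.{u} (A ⊗[k] B)}
    (hX : ∀ j, Module.Injective B (Bi k A B (X j))) {M : Type u} [AddCommGroup M]
    [Module (A ⊗[k] B) M] (h : Filt X M) : Module.Injective B (Bi k A B M) := by
  induction h with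
  | zero M => exact ⟨fun _ _ _ _ _ _ _ _ _ => ⟨0, fun _ => Subsingleton.elim (α := M) _ _⟩⟩
  | cons i j q hi hex hq _ ih =>
    exact injective_of_exact (i := Bi.mapRight i) (q := Bi.mapRight q) ih (hX j) hi hex hq

theorem Filt.projective_bi {J : Type*} {X : J → ModuleCat.{u} (A ⊗[k] B)}
    (hX : ∀ j, Module.Projective B (Bi k A B (X j))) {M : Type u} [AddCommGroup M]
    [Module (A ⊗[k] B) M] (h : Filt X M) : Module.Projective B (Bi k A B M) := by
  induction h with
  | zero M =>
    have : Subsingleton (Bi k A B M) := inferInstanceAs (Subsingleton M)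
    infer_instance
  | @cons N M _ _ _ _ i j q hi hex hq _ ih =>
    have := hX j
    obtain ⟨s, hs⟩ := (Bi.mapRight q : Bi k A B M →ₗ[B] _).exists_rightInverse_of_surjective
      (LinearMap.range_eq_top.2 hq)
    have hs' : ∀ y, Bi.mapRight q (s y) = y := fun y => LinearMap.congr_fun hs y
    have hq0 : ∀ n, Bi.mapRight q (Bi.mapRight (k := k) (A := A) (B := B) i n) = 0 := fun n =>
      hex.apply_apply_eq_zero n
    let t : Bi k A B N × Bi k A B (X j) →ₗ[B] Bi k A B M := (Bi.mapRight i).coprod s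
    have ht : ∀ x, t x = Bi.mapRight i x.1 + s x.2 := fun _ => rfl
    refine Module.Projective.of_equiv (LinearEquiv.ofBijective t ⟨?_, fun m => ?_⟩)
    · rw [injective_iff_map_eq_zero]
      rintro ⟨n, y⟩ h
      rw [ht] at h
      have hy : y = 0 := by
        have := congrArg (Bi.mapRight q) h
        rwa [map_add, hq0, hs', zero_add, map_zero] at this
      subst hy
      rw [map_zero, add_zero] at h
      exact Prod.ext (hi (h.trans (map_zero (Bi.mapRight i)).symm)) rfl
    · obtain ⟨n, hn⟩ := (hex (m - s (Bi.mapRight q m) : Bi k A B M)).1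
        (show Bi.mapRight q (m - s (Bi.mapRight q m)) = 0 by rw [map_sub, hs', sub_self])
      refine ⟨(n, Bi.mapRight q m), ?_⟩
      rw [ht]
      exact (congrArg (· + s (Bi.mapRight q m)) hn).trans (sub_add_cancel _ _)

theorem ExtTensor.contract_smul {X : Type u} [AddCommGroup X] [Module k X] [Module A X]
    [IsScalarTower k A X] (χ : B →ₗ[k] k) (b : B) (t : ExtTensor k X B) :
    ExtTensor.contract χ (b • Bi.mk k A B (ExtTensor k X B) t) =
      ExtTensor.contract (χ ∘ₗ LinearMap.mulLeft k b) (Bi.mk k A B (ExtTensor k X B) t) := by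
  induction t using ExtTensor.induction_on with
  | zero => simp
  | tmul x n =>
    rw [Bi.smul_mk_right, ExtTensor.smul_tmul, one_smul, contract_tmul, contract_tmul]
    rfl
  | add s t hs ht => rw [map_add, smul_add, map_add, hs, ht, map_add]

variable [FiniteDimensional k B] [IsLocalRing B]

/-- A self-injective local algebra is isomorphic to its dual. -/
theorem nonempty_equiv_coind {ε : B →ₐ[k] k} (hε : ∀ b, ε b = 0 ↔ ¬ IsUnit b)
    [h : Module.Injective B B] : Nonempty (B ≃ₗ[B] Coind k B k) := by
  have : IsArtinianRing B := IsArtinianRing.of_finite k B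
  obtain ⟨Z, hZ⟩ := IsAtomic.exists_atom (Submodule B B)
  have : IsSimpleModule B Z := isSimpleModule_iff_isAtom.2 hZ
  have := IsSimpleModule.nontrivial B Z
  obtain ⟨z, hz⟩ := exists_ne (0 : Z)
  have hbz : ∀ b : B, b • (z : B) = ε b • (z : B) := fun b =>
    congrArg Subtype.val (smul_eq_of_isSimpleModule hε b z)
  have hfin : Module.Finite k (Coind k B k) := inferInstanceAs (Module.Finite k (B →ₗ[k] k))
  have : Module.Finite B (Coind k B k) := Module.Finite.of_restrictScalars_finite k B _
  -- The multiples of `ε`, which form the socle of the dual. The map `g` sends them into the simple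
  -- left ideal generated by `z`.
  let K : Submodule B (Coind k B k) :=
    { carrier := {φ | ∀ b, φ.eval b = ε b * φ.eval 1}
      add_mem' := fun {φ ψ} hφ hψ b => by
        rw [Coind.add_eval, Coind.add_eval, hφ, hψ, mul_add]
      zero_mem' := fun b => by simp
      smul_mem' := fun c φ hφ b => by
        rw [Coind.smul_right_eval, Coind.smul_right_eval, hφ, hφ (1 * c), map_mul, one_mul,
          mul_assoc] }
  let g : K →ₗ[B] B :=
    { toFun := fun φ => φ.1.eval 1 • (z : B)
      map_add' := fun φ ψ => add_smul _ _ _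
      map_smul' := fun b φ => by
        change (b • φ.1).eval 1 • (z : B) = b • φ.1.eval 1 • (z : B)
        rw [Coind.smul_right_eval, one_mul, φ.2 b, smul_comm b, hbz, smul_smul, mul_comm] }
  obtain ⟨f, hf⟩ := h.out K.subtype K.injective_subtype g
  -- A simple submodule of the kernel would lie in `K`, where `f` agrees with the injective map `g`.
  -- Surjectivity then follows from equal dimensions.
  have hfi : Function.Injective f := by
    rw [← LinearMap.ker_eq_bot]
    by_contra hne
    obtain ⟨Z', hZ', hle⟩ := (eq_bot_or_exists_atom_le (LinearMap.ker f)).resolve_left hne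
    have : IsSimpleModule B Z' := isSimpleModule_iff_isAtom.2 hZ'
    have := IsSimpleModule.nontrivial B Z'
    obtain ⟨φ, hφ⟩ := exists_ne (0 : Z')
    have hφK : φ.1 ∈ K := fun b => by
      have h1 : b • φ.1 = ε b • φ.1 := congrArg Subtype.val (smul_eq_of_isSimpleModule hε b φ)
      have h2 := congrArg (fun ψ => ψ.eval 1) h1
      simp only [Coind.smul_right_eval, one_mul] at h2
      exact h2
    have h0 : φ.1.eval 1 • (z : B) = 0 := (hf ⟨φ.1, hφK⟩).symm.trans (hle φ.2)
    have h1 : φ.1.eval 1 = 0 :=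
      (smul_eq_zero.1 h0).resolve_right fun h => hz (Subtype.ext h)
    refine hφ (Subtype.ext (Coind.ext fun b => ?_))
    rw [hφK b, h1, mul_zero]
    rfl
  have hfs : Function.Surjective f :=
    (LinearMap.injective_iff_surjective_of_finrank_eq_finrank (f := f.restrictScalars k)
      (Subspace.dual_finrank_eq (K := k) (V := B))).1 hfi
  exact ⟨(LinearEquiv.ofBijective f ⟨hfi, hfs⟩).symm⟩

/-- Inducing and coinducing agree over a self-injective local algebra. -/
theorem nonempty_extTensor_equiv_coind (e : B ≃ₗ[B] Coind k B k) {X : Type u} [AddCommGroup X]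
    [Module k X] [Module A X] [IsScalarTower k A X] [FiniteDimensional k X] :
    Nonempty (ExtTensor k X B ≃ₗ[A ⊗[k] B] Coind k B X) := by
  -- A Frobenius form: `(b, c) ↦ χ (b * c)` is nondegenerate because `e` is bijective. The
  -- isomorphism sends `x ⊗ c` to `b ↦ χ (b * c) • x`.
  let χ : B →ₗ[k] k :=
    { toFun := fun b => (e b).eval 1
      map_add' := fun b c => by rw [map_add, Coind.add_eval]
      map_smul' := fun c b => congrArg (fun φ => φ.eval 1)
        (map_smul (e.toLinearMap.restrictScalars k) c b) }
  have hχ : ∀ b c, χ (b * c) = (e c).eval b := fun b c => by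
    change (e (b • c)).eval 1 = _
    rw [map_smul, Coind.smul_right_eval, one_mul]
  let θ : B →ₗ[k] Module.Dual k B :=
    { toFun := fun b => χ ∘ₗ LinearMap.mulLeft k b
      map_add' := fun b c => by ext; simp [add_mul]
      map_smul' := fun c b => by ext; simp }
  have hθi : Function.Injective θ := by
    rw [injective_iff_map_eq_zero]
    intro b hb
    refine (Module.forall_dual_apply_eq_zero_iff k b).1 fun φ => ?_
    obtain ⟨c, hc⟩ := e.surjective (Coind.mk φ)
    rw [← Coind.eval_mk φ b, ← hc, ← hχ]
    exact LinearMap.congr_fun hb c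
  have hθs : Function.Surjective θ :=
    (LinearMap.injective_iff_surjective_of_finrank_eq_finrank
      (Subspace.dual_finrank_eq (K := k) (V := B)).symm).1 hθi
  let f : ExtTensor k X B →ₗ[A ⊗[k] B] Coind k B X := Coind.lift (ExtTensor.contract χ)
  have hfi : Function.Injective f := by
    rw [injective_iff_map_eq_zero]
    intro t ht
    refine ExtTensor.eq_zero_of_contract (A := A) (t := Bi.mk k A B _ t) fun ψ => ?_
    obtain ⟨b, rfl⟩ := hθs ψ
    refine (ExtTensor.contract_smul χ b t).symm.trans ?_
    exact congrArg (fun φ => φ.eval b) ht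
  have : Module.Finite k (ExtTensor k X B) := inferInstanceAs (Module.Finite k (X ⊗[k] B))
  have : Module.Finite k (Coind k B X) := inferInstanceAs (Module.Finite k (B →ₗ[k] X))
  have hd : Module.finrank k (ExtTensor k X B) = Module.finrank k (Coind k B X) :=
    (Module.finrank_tensorProduct (R := k) (S := k) (M := X) (M' := B)).trans
      ((mul_comm _ _).trans (Module.finrank_linearMap k k B X).symm)
  have hfs : Function.Surjective f :=
    (LinearMap.injective_iff_surjective_of_finrank_eq_finrank (f := f.restrictScalars k) hd).1 hfi
  exact ⟨LinearEquiv.ofBijective f ⟨hfi, hfs⟩⟩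

end Injective

end Strat

/-! ### Tilting and cotilting modules of A ⊗ B. -/

namespace Strat

open scoped ModuleCat

variable {k A B : Type u} [Field k] [Ring A] [Ring B] [Algebra k A] [Algebra k B]
  {Λ : Type w} {S : SimpleSystem A Λ} {SD : SimpleSystem (A ⊗[k] B) Λ} {ε : B →ₐ[k] k}

theorem SimpleSystem.nonempty_index [Nontrivial A] (S : SimpleSystem A Λ) : Nonempty Λ := by
  obtain ⟨I, hI⟩ := Ideal.exists_maximal A
  have : IsSimpleModule A (A ⧸ I) := isSimpleModule_iff_isCoatom.2 hI.out
  exact (S.exists_iso (A ⧸ I)).nonempty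

variable [LinearOrder Λ] [FiniteDimensional k A] [FiniteDimensional k B]

namespace IsInflation

theorem projective_standard_bi (hL : IsInflation S SD ε) (l : Λ) :
    Module.Projective B (Bi k A B (SD.standard l)) := by
  obtain ⟨e⟩ := (hL.nonempty_standard_equiv l).1
  have := ExtTensor.projective_right (A := A) (X := S.standard l) (k := k) (B := B) (N := B)
  exact Module.Projective.of_equiv (LinearEquiv.ofBijective
    (Bi.mapRight e.symm.toLinearMap : Bi k A B (ExtTensor k (S.standard l) B) →ₗ[B] _)
    e.symm.bijective)

theorem injective_costandard_bi (hL : IsInflation S SD ε) (l : Λ) :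
    Module.Injective B (Bi k A B (SD.costandard l)) := by
  obtain ⟨e⟩ := hL.nonempty_costandard_equiv l
  have := Coind.injective_right (k := k) (A := A) (B := B) (X := S.costandard l)
  exact injective_of_retract
    (Bi.mapRight e.symm.toLinearMap : Bi k A B (SD.costandard l) →ₗ[B] _)
    (Bi.mapRight e.toLinearMap) e.apply_symm_apply

/-- The costandard filtration makes `M` injective over `B`. Its top standard factor `Δ ⊗ B`
contracts onto `B` by a functional on `Δ`, and since `B` is projective it is a summand of `M`. -/
theorem injective_of_filt (hL : IsInflation S SD ε) {M : Type u} [AddCommGroup M]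
    [Module (A ⊗[k] B) M] [Nontrivial M] (h : Filt SD.standard M) (h' : Filt SD.costandard M) :
    Module.Injective B B := by
  have hM : Module.Injective B (Bi k A B M) := h'.injective_bi hL.injective_costandard_bi
  cases h with
  | zero => exact (not_subsingleton M ‹_›).elim
  | cons i l q hi hex hq hN =>
    have : IsArtinianRing A := IsArtinianRing.of_finite k A
    have := IsSimpleModule.nontrivial A (S.L l)
    have : Nontrivial (S.standard l) := (S.standardTop_surjective l).nontrivial
    obtain ⟨x, hx⟩ := exists_ne (0 : S.standard l)
    obtain ⟨χ, hχ⟩ := not_forall.1 (mt (Module.forall_dual_apply_eq_zero_iff k x).1 hx)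
    obtain ⟨e⟩ := (hL.nonempty_standard_equiv l).1
    let r : Bi k A B M →ₗ[B] B := ExtTensor.contractLeft (N := B) χ ∘ₗ
      Bi.mapRight (e.toLinearMap ∘ₗ q)
    have hr : Function.Surjective r := fun b => by
      obtain ⟨m, hm⟩ := (e.surjective.comp hq) (.tmul x ((χ x)⁻¹ • b))
      refine ⟨Bi.mk k A B M m, ?_⟩
      have := ExtTensor.contractLeft_tmul (A := A) (B := B) χ x ((χ x)⁻¹ • b)
      rw [smul_smul, mul_inv_cancel₀ hχ, one_smul] at this
      exact (congrArg (fun t => ExtTensor.contractLeft χ (Bi.mk k A B _ t)) hm).trans this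
    obtain ⟨s, hs⟩ := r.exists_rightInverse_of_surjective (LinearMap.range_eq_top.2 hr)
    exact injective_of_retract s r (LinearMap.congr_fun hs)

variable [IsLocalRing B]

theorem filt_standard (hL : IsInflation S SD ε) (hε : ∀ b, ε b = 0 ↔ ¬ IsUnit b)
    (hS : ∀ l, S.radicalImage l = ⊥) (l : Λ) :
    Filt (fun _ : Unit => SD.properStandard l) (SD.standard l) := by
  obtain ⟨e⟩ := (hL.nonempty_standard_equiv l).1
  obtain ⟨f⟩ := hL.nonempty_properStandard_equiv hS l
  exact (filt_extTensor_of_finiteDimensional hε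
    (Filt.single (X := fun _ : Unit => SD.properStandard l) (j := ()) f.symm) _ rfl).of_equiv e.symm

theorem isProperlyStratified (hL : IsInflation S SD ε) (hε : ∀ b, ε b = 0 ↔ ¬ IsUnit b)
    (hA : S.IsQuasiHereditary) : SD.IsProperlyStratified := by
  refine ⟨fun l => ?_, fun l => hasFiltration_iff.2 (hL.filt_standard hε hA.2 l)⟩
  obtain ⟨e⟩ := (hL.nonempty_standard_equiv l).2
  refine hasFiltration_iff.2 (Filt.of_equiv (Filt.extTensor (fun j => ?_)
    (hasFiltration_iff.1 (hA.1 l))) e)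
  obtain ⟨f⟩ := (hL.nonempty_standard_equiv j.1).1
  exact .single (j := j) f.symm

/-- The standard filtration gives projectivity over `B`, and the proper costandard one restricts to
a costandard filtration over `A`. Hence `M` is filtered by the modules `∇ ⊗ B`, which are the
costandard modules since `B` is isomorphic to its dual. -/
theorem filt_costandard_of_filt [IsAlgClosed k] [Finite Λ] (hL : IsInflation S SD ε)
    (hε : ∀ b, ε b = 0 ↔ ¬ IsUnit b) (hS : ∀ l, S.radicalImage l = ⊥) [Module.Injective B B]
    {M : Type u} [AddCommGroup M] [Module (A ⊗[k] B) M] (h : Filt SD.standard M)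
    (h' : Filt SD.properCostandard M) : Filt SD.costandard M := by
  have := Fintype.ofFinite Λ
  have hP : Module.Projective B (Bi k A B M) := h.projective_bi hL.projective_standard_bi
  have hbi : Filt (fun m : {m // m ∈ (Finset.univ : Finset Λ)} => S.costandard m) (Bi k A B M) := by
    refine h'.bi fun l => ?_
    obtain ⟨e⟩ := hL.nonempty_properCostandard_equiv hS l
    exact .single (j := ⟨l, Finset.mem_univ l⟩) ((LinearEquiv.ofBijective
      (Bi.mapLeft e.symm.toLinearMap : Bi k A B (SD.properCostandard l) →ₗ[A] _)
      e.symm.bijective).trans (Infl.biEquiv ε))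
  refine (filt_extTensor_of_filt_bi hS Finset.univ hbi hP).trans fun l => ?_
  obtain ⟨e⟩ := nonempty_equiv_coind hε
  obtain ⟨f⟩ := nonempty_extTensor_equiv_coind (A := A) e (X := S.costandard l)
  obtain ⟨g⟩ := hL.nonempty_costandard_equiv l
  exact .single (f.trans g)

theorem isCotilting_of_isTilting [IsAlgClosed k] [Finite Λ] (hL : IsInflation S SD ε)
    (hε : ∀ b, ε b = 0 ↔ ¬ IsUnit b) (hS : ∀ l, S.radicalImage l = ⊥) [Module.Injective B B]
    {M : Type u} [AddCommGroup M] [Module (A ⊗[k] B) M] (h : SD.IsTilting M) :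
    SD.IsCotilting M := by
  have h1 := hasFiltration_iff.1 h.1
  refine ⟨hasFiltration_iff.2 (h1.trans fun l => (hL.filt_standard hε hS l).trans fun _ =>
    .single (.refl _ _)), hasFiltration_iff.2 ?_⟩
  exact hL.filt_costandard_of_filt hε hS h1 (hasFiltration_iff.1 h.2)

/-- The standard module of a minimal index is tilting. -/
theorem isTilting_standard (hL : IsInflation S SD ε) (hε : ∀ b, ε b = 0 ↔ ¬ IsUnit b)
    (hS : ∀ l, S.radicalImage l = ⊥) {l : Λ} (hl : ∀ m, l ≤ m) :
    SD.IsTilting (SD.standard l) := by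
  have : IsArtinianRing A := IsArtinianRing.of_finite k A
  refine ⟨hasFiltration_iff.2 (.single (.refl _ _)), hasFiltration_iff.2 ?_⟩
  obtain ⟨e⟩ := (hL.nonempty_standard_equiv l).1
  -- For minimal `l` the modules `Δ l` and `∇ l` agree, so the inflation of `Δ l`, which filters `Δ
  -- l ⊗ B`, is proper costandard.
  obtain ⟨f⟩ := S.nonempty_standard_equiv_costandard hS hl
  obtain ⟨g⟩ := hL.nonempty_properCostandard_equiv hS l
  exact (filt_extTensor_of_finiteDimensional hε
    (Filt.single ((Infl.congr ε f).trans g)) _ rfl).of_equiv e.symm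

end IsInflation

theorem SimpleSystem.IsCharacteristicTilting.isTilting {R : Type u} [Ring R] [Finite Λ]
    {S : SimpleSystem R Λ} {T : Type u} [AddCommGroup T] [Module R T]
    (h : S.IsCharacteristicTilting T) : S.IsTilting T := by
  obtain ⟨X, hX, ⟨e⟩⟩ := h
  exact ⟨hasFiltration_iff.2 (.pi (fun l => hasFiltration_iff.1 (hX l).2.1.1) e),
    hasFiltration_iff.2 (.pi (fun l => hasFiltration_iff.1 (hX l).2.1.2) e)⟩

theorem SimpleSystem.IsCharacteristicTilting.nontrivial {R : Type u} [Ring R] [Nonempty Λ]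
    {S : SimpleSystem R Λ} {T : Type u} [AddCommGroup T] [Module R T]
    (h : S.IsCharacteristicTilting T) : Nontrivial T := by
  obtain ⟨X, hX, ⟨e⟩⟩ := h
  have : ∀ l, Nontrivial (X l) := fun l => (hX l).1.1
  obtain ⟨l⟩ := ‹Nonempty Λ›
  have : Nontrivial (∀ l, X l) := Pi.nontrivial_at l
  exact e.toEquiv.nontrivial

end Strat

theorem corollary38 (k : Type u) [Field k] [IsAlgClosed k]
    (A B : Type u) [Ring A] [Ring B] [Algebra k A] [Algebra k B]
    [FiniteDimensional k A] [FiniteDimensional k B] [Nontrivial A] [IsLocalRing B]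
    (Λ : Type w) [LinearOrder Λ] [Finite Λ]
    (S : Strat.SimpleSystem A Λ) (hA : S.IsQuasiHereditary)
    (LB : ModuleCat.{u} B) (hLB : IsSimpleModule B LB)
    (SD : Strat.SimpleSystem (A ⊗[k] B) Λ)
    (hSD : ∀ l, Strat.IsExternalTensor k (S.L l) LB (SD.L l)) :
    SD.IsProperlyStratified ∧
    ((∀ (M : Type u) [AddCommGroup M] [Module (A ⊗[k] B) M], SD.IsTilting M → SD.IsCotilting M) ↔
      Module.Injective B B) ∧
    (∀ (T : Type u) [AddCommGroup T] [Module (A ⊗[k] B) T], SD.IsCharacteristicTilting T →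
      (SD.IsCotilting T ↔ Module.Injective B B)) := by
  obtain ⟨ε, hε⟩ := Strat.exists_augmentation (k := k) (B := B)
  have hL := Strat.isInflation_of_isExternalTensor hε LB hSD
  have := S.nonempty_index
  refine ⟨hL.isProperlyStratified hε hA, ⟨fun h => ?_, fun _ _ _ _ hM =>
    hL.isCotilting_of_isTilting hε hA.2 hM⟩, fun T _ _ hT => ⟨fun h => ?_, fun _ =>
    hL.isCotilting_of_isTilting hε hA.2 hT.isTilting⟩⟩
  · obtain ⟨l, hl⟩ := Finite.exists_min (id : Λ → Λ)
    change ∀ m, l ≤ m at hl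
    have hM := hL.isTilting_standard (l := l) hε hA.2 hl
    have : IsArtinianRing (A ⊗[k] B) := IsArtinianRing.of_finite k _
    have := IsSimpleModule.nontrivial (A ⊗[k] B) (SD.L l)
    have : Nontrivial (SD.standard l) := (SD.standardTop_surjective l).nontrivial
    exact hL.injective_of_filt (Strat.hasFiltration_iff.1 hM.1)
      (Strat.hasFiltration_iff.1 (h _ hM).2)
  -- All that is needed of `T` is that it is tilting and nonzero.
  · have := hT.nontrivial
    exact hL.injective_of_filt (Strat.hasFiltration_iff.1 hT.isTilting.1)
      (Strat.hasFiltration_iff.1 h.2)
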